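/- **Setting.** Let $T>0$, $n,m\ge 0$, $r\ge1$, $f:[0,T]\times\mathbb R^n\times\mathbb R^m\to\mathbb R^n$, $U:[0,T]\rightrightarrows\mathbb R^m$, $\psi_1,\dots,\psi_r:\mathbb R^n\to\mathbb R$, $C_i=\{\psi_i\le 0\}$, $C=\bigcap_i C_i$, and let $\varphi:\mathbb R^n\to\mathbb R\cup\{\infty\}$ be lower semicontinuous with $\operatorname{dom}\varphi=C$. Let $\mathscr U$ be the set of Lebesgue measurable $u:[0,T]\to\mathbb R^m$ with $u(t)\in U(t)$ a.e. Let $\partial\varphi$ be the Clarke subdifferential ($\partial\varphi(x)=\emptyset$ for $x\notin C$). Assume: * $C$ is nonempty and compact, and $\operatorname{int}C$ is connected; $C_0\subset C$ is nonempty and closed. * There is $M>0$ such that for a.e. $t$: $(x,u)\mapsto f(t,x,u)$ is continuous on $C\times U(t)$, $\|f(t,x,u)-f(t,y,u)\|\le M\|x-y\|$ and $\|f(t,x,u)\|\le M$ for $x,y\in C$, $u\in U(t)$. For fixed $x\in C$, $f(\cdot,x,u)$ is Lebesgue measurable for each $u\in\bigcup_{t\in[0,T]} U(t)$, and $t\mapsto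 f(t,x,u(t))$ is Lebesgue measurable for each $u(\cdot)\in\mathscr U$. * For some $\rho>0$ each $\psi_i$ is $\mathcal C^{1,1}$ (differentiable with locally Lipschitz gradient) on $C+\rho B$. For some $\eta>0$, $\|\sum_i\lambda_i\nabla\psi_i(c)\|>2\eta$ whenever $c\in C$, $\lambda_i\ge0$, $\sum_i\lambda_i=1$ and $\lambda_i=0$ for all $i$ with $\psi_i(c)\ne0$. Let $M_\psi\ge 4\eta/\rho$ be such that each $\nabla\psi_i$ is $2M_\psi$-Lipschitz on $C+\frac\rho2\bar B$. * $\varphi$ is Lipschitz on $C$ and $\mathcal C^1$ on $\operatorname{int}C$, and $\nabla\varphi$ is Lipschitz on $\operatorname{int}C$. The sweeping process with data $(x_0,u)$, $x_0\in C_0$, is $$(D)\qquad \dot x(t)\in f(t,x(t),u(t))-\partial\varphi(x(t))\ \text{ a.e. } t\in[0,T],\qquad x(0)=x_0,$$ for absolutely continuous $x$. **Theorem.** There are $\varPhi\in \mathcal C^{1,1}(\mathbb R^n)$ and $K>0$ with $\varPhi=\varphi$ on $C$, $|\varPhi|\le K$, $\|\nabla\varPhi\|\le K$, and $\nabla\varPhi$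 $K$-Lipschitz. Moreover, for any such $\varPhi,K$, put $f_\varPhi=f-\nabla\varPhi$ and $\bar M=M+K$, and let $(\gamma_k)$ be any sequence with $\gamma_k>2\bar M/\eta$ and $\gamma_k\to\infty$. Put $C^{\gamma_k}=\{\sum_i e^{\gamma_k\psi_i}\le1\}$, $C^{\gamma_k}(k)=\{\sum_ie^{\gamma_k\psi_i}\le \frac{2\bar M}{\eta\gamma_k}\}$, and, for $c\in C^{\gamma_k}$, $u\in\mathscr U$, consider absolutely continuous $x:[0,T]\to C$ with $$(D_{\gamma_k})\qquad \dot x(t)=f_\varPhi(t,x(t),u(t))-\sum_{i=1}^r\gamma_ke^{\gamma_k\psi_i(x(t))}\nabla\psi_i(x(t))\ \text{ a.e.},\qquad x(0)=c.$$ There is $k_3$ such that for all $k\ge k_3$ the set $C^{\gamma_k}$ is nonempty, and for all $c\in C^{\gamma_k}$, $u\in\mathscr U$, $(D_{\gamma_k})$ has exactly one solution, which lies in $W^{1,2}([0,T];\mathbb R^n)$ and stays in $C^{\gamma_k}$; and the following hold. **(I)** Let $c_{\gamma_k}\in C^{\gamma_k}$ $(k\ge k_3)$ converge to $x_0\in C_0$,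 let $u_{\gamma_k}\in\mathscr U$, let $x_{\gamma_k}$ $(k\ge k_3)$ be the corresponding solutions of $(D_{\gamma_k})$, and let $\xi^i_{\gamma_k}(t)=\gamma_ke^{\gamma_k\psi_i(x_{\gamma_k}(t))}$, $\xi_{\gamma_k}=\sum_i\xi^i_{\gamma_k}$. (i) Along a subsequence, $x_{\gamma_k}\to x$ uniformly and $\dot x_{\gamma_k}\rightharpoonup\dot x$ weakly in $L^2$, where $x\in W^{1,2}$ has values in $C$ and $$\|x\|_\infty\le\|x_0\|+\sqrt{(\bar MT)^2+2T},\qquad \int_0^T\|\dot x\|^2dt\le\bar M^2T+2.\tag{1}$$ (ii) $(\|\xi_{\gamma_k}\|_2^2)_{k\ge k_3}$ is bounded. Any subsequence along which $x_{\gamma_k}$ converges uniformly to some $x$ has a further subsequence along which $\xi^i_{\gamma_k}\rightharpoonup\xi^i$ $(i=1,\dots,r)$ and $\xi_{\gamma_k}\rightharpoonup\xi:=\sum_i\xi^i$ weakly in $L^2$, where $\xi^i\ge0$, $$\xi^i(t)=0\ \text{ if } x(t)\in\operatorname{int}C_i,\qquad \xi(t)=0\ \text{ if } x(t)\in\operatorname{int}C;\tag{2}$$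 and $x$ is a $C$-valued function in $W^{1,2}$ satisfying (1). (iii) Let $x_{\gamma_k}\to x$ uniformly and $\xi_{\gamma_k}^i\rightharpoonup\xi^i$ weakly in $L^2$ for all $i$ along a common subsequence. If along it $u_{\gamma_k}(t)\to u(t)$ for a.e. $t$, where $u\in\mathscr U$, then $x$ is the unique solution of $(D)$ for $(x_0,u)$, and $$\dot x(t)=f_\varPhi(t,x(t),u(t))-\sum_{i=1}^r\xi^i(t)\nabla\psi_i(x(t))\ \text{ a.e.},\tag{3}$$ $$\|\xi^i\|_\infty\le\tfrac{\bar M}{2\eta}\ (i=1,\dots,r),\qquad\|\xi\|_\infty\le\tfrac{\bar M}{2\eta},\tag{4}$$ $$\|f_\varPhi(t,x(t),u(t))-\dot x(t)\|\le\|f_\varPhi(t,x(t),u(t))\|\ \text{ a.e.},\tag{5}$$ $$\langle f_\varPhi(t,x(t),u(t))-\dot x(t),z-x(t)\rangle\le\tfrac{\bar MM_\psi}{2\eta}\|z-x(t)\|^2\quad\forall z\in C,\ \text{a.e. } t.\tag{6}$$ (iv) Let $x,\xi^i$ be limits along a common subsequence as in (iii), with no assumption on $(u_{\gamma_k})$.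 If the graph of $U$ is $\mathscr L\times\mathscr B$-measurable, the sets $U(t)$ are closed and bounded uniformly in $t$, and, for a.e. $t$, $f(t,y,U(t))$ is convex for all $y\in C$, then there is $u\in\mathscr U$ such that $x$ is the unique solution of $(D)$ for $(x_0,u)$ and (3)–(6) hold. **(II)** Conversely, let $x_0\in C_0$, $\bar u\in\mathscr U$. There are sequences $(c_{\gamma_k})$ converging to $x_0$ with $c_{\gamma_k}\in\operatorname{int}C^{\gamma_k}(k)$ for large $k$. The system $(D)$ for $(x_0,\bar u)$ has a unique solution $\bar x$; and for every such sequence, if $x_{\gamma_k}$ (for large $k$) solves $(D_{\gamma_k})$ for $(c_{\gamma_k},\bar u)$, then $x_{\gamma_k}(t)\in C^{\gamma_k}$ for all $t\in[0,T]$ and all large $k$, and along a subsequence $x_{\gamma_k}\to\bar x$ uniformly, $\xi^i_{\gamma_k}\rightharpoonup\xi^i\ge0$ weakly in $L^2$ (and $\xi_{\gamma_k}\rightharpoonup\xi=\sum_i\xi^i$), where $\bar x\in W^{1,2}$ is $C$-valued and $(\bar x,\bar u,(\xi^i)_i)$ satisfies (1)–(6). -/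

import Mathlib

open Set Filter Topology MeasureTheory

noncomputable section

namespace Sweeping

/-- The Euclidean space of dimension `n`. -/
abbrev E (n : ℕ) : Type := EuclideanSpace ℝ (Fin n)

/-! ### Clarke subdifferential of an extended-real-valued function -/

/-- The Clarke tangent cone to `S` at `a`, in its sequential form. -/
def clarkeTangentCone {V : Type*} [NormedAddCommGroup V] [NormedSpace ℝ V]
    (S : Set V) (a : V) : Set V :=
  {v | ∀ (y : ℕ → V) (τ : ℕ → ℝ), (∀ k, y k ∈ S) → Tendsto y atTop (𝓝 a) →
      (∀ k, 0 < τ k) → Tendsto τ atTop (𝓝 0) →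
      ∃ w : ℕ → V, Tendsto w atTop (𝓝 v) ∧ ∀ k, y k + τ k • w k ∈ S}

/-- The epigraph of an extended-real-valued function, as a subset of `V × ℝ`. -/
def epigraph {V : Type*} (φ : V → EReal) : Set (V × ℝ) :=
  {p | φ p.1 ≤ (p.2 : EReal)}

/-- The Clarke subdifferential: `ζ ∈ ∂φ(x)` iff `x ∈ dom φ` and `(ζ, -1)` belongs to the Clarke
normal cone (the polar of the Clarke tangent cone) to the epigraph of `φ` at `(x, φ x)`. -/
def clarkeSubdifferential {n : ℕ} (φ : E n → EReal) (x : E n) : Set (E n) :=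
  {ζ | φ x ≠ ⊤ ∧ ∀ p ∈ clarkeTangentCone (epigraph φ) (x, (φ x).toReal),
      inner ℝ ζ p.1 + (-1) * p.2 ≤ 0}

/-! ### The sweeping set and its approximations -/

/-- `C_i`, the zero-sublevel set of `ψ_i`. -/
def sublevel {n r : ℕ} (ψ : Fin r → E n → ℝ) (i : Fin r) : Set (E n) := {x | ψ i x ≤ 0}

/-- `C`, the intersection of the zero-sublevel sets `C_i`. -/
def sweepingSet {n r : ℕ} (ψ : Fin r → E n → ℝ) : Set (E n) := ⋂ i, sublevel ψ i

/-- `C^γ`, the set where `∑ i, exp (γ ψ_i) ≤ 1`. -/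
def approxSet {n r : ℕ} (ψ : Fin r → E n → ℝ) (γ : ℝ) : Set (E n) :=
  {x | ∑ i, Real.exp (γ * ψ i x) ≤ 1}

/-- The smaller set `C^γ(k)`, where `∑ i, exp (γ ψ_i) ≤ 2 Mbar / (η γ)`. -/
def innerApproxSet {n r : ℕ} (ψ : Fin r → E n → ℝ) (Mbar η γ : ℝ) : Set (E n) :=
  {x | ∑ i, Real.exp (γ * ψ i x) ≤ 2 * Mbar / (η * γ)}

/-- The multiplier `ξ^i_γ(t) = γ exp (γ ψ_i (x t))` along a curve `x`. -/
def multiplier {n r : ℕ} (ψ : Fin r → E n → ℝ) (γ : ℝ) (x : ℝ → E n) (i : Fin r) (t : ℝ) : ℝ :=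
  γ * Real.exp (γ * ψ i (x t))

/-! ### Function spaces on `[0, T]` -/

/-- Lebesgue measure on `[0, T]`. -/
def timeMeasure (T : ℝ) : Measure ℝ := volume.restrict (Icc 0 T)

/-- Membership in `W^{1,2}([0, T]; ℝⁿ)`. -/
def InW12 {n : ℕ} (T : ℝ) (x : ℝ → E n) : Prop :=
  AbsolutelyContinuousOnInterval x 0 T ∧ MemLp (deriv x) 2 (timeMeasure T)

/-- Weak convergence in `L²([0, T]; H)`. -/
def WeakL2Tendsto {H : Type*} [NormedAddCommGroup H] [InnerProductSpace ℝ H] (T : ℝ)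
    (v : ℕ → ℝ → H) (w : ℝ → H) : Prop :=
  (∀ j, MemLp (v j) 2 (timeMeasure T)) ∧ MemLp w 2 (timeMeasure T) ∧
    ∀ g : ℝ → H, MemLp g 2 (timeMeasure T) →
      Tendsto (fun j => ∫ t, inner ℝ (g t) (v j t) ∂timeMeasure T) atTop
        (𝓝 (∫ t, inner ℝ (g t) (w t) ∂timeMeasure T))

/-- The set of controls: Lebesgue measurable selections of `U` on `[0, T]`. -/
def controls {m : ℕ} (T : ℝ) (U : ℝ → Set (E m)) : Set (ℝ → E m) :=
  {u | AEMeasurable u (timeMeasure T) ∧ ∀ᵐ t ∂timeMeasure T, u t ∈ U t}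

/-- The σ-algebra of Lebesgue measurable subsets of `ℝ`. -/
abbrev lebesgueSigma : MeasurableSpace ℝ :=
  (inferInstance : MeasurableSpace (NullMeasurableSpace ℝ volume))

/-! ### Assumptions on the data -/

/-- Global assumption on `f`. The field `measurable_control` says that each control yields a
measurable vector field; it follows from `measurable` and `regular` when `U` is constant. -/
structure RegularDynamics {n m : ℕ} (T : ℝ) (C : Set (E n)) (U : ℝ → Set (E m))
    (f : ℝ → E n → E m → E n) (M : ℝ) : Prop where
  pos : 0 < M
  measurable : ∀ x ∈ C, ∀ w ∈ ⋃ t ∈ Icc 0 T, U t,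
    AEMeasurable (fun t => f t x w) (timeMeasure T)
  measurable_control : ∀ x ∈ C, ∀ u ∈ controls T U,
    AEMeasurable (fun t => f t x (u t)) (timeMeasure T)
  regular : ∀ᵐ t ∂timeMeasure T,
    ContinuousOn (fun p : E n × E m => f t p.1 p.2) (C ×ˢ U t) ∧
    (∀ w ∈ U t, ∀ x ∈ C, ∀ y ∈ C, ‖f t x w - f t y w‖ ≤ M * ‖x - y‖) ∧
    (∀ x ∈ C, ∀ w ∈ U t, ‖f t x w‖ ≤ M)

/-- `ψ_i` is `C^{1,1}` on `C + ρB`, for each `i`. -/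
def SmoothConstraints {n r : ℕ} (ψ : Fin r → E n → ℝ) (ρ : ℝ) : Prop :=
  0 < ρ ∧ ∀ i, DifferentiableOn ℝ (ψ i) (Metric.thickening ρ (sweepingSet ψ)) ∧
    LocallyLipschitzOn (Metric.thickening ρ (sweepingSet ψ)) (gradient (ψ i))

/-- Convex combinations of the gradients of the active constraints have norm larger than `2η`. -/
def QualifiedConstraints {n r : ℕ} (ψ : Fin r → E n → ℝ) (η : ℝ) : Prop :=
  0 < η ∧ ∀ c ∈ sweepingSet ψ, ∀ a : Fin r → ℝ, (∀ i, 0 ≤ a i) →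
    (∀ i, ψ i c ≠ 0 → a i = 0) → ∑ i, a i = 1 →
    2 * η < ‖∑ i, a i • gradient (ψ i) c‖

/-- `φ` is Lipschitz on `C` and `C¹` on `int C`, with gradient Lipschitz on `int C`. -/
def RegularPotential {n : ℕ} (C : Set (E n)) (φ : E n → EReal) : Prop :=
  (∃ L, LipschitzOnWith L (fun x => (φ x).toReal) C) ∧
  ContDiffOn ℝ 1 (fun x => (φ x).toReal) (interior C) ∧
  ∃ L, LipschitzOnWith L (gradient (fun x => (φ x).toReal)) (interior C)

/-- The graph of `U` is `𝓛 × 𝓑`-measurable, and its values are closed and uniformly bounded. -/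
def RegularControlSets {m : ℕ} (T : ℝ) (U : ℝ → Set (E m)) : Prop :=
  MeasurableSet[lebesgueSigma.prod (borel (E m))]
    {p : ℝ × E m | p.1 ∈ Icc 0 T ∧ p.2 ∈ U p.1} ∧
  (∀ t ∈ Icc 0 T, IsClosed (U t)) ∧
  ∃ R : ℝ, ∀ t ∈ Icc 0 T, ∀ w ∈ U t, ‖w‖ ≤ R

/-- `Φ` is a `C^{1,1}` extension of `φ` from `C` to the whole space, such that `Φ` and `∇Φ` are
bounded by `K` and `∇Φ` is `K`-Lipschitz. -/
structure IsExtension {n : ℕ} (C : Set (E n)) (φ : E n → EReal) (Φ : E n → ℝ) (K : ℝ) :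
    Prop where
  pos : 0 < K
  contDiff : ContDiff ℝ 1 Φ
  eq_on : ∀ x ∈ C, (Φ x : EReal) = φ x
  bound : ∀ x, |Φ x| ≤ K
  gradient_bound : ∀ x, ‖gradient Φ x‖ ≤ K
  gradient_lipschitz : ∀ x y, ‖gradient Φ x - gradient Φ y‖ ≤ K * ‖x - y‖

/-! ### The dynamics -/

/-- `f_Φ(t, x, u) = f(t, x, u) - ∇Φ(x)`. -/
def fExt {n m : ℕ} (f : ℝ → E n → E m → E n) (Φ : E n → ℝ) (t : ℝ) (x : E n) (w : E m) : E n :=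
  f t x w - gradient Φ x

/-- `x` solves the sweeping process `(D)` on `[0, T]` with initial point `x₀ ∈ C₀` and
control `u`. -/
structure IsSweepingSolution {n m : ℕ} (T : ℝ) (f : ℝ → E n → E m → E n) (φ : E n → EReal)
    (C₀ : Set (E n)) (x₀ : E n) (u : ℝ → E m) (x : ℝ → E n) : Prop where
  absCont : AbsolutelyContinuousOnInterval x 0 T
  initial : x 0 = x₀
  initial_mem : x₀ ∈ C₀
  inclusion : ∀ᵐ t ∂timeMeasure T, ∃ ζ ∈ clarkeSubdifferential φ (x t),
    HasDerivAt x (f t (x t) (u t) - ζ) t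

/-- `x` is the unique solution of `(D)` on `[0, T]` for the data `(x₀, u)`. -/
def IsUniqueSweepingSolution {n m : ℕ} (T : ℝ) (f : ℝ → E n → E m → E n) (φ : E n → EReal)
    (C₀ : Set (E n)) (x₀ : E n) (u : ℝ → E m) (x : ℝ → E n) : Prop :=
  IsSweepingSolution T f φ C₀ x₀ u x ∧
    ∀ y, IsSweepingSolution T f φ C₀ x₀ u y → EqOn y x (Icc 0 T)

/-- `x` solves the penalized equation `(D_γ)` on `[0, T]` with initial point `c ∈ C^γ` and
control `u`. Curves are `C`-valued, because nothing is assumed on `f` outside `C`. -/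
structure IsPenalizedSolution {n m r : ℕ} (T : ℝ) (f : ℝ → E n → E m → E n) (Φ : E n → ℝ)
    (ψ : Fin r → E n → ℝ) (γ : ℝ) (c : E n) (u : ℝ → E m) (x : ℝ → E n) : Prop where
  absCont : AbsolutelyContinuousOnInterval x 0 T
  initial : x 0 = c
  initial_mem : c ∈ approxSet ψ γ
  mem : ∀ t ∈ Icc 0 T, x t ∈ sweepingSet ψ
  equation : ∀ᵐ t ∂timeMeasure T,
    HasDerivAt x (fExt f Φ t (x t) (u t)
      - ∑ i, (γ * Real.exp (γ * ψ i (x t))) • gradient (ψ i) (x t)) t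

/-! ### Properties of the limits -/

/-- `x` is a `C`-valued curve of class `W^{1,2}`, with the a priori bounds on `x` and `x'`. -/
structure HasStateBounds {n : ℕ} (T Mbar : ℝ) (C : Set (E n)) (x₀ : E n) (x : ℝ → E n) :
    Prop where
  inW12 : InW12 T x
  mem : ∀ t ∈ Icc 0 T, x t ∈ C
  sup_bound : ∀ t ∈ Icc 0 T, ‖x t‖ ≤ ‖x₀‖ + Real.sqrt ((Mbar * T) ^ 2 + 2 * T)
  energy_bound : ∫ t, ‖deriv x t‖ ^ 2 ∂timeMeasure T ≤ Mbar ^ 2 * T + 2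

/-- The multipliers `ξ_{γ_{s j}}` along the curves `X (s j)` converge weakly in `L²` to `ξ`. -/
def MultipliersTendsto {n r : ℕ} (T : ℝ) (ψ : Fin r → E n → ℝ) (γ : ℕ → ℝ)
    (X : ℕ → ℝ → E n) (s : ℕ → ℕ) (ξ : Fin r → ℝ → ℝ) : Prop :=
  ∀ i, WeakL2Tendsto T (fun j => multiplier ψ (γ (s j)) (X (s j)) i) (ξ i)

/-- Nonnegativity and complementary slackness of the limit multipliers. -/
structure IsSlack {n r : ℕ} (T : ℝ) (ψ : Fin r → E n → ℝ) (x : ℝ → E n)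
    (ξ : Fin r → ℝ → ℝ) : Prop where
  nonneg : ∀ i, ∀ t ∈ Icc 0 T, 0 ≤ ξ i t
  zero : ∀ i, ∀ t ∈ Icc 0 T, x t ∈ interior (sublevel ψ i) → ξ i t = 0
  sum_zero : ∀ t ∈ Icc 0 T, x t ∈ interior (sweepingSet ψ) → ∑ i, ξ i t = 0

/-- The relations satisfied by the triplet `(x, u, ξ)` in the limit. -/
structure IsLimitTriplet {n m r : ℕ} (T : ℝ) (f : ℝ → E n → E m → E n) (Φ : E n → ℝ)
    (ψ : Fin r → E n → ℝ) (Mbar η Mψ : ℝ) (x : ℝ → E n) (u : ℝ → E m)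
    (ξ : Fin r → ℝ → ℝ) : Prop where
  equation : ∀ᵐ t ∂timeMeasure T,
    HasDerivAt x (fExt f Φ t (x t) (u t) - ∑ i, ξ i t • gradient (ψ i) (x t)) t
  bound : ∀ i, ∀ᵐ t ∂timeMeasure T, |ξ i t| ≤ Mbar / (2 * η)
  sum_bound : ∀ᵐ t ∂timeMeasure T, |∑ i, ξ i t| ≤ Mbar / (2 * η)
  norm_le : ∀ᵐ t ∂timeMeasure T,
    ‖fExt f Φ t (x t) (u t) - deriv x t‖ ≤ ‖fExt f Φ t (x t) (u t)‖
  prox : ∀ᵐ t ∂timeMeasure T, ∀ z ∈ sweepingSet ψ,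
    inner ℝ (fExt f Φ t (x t) (u t) - deriv x t) (z - x t)
      ≤ Mbar * Mψ / (2 * η) * ‖z - x t‖ ^ 2

end Sweeping

end

/-!
Convergence of the exponential penalty approximation of a sweeping process with controls.

*Geometry.* The qualification condition gives, at each `c ∈ C`, a direction `v` along which all
active constraints decrease at rate `2η` (`ConstraintData.exists_inward`); compactness turns the
condition into the lower bound `2 η γ V - B ≤ ‖γ ∑ e^{γ ψ_i} ∇ψ_i‖` near `C`, where
`V = ∑ e^{γ ψ_i}` (`ConstraintData.exists_penalty_lower_bound`). The set `C` is prox-regular, with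
the quadratic estimate `IsNormal.inner_sub_le`.

*Extension of `φ`.* The inward directions connect nearby points of `int C` by short polygonal paths
inside `int C`, so `φ` and `∇φ` form a Whitney `C^{1,1}` jet. Adding a multiple of `‖x‖²`, the jet
is extended by the largest convex function that lies below an infimum of paraboloids; this function
is at once convex and semiconcave, hence `C^{1,1}`, and a cut-off makes it bounded
(`ConstraintData.exists_isExtension`).

*Penalized equations.* On the boundary of `C^γ` the penalty dominates the field when `γ` is large,
so `C^γ` is invariant; existence is Carathéodory's theorem for a Lipschitz extension of the field
(`ConstraintData.exists_penalizedCurve`). Since `V` decreases along the penalty field, testing the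
equation with `x'` bounds the energy `∫ ‖x'‖²` by `Mbar² T + 2`, independently of `γ`
(`PenalizedCurve.integral_norm_deriv_sq_le`), and the lower bound above then bounds the multipliers
in `L²` (`exists_multiplier_bound`).

*Limits.* Bounded energy gives uniformly convergent subsequences with weakly convergent velocities
(`exists_uniform_subseq`), and bounded multipliers converge weakly; where a constraint is inactive
its multipliers decay exponentially, which is complementary slackness
(`PenalizedSequence.ae_multiplier_limit`). Products of weakly convergent multipliers and uniformly
convergent gradients pass to the limit in the integrated equations
(`PenalizedSequence.hasDerivAt_limit`). A curve that stays in `C` is tangent to its active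
constraints, so the velocity is orthogonal to the normal part of the equation; this bounds the
normal part by the field, and the multipliers by the qualification condition
(`isLimitTriplet_of_hasDerivAt`). The Clarke subdifferential of `φ` consists of `∇Φ` plus normals
(`isNormal_of_mem_clarkeSubdifferential`, `mem_clarkeSubdifferential_of_multipliers`), and
hypomonotonicity of the normals with Gronwall's lemma yields uniqueness
(`IsSweepingSolution.eqOn`).

*Relaxed controls.* When the velocity sets are convex, the weak limit of the velocities is a
selection of them (`WeakL2Tendsto.ae_mem`), and Filippov's lemma realizes it by a control
(`exists_control_eq`). The latter rests on Aumann's selection theorem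
(`exists_measurable_selection`): an analytic set is, up to small measure, covered by images of
compact sets, on which a selection is given by fibrewise minimization of an injective continuous
function.
-/

noncomputable section

namespace Sweeping

/-! ### Geometry of the constraint set -/

section Gradient

variable {V : Type*} [NormedAddCommGroup V] [InnerProductSpace ℝ V] [CompleteSpace V]

theorem hasDerivAt_comp_gradient {f : V → ℝ} {x : ℝ → V} {x' : V} {t : ℝ}
    (hf : DifferentiableAt ℝ f (x t)) (hx : HasDerivAt x x' t) :
    HasDerivAt (fun s => f (x s)) (inner ℝ (gradient f (x t)) x') t := by
  exact ((hf.hasGradientAt.hasFDerivAt).comp_hasDerivAt t hx).congr_deriv (by simp)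

/-- Second-order Taylor estimate along a segment on which the gradient grows at most linearly. -/
theorem abs_sub_sub_inner_gradient_le {f : V → ℝ} {x z : V} {L : ℝ}
    (hd : ∀ p ∈ segment ℝ x z, DifferentiableAt ℝ f p)
    (hL : ∀ p ∈ segment ℝ x z, ‖gradient f p - gradient f x‖ ≤ L * ‖p - x‖) :
    |f z - f x - inner ℝ (gradient f x) (z - x)| ≤ L / 2 * ‖z - x‖ ^ 2 := by
  have hseg : ∀ τ ∈ Icc (0 : ℝ) 1, x + τ • (z - x) ∈ segment ℝ x z := by
    intro τ hτ
    rw [segment_eq_image']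
    exact ⟨τ, hτ, rfl⟩
  have hp : ∀ τ : ℝ, HasDerivAt (fun τ : ℝ => x + τ • (z - x)) (z - x) τ := by
    intro τ
    simpa using ((hasDerivAt_id τ).smul_const (z - x)).const_add x
  have hg : ∀ τ ∈ Icc (0 : ℝ) 1, HasDerivAt
      (fun τ : ℝ => f (x + τ • (z - x)) - f x - τ * inner ℝ (gradient f x) (z - x))
      (inner ℝ (gradient f (x + τ • (z - x)) - gradient f x) (z - x)) τ := by
    intro τ hτ
    have h1 := hasDerivAt_comp_gradient (x := fun τ : ℝ => x + τ • (z - x))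
      (hd _ (hseg τ hτ)) (hp τ)
    have h2 := (h1.sub_const (f x)).sub
      ((hasDerivAt_id τ).mul_const (inner ℝ (gradient f x) (z - x)))
    refine h2.congr_deriv ?_
    rw [inner_sub_left, one_mul]
  have hB : ∀ τ : ℝ, HasDerivAt (fun τ : ℝ => L / 2 * ‖z - x‖ ^ 2 * τ ^ 2)
      (L * ‖z - x‖ ^ 2 * τ) τ := by
    intro τ
    have := ((hasDerivAt_id τ).pow 2).const_mul (L / 2 * ‖z - x‖ ^ 2)
    refine this.congr_deriv ?_
    simp
    ring
  have key := image_norm_le_of_norm_deriv_right_le_deriv_boundary (a := 0) (b := 1)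
    (f := fun τ : ℝ => f (x + τ • (z - x)) - f x - τ * inner ℝ (gradient f x) (z - x))
    (fun τ hτ => (hg τ hτ).continuousAt.continuousWithinAt)
    (fun τ hτ => (hg τ (Ico_subset_Icc_self hτ)).hasDerivWithinAt)
    (B := fun τ : ℝ => L / 2 * ‖z - x‖ ^ 2 * τ ^ 2) (by simp) hB
    (by
      intro τ hτ
      have h1 := hL _ (hseg τ (Ico_subset_Icc_self hτ))
      rw [add_sub_cancel_left, norm_smul, Real.norm_of_nonneg hτ.1] at h1
      calc ‖inner ℝ (gradient f (x + τ • (z - x)) - gradient f x) (z - x)‖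
          ≤ ‖gradient f (x + τ • (z - x)) - gradient f x‖ * ‖z - x‖ := norm_inner_le_norm _ _
        _ ≤ L * (τ * ‖z - x‖) * ‖z - x‖ := by gcongr
        _ = L * ‖z - x‖ ^ 2 * τ := by ring)
    (right_mem_Icc.2 zero_le_one)
  simpa using key

end Gradient

/-- The regularity and qualification assumptions on the constraints `ψ_i`, in one bundle. -/
structure ConstraintData {n r : ℕ} (ψ : Fin r → E n → ℝ) (ρ η Mψ : ℝ) : Prop where
  compact : IsCompact (sweepingSet ψ)
  nonempty : (sweepingSet ψ).Nonempty
  smooth : SmoothConstraints ψ ρ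
  qualified : QualifiedConstraints ψ η
  le_mul : 4 * η / ρ ≤ Mψ
  lip : ∀ i, ∀ x ∈ Metric.cthickening (ρ / 2) (sweepingSet ψ),
    ∀ y ∈ Metric.cthickening (ρ / 2) (sweepingSet ψ),
    ‖gradient (ψ i) x - gradient (ψ i) y‖ ≤ 2 * Mψ * ‖x - y‖

variable {n m r : ℕ} {ψ : Fin r → E n → ℝ} {ρ η Mψ : ℝ}

/-- The sum `∑ i, exp (γ ψ_i x)`, whose sublevel set of level `1` is `C^γ`. -/
def penaltySum (ψ : Fin r → E n → ℝ) (γ : ℝ) (x : E n) : ℝ := ∑ i, Real.exp (γ * ψ i x)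

/-- The penalty field `∑ i, γ exp (γ ψ_i x) ∇ψ_i x`, which is the gradient of `penaltySum`. -/
def penaltyField (ψ : Fin r → E n → ℝ) (γ : ℝ) (x : E n) : E n :=
  ∑ i, (γ * Real.exp (γ * ψ i x)) • gradient (ψ i) x

theorem mem_sweepingSet {x : E n} : x ∈ sweepingSet ψ ↔ ∀ i, ψ i x ≤ 0 := by
  simp [sweepingSet, sublevel]

theorem penaltySum_nonneg (γ : ℝ) (x : E n) : 0 ≤ penaltySum ψ γ x :=
  Finset.sum_nonneg fun _ _ => (Real.exp_pos _).le

theorem approxSet_subset {γ : ℝ} (hγ : 0 < γ) : approxSet ψ γ ⊆ sweepingSet ψ := by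
  intro x hx
  rw [mem_sweepingSet]
  intro i
  by_contra! h
  have h1 : Real.exp (γ * ψ i x) ≤ ∑ j, Real.exp (γ * ψ j x) :=
    Finset.single_le_sum (f := fun j => Real.exp (γ * ψ j x))
      (fun j _ => (Real.exp_pos _).le) (Finset.mem_univ i)
  have h2 : 1 < Real.exp (γ * ψ i x) := Real.one_lt_exp_iff.2 (mul_pos hγ h)
  have h3 : ∑ j, Real.exp (γ * ψ j x) ≤ 1 := hx
  linarith

theorem mem_cthickening {x : E n} (hx : x ∈ sweepingSet ψ) {δ : ℝ} :
    x ∈ Metric.cthickening δ (sweepingSet ψ) :=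
  Metric.self_subset_cthickening _ hx

theorem cthickening_mem_nhds {x : E n} (hx : x ∈ sweepingSet ψ) {δ : ℝ} (hδ : 0 < δ) :
    Metric.cthickening δ (sweepingSet ψ) ∈ 𝓝 x :=
  mem_of_superset (Metric.isOpen_thickening.mem_nhds (Metric.self_subset_thickening hδ _ hx))
    (Metric.thickening_subset_cthickening _ _)

theorem segment_subset_cthickening {x z : E n} (hx : x ∈ sweepingSet ψ) (hz : z ∈ sweepingSet ψ)
    (hxz : ‖z - x‖ ≤ ρ) : segment ℝ x z ⊆ Metric.cthickening (ρ / 2) (sweepingSet ψ) := by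
  intro p hp
  rw [segment_eq_image'] at hp
  obtain ⟨τ, ⟨h0, h1⟩, rfl⟩ := hp
  -- the point is within `ρ / 2` of the closer endpoint
  rcases le_total τ (1 / 2) with h | h
  · refine Metric.mem_cthickening_of_dist_le _ x _ _ hx ?_
    rw [dist_eq_norm, add_sub_cancel_left, norm_smul, Real.norm_of_nonneg h0]
    nlinarith [norm_nonneg (z - x)]
  · refine Metric.mem_cthickening_of_dist_le _ z _ _ hz ?_
    have : x + τ • (z - x) - z = -((1 - τ) • (z - x)) := by module
    rw [dist_eq_norm, this, norm_neg, norm_smul, Real.norm_of_nonneg (by linarith)]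
    nlinarith [norm_nonneg (z - x)]

namespace ConstraintData

variable (D : ConstraintData ψ ρ η Mψ)
include D

theorem rho_pos : 0 < ρ := D.smooth.1

theorem eta_pos : 0 < η := D.qualified.1

theorem Mψ_pos : 0 < Mψ :=
  lt_of_lt_of_le (div_pos (mul_pos four_pos D.eta_pos) D.rho_pos) D.le_mul

theorem cthickening_subset : Metric.cthickening (ρ / 2) (sweepingSet ψ) ⊆
    Metric.thickening ρ (sweepingSet ψ) :=
  Metric.cthickening_subset_thickening' D.rho_pos (half_lt_self D.rho_pos) _

theorem isCompact_cthickening (δ : ℝ) : IsCompact (Metric.cthickening δ (sweepingSet ψ)) :=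
  D.compact.cthickening

theorem differentiableAt (i : Fin r) {x : E n}
    (hx : x ∈ Metric.cthickening (ρ / 2) (sweepingSet ψ)) : DifferentiableAt ℝ (ψ i) x :=
  ((D.smooth.2 i).1).differentiableAt
    (Metric.isOpen_thickening.mem_nhds (D.cthickening_subset hx))

theorem continuousOn (i : Fin r) :
    ContinuousOn (ψ i) (Metric.cthickening (ρ / 2) (sweepingSet ψ)) := fun _ hx =>
  (D.differentiableAt i hx).continuousAt.continuousWithinAt

theorem continuousOn_gradient (i : Fin r) :
    ContinuousOn (gradient (ψ i)) (Metric.cthickening (ρ / 2) (sweepingSet ψ)) := by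
  have : LipschitzOnWith (2 * Mψ).toNNReal (gradient (ψ i))
      (Metric.cthickening (ρ / 2) (sweepingSet ψ)) := by
    refine LipschitzOnWith.of_dist_le_mul fun x hx y hy => ?_
    rw [Real.coe_toNNReal _ (by linarith [D.Mψ_pos]), dist_eq_norm, dist_eq_norm]
    exact D.lip i x hx y hy
  exact this.continuousOn

theorem continuousAt {i : Fin r} {x : E n} (hx : x ∈ sweepingSet ψ) : ContinuousAt (ψ i) x :=
  (D.differentiableAt i (mem_cthickening hx)).continuousAt

theorem continuousAt_gradient {i : Fin r} {x : E n} (hx : x ∈ sweepingSet ψ) :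
    ContinuousAt (gradient (ψ i)) x :=
  (D.continuousOn_gradient i).continuousAt
    (cthickening_mem_nhds hx (half_pos D.rho_pos))

/-- On `C` each constraint stays within `Mψ ‖z - x‖²` of its linearization. For `‖z - x‖ ≤ ρ` the
segment from `x` to `z`, although not in `C`, stays in the `ρ / 2`-neighbourhood of `C`, where the
gradient is `2 Mψ`-Lipschitz. -/
theorem abs_sub_sub_inner_le (i : Fin r) {x z : E n} (hx : x ∈ sweepingSet ψ)
    (hz : z ∈ sweepingSet ψ) (hxz : ‖z - x‖ ≤ ρ) :
    |ψ i z - ψ i x - inner ℝ (gradient (ψ i) x) (z - x)| ≤ Mψ * ‖z - x‖ ^ 2 := by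
  have hseg := segment_subset_cthickening hx hz hxz
  have := abs_sub_sub_inner_gradient_le (L := 2 * Mψ)
    (fun p hp => D.differentiableAt i (hseg hp))
    (fun p hp => D.lip i p (hseg hp) x (mem_cthickening hx))
  rwa [mul_div_cancel_left₀ _ two_ne_zero] at this

/-- At each point of `C` there is a direction pointing strictly inside all active constraints:
the opposite of the element of least norm in the convex hull of the active gradients. -/
theorem exists_inward {c : E n} (hc : c ∈ sweepingSet ψ) :
    ∃ v : E n, ‖v‖ ≤ 1 ∧ ∀ i, ψ i c = 0 → inner ℝ (gradient (ψ i) c) v < -(2 * η) := by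
  set A : Set (Fin r → ℝ) := {a | a ∈ stdSimplex ℝ (Fin r) ∧ ∀ i, ψ i c ≠ 0 → a i = 0} with hA
  set S : (Fin r → ℝ) → E n := fun a => ∑ i, a i • gradient (ψ i) c with hS
  have hScont : Continuous S := by fun_prop
  have hAcomp : IsCompact A := by
    have : A = stdSimplex ℝ (Fin r) ∩ {a | ∀ i, ψ i c ≠ 0 → a i = 0} := rfl
    rw [this]
    refine (isCompact_stdSimplex ℝ (Fin r)).inter_right ?_
    simp only [ofPred_forall]
    exact isClosed_iInter fun i => isClosed_iInter fun _ =>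
      isClosed_eq (continuous_apply i) continuous_const
  have hKconv : Convex ℝ (S '' A) := by
    have hAconv : Convex ℝ A := by
      intro a ha b hb s t hs ht hst
      refine ⟨convex_stdSimplex ℝ _ ha.1 hb.1 hs ht hst, fun i hi => ?_⟩
      simp [ha.2 i hi, hb.2 i hi]
    have hlin : IsLinearMap ℝ S := by
      refine ⟨fun a b => ?_, fun s a => ?_⟩
      · simp [hS, add_smul, Finset.sum_add_distrib]
      · simp [hS, mul_smul, Finset.smul_sum]
    exact hAconv.is_linear_image hlin
  by_cases hact : ∃ i, ψ i c = 0
  · obtain ⟨i₀, hi₀⟩ := hact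
    have hsingle : ∀ i, ψ i c = 0 → gradient (ψ i) c ∈ S '' A := by
      intro i hi
      refine ⟨Pi.single i 1, ⟨single_mem_stdSimplex ℝ i, fun j hj => ?_⟩, ?_⟩
      · rw [Pi.single_apply, if_neg]
        rintro rfl
        exact hj hi
      · simp [hS]
    obtain ⟨w, hw, hmin⟩ := exists_norm_eq_iInf_of_complete_convex ⟨_, hsingle i₀ hi₀⟩
      (hAcomp.image hScont).isComplete hKconv 0
    rw [norm_eq_iInf_iff_real_inner_le_zero hKconv hw] at hmin
    have hwn : 2 * η < ‖w‖ := by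
      obtain ⟨a, ha, rfl⟩ := hw
      exact D.qualified.2 c hc a ha.1.1 ha.2 ha.1.2
    have hwpos : 0 < ‖w‖ := by linarith [D.eta_pos]
    refine ⟨-(‖w‖⁻¹ • w), ?_, fun i hi => ?_⟩
    · rw [norm_neg, norm_smul, norm_inv, norm_norm, inv_mul_cancel₀ hwpos.ne']
    · have h1 := hmin _ (hsingle i hi)
      rw [zero_sub, inner_neg_left, inner_sub_right, real_inner_self_eq_norm_sq] at h1
      rw [inner_neg_right, inner_smul_right, real_inner_comm]
      have h2 : ‖w‖ ≤ ‖w‖⁻¹ * inner ℝ w (gradient (ψ i) c) := by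
        rw [inv_mul_eq_div, le_div_iff₀ hwpos]
        nlinarith
      linarith
  · push Not at hact
    exact ⟨0, by simp, fun i hi => absurd hi (hact i)⟩

/-- The qualification condition persists, by compactness, for almost active constraints at
points close to `C`. -/
theorem exists_qualified_near : ∃ δ, 0 < δ ∧ δ ≤ ρ / 2 ∧
    ∀ x ∈ Metric.cthickening δ (sweepingSet ψ), ∀ a ∈ stdSimplex ℝ (Fin r),
      (∀ i, ψ i x < -δ → a i = 0) → 2 * η ≤ ‖∑ i, a i • gradient (ψ i) x‖ := by
  by_contra! hcon
  have hρ := D.rho_pos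
  set δ : ℕ → ℝ := fun k => ρ / 2 * (1 / ((k : ℝ) + 1)) with hδ
  have hδpos : ∀ k, 0 < δ k := fun k => by positivity
  have hδle : ∀ k, δ k ≤ ρ / 2 := fun k => by
    have : 1 / ((k : ℝ) + 1) ≤ 1 := by
      rw [div_le_one (by positivity)]
      linarith [(Nat.cast_nonneg k : (0 : ℝ) ≤ k)]
    exact mul_le_of_le_one_right (half_pos hρ).le this
  have hδ0 : Tendsto δ atTop (𝓝 0) := by
    rw [← mul_zero (ρ / 2)]
    exact tendsto_one_div_add_atTop_nhds_zero_nat.const_mul (ρ / 2)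
  choose x hx a ha hsupp hlt using fun k => hcon (δ k) (hδpos k) (hδle k)
  have hxN : ∀ k, x k ∈ Metric.cthickening (ρ / 2) (sweepingSet ψ) := fun k =>
    Metric.cthickening_mono (hδle k) _ (hx k)
  obtain ⟨⟨c, b⟩, hcb, s, hs, hlim⟩ := ((D.isCompact_cthickening (ρ / 2)).prod
    (isCompact_stdSimplex ℝ (Fin r))).tendsto_subseq (x := fun k => (x k, a k))
    (fun k => ⟨hxN k, ha k⟩)
  have hxc : Tendsto (fun k => x (s k)) atTop (𝓝 c) := (continuous_fst.tendsto _).comp hlim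
  have hab : Tendsto (fun k => a (s k)) atTop (𝓝 b) := (continuous_snd.tendsto _).comp hlim
  have hcC : c ∈ sweepingSet ψ := by
    rw [← D.compact.isClosed.closure_eq, Metric.mem_closure_iff_infDist_zero D.nonempty]
    have h1 : Tendsto (fun k => Metric.infDist (x (s k)) (sweepingSet ψ)) atTop
        (𝓝 (Metric.infDist c (sweepingSet ψ))) :=
      ((Metric.continuous_infDist_pt _).tendsto c).comp hxc
    have h2 : Tendsto (fun k => Metric.infDist (x (s k)) (sweepingSet ψ)) atTop (𝓝 0) := by
      refine squeeze_zero (fun k => Metric.infDist_nonneg) (fun k => ?_)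
        (hδ0.comp hs.tendsto_atTop)
      have := hx (s k)
      rw [Metric.mem_cthickening_iff] at this
      exact ENNReal.toReal_le_of_le_ofReal (hδpos _).le this
    exact tendsto_nhds_unique h1 h2
  have hψ : ∀ i, Tendsto (fun k => ψ i (x (s k))) atTop (𝓝 (ψ i c)) := fun i =>
    (D.continuousAt hcC).tendsto.comp hxc
  have hgr : ∀ i, Tendsto (fun k => gradient (ψ i) (x (s k))) atTop (𝓝 (gradient (ψ i) c)) :=
    fun i => (D.continuousAt_gradient hcC).tendsto.comp hxc
  have hai : ∀ i, Tendsto (fun k => a (s k) i) atTop (𝓝 (b i)) := fun i =>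
    ((continuous_apply i).tendsto _).comp hab
  have hnorm : ‖∑ i, b i • gradient (ψ i) c‖ ≤ 2 * η :=
    le_of_tendsto (tendsto_finsetSum _ fun i _ => (hai i).smul (hgr i)).norm
      (Eventually.of_forall fun k => (hlt (s k)).le)
  refine absurd hnorm (not_le.2 (D.qualified.2 c hcC b hcb.2.1 (fun i hi => ?_) hcb.2.2))
  have hneg : ψ i c < 0 := lt_of_le_of_ne (mem_sweepingSet.1 hcC i) hi
  have hδs : Tendsto (fun k => -δ (s k)) atTop (𝓝 0) := by
    simpa using (hδ0.comp hs.tendsto_atTop).neg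
  have hev : ∀ᶠ k in atTop, a (s k) i = 0 := by
    filter_upwards [(hψ i).eventually_lt hδs hneg] with k hk using hsupp _ i hk
  exact tendsto_nhds_unique ((hai i).congr' hev) tendsto_const_nhds

theorem exists_gradient_bound : ∃ L, 0 ≤ L ∧ ∀ i,
    ∀ x ∈ Metric.cthickening (ρ / 2) (sweepingSet ψ), ‖gradient (ψ i) x‖ ≤ L := by
  have h : ∀ i, ∃ L, ∀ x ∈ Metric.cthickening (ρ / 2) (sweepingSet ψ),
      ‖gradient (ψ i) x‖ ≤ L := fun i =>
    (D.isCompact_cthickening _).exists_bound_of_continuousOn (D.continuousOn_gradient i)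
  choose L hL using h
  refine ⟨∑ i, |L i|, Finset.sum_nonneg fun i _ => abs_nonneg _, fun i x hx => ?_⟩
  calc ‖gradient (ψ i) x‖ ≤ L i := hL i x hx
    _ ≤ |L i| := le_abs_self _
    _ ≤ ∑ j, |L j| := Finset.single_le_sum (f := fun j => |L j|)
        (fun j _ => abs_nonneg _) (Finset.mem_univ i)

/-- The penalty field dominates the total multiplier `γ ∑ i, exp (γ ψ_i)` up to a constant that
does not depend on `γ`: inactive constraints contribute at most `γ exp (-γ δ) ≤ 1 / δ`. -/
theorem exists_penalty_lower_bound : ∃ δ, 0 < δ ∧ δ ≤ ρ / 2 ∧ ∃ B, 0 ≤ B ∧ ∀ γ, 0 < γ →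
    ∀ x ∈ Metric.cthickening δ (sweepingSet ψ),
      2 * η * (γ * penaltySum ψ γ x) - B ≤ ‖penaltyField ψ γ x‖ := by
  obtain ⟨δ, hδ, hδρ, hq⟩ := D.exists_qualified_near
  obtain ⟨L, hL0, hL⟩ := D.exists_gradient_bound
  have hη := D.eta_pos
  refine ⟨δ, hδ, hδρ, (2 * η + L) * (r * (1 / δ)), by positivity, fun γ hγ x hx => ?_⟩
  have hxN : x ∈ Metric.cthickening (ρ / 2) (sweepingSet ψ) := Metric.cthickening_mono hδρ _ hx
  set e : Fin r → ℝ := fun i => γ * Real.exp (γ * ψ i x) with he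
  have hepos : ∀ i, 0 < e i := fun i => mul_pos hγ (Real.exp_pos _)
  set b : Fin r → ℝ := fun i => if ψ i x < -δ then 0 else e i with hb
  have hb0 : ∀ i, 0 ≤ b i := fun i => by
    simp only [hb]; split_ifs <;> simp [(hepos i).le]
  have hsmall : ∀ i, |e i - b i| ≤ 1 / δ := by
    intro i
    simp only [hb]
    split_ifs with h
    · rw [sub_zero, abs_of_pos (hepos i), le_div_iff₀ hδ]
      have h1 : Real.exp (γ * ψ i x) ≤ Real.exp (-(γ * δ)) := Real.exp_le_exp.2 (by nlinarith)
      have h2 : γ * δ ≤ Real.exp (γ * δ) := by linarith [Real.add_one_le_exp (γ * δ)]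
      calc e i * δ ≤ γ * Real.exp (-(γ * δ)) * δ := by simp only [he]; gcongr
        _ = γ * δ * Real.exp (-(γ * δ)) := by ring
        _ ≤ Real.exp (γ * δ) * Real.exp (-(γ * δ)) := by gcongr
        _ = 1 := by rw [← Real.exp_add]; simp
    · simp [hδ.le]
  have hB : 2 * η * ∑ i, b i ≤ ‖∑ i, b i • gradient (ψ i) x‖ := by
    rcases (Finset.sum_nonneg fun i (_ : i ∈ Finset.univ) => hb0 i).eq_or_lt with h0 | hpos
    · rw [← h0]; simp
    · have h1 := hq x hx (fun i => (∑ j, b j)⁻¹ * b i)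
        ⟨fun i => mul_nonneg (inv_nonneg.2 hpos.le) (hb0 i), by
          rw [← Finset.mul_sum, inv_mul_cancel₀ hpos.ne']⟩
        (fun i hi => by simp [hb, hi])
      have h2 : ∑ i, ((∑ j, b j)⁻¹ * b i) • gradient (ψ i) x
          = (∑ j, b j)⁻¹ • ∑ i, b i • gradient (ψ i) x := by
        rw [Finset.smul_sum]; simp only [mul_smul]
      rw [h2, norm_smul, norm_inv, Real.norm_of_nonneg hpos.le, inv_mul_eq_div,
        le_div_iff₀ hpos] at h1
      exact h1
  have h1 : γ * penaltySum ψ γ x = ∑ i, b i + ∑ i, (e i - b i) := by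
    simp [penaltySum, Finset.mul_sum, he]
  have h2 : penaltyField ψ γ x
      = ∑ i, b i • gradient (ψ i) x + ∑ i, (e i - b i) • gradient (ψ i) x := by
    rw [← Finset.sum_add_distrib]
    refine Finset.sum_congr rfl fun i _ => ?_
    rw [← add_smul, add_sub_cancel]
  have h3 : ∑ i, (e i - b i) ≤ r * (1 / δ) := by
    calc ∑ i, (e i - b i) ≤ ∑ _i : Fin r, 1 / δ :=
          Finset.sum_le_sum fun i _ => (le_abs_self _).trans (hsmall i)
      _ = r * (1 / δ) := by simp
  have h4 : ‖∑ i, (e i - b i) • gradient (ψ i) x‖ ≤ L * (r * (1 / δ)) := by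
    calc ‖∑ i, (e i - b i) • gradient (ψ i) x‖
        ≤ ∑ i, ‖(e i - b i) • gradient (ψ i) x‖ := norm_sum_le _ _
      _ ≤ ∑ _i : Fin r, 1 / δ * L := Finset.sum_le_sum fun i _ => by
          rw [norm_smul, Real.norm_eq_abs]
          exact mul_le_mul (hsmall i) (hL i x hxN) (norm_nonneg _) (by positivity)
      _ = L * (r * (1 / δ)) := by simp; ring
  have h5 := norm_sub_le (penaltyField ψ γ x) (∑ i, (e i - b i) • gradient (ψ i) x)
  rw [h2, add_sub_cancel_right, ← h2] at h5
  rw [h1]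
  nlinarith [mul_le_mul_of_nonneg_left h3 (by linarith : (0 : ℝ) ≤ 2 * η)]

end ConstraintData

/-! ### `C^{1,1}` extension of the potential -/

section Whitney

variable {V : Type*} [NormedAddCommGroup V] [InnerProductSpace ℝ V] [FiniteDimensional ℝ V]

/-- A finite convex function on a finite-dimensional space has a subgradient at each point. -/
theorem exists_subgradient {F : V → ℝ} (hF : ConvexOn ℝ univ F) (x : V) :
    ∃ p : V, ∀ y, F x + inner ℝ p (y - x) ≤ F y := by
  have hcont : Continuous F := by
    have := hF.continuousOn isOpen_univ
    rwa [continuousOn_univ] at this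
  -- separate the open strict epigraph from the point `(x, F x)` of its boundary
  have hopen : IsOpen {p : V × ℝ | p.1 ∈ (univ : Set V) ∧ F p.1 < p.2} := by
    simp only [mem_univ, true_and]
    exact isOpen_lt (hcont.comp continuous_fst) continuous_snd
  obtain ⟨L, hL⟩ := geometric_hahn_banach_open_point hF.convex_strict_epigraph hopen
    (x := (x, F x)) (by simp)
  have hLe : ∀ y t, F y < t → L (y, t) < L (x, F x) := fun y t h => hL _ ⟨mem_univ _, h⟩
  have hsplit : ∀ y t, L (y, t) = L (y, 0) + t * L (0, 1) := by
    intro y t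
    have : (y, t) = (y, (0 : ℝ)) + t • ((0 : V), (1 : ℝ)) := by simp
    rw [this, map_add, map_smul, smul_eq_mul]
  have hneg : L (0, 1) < 0 := by
    have := hLe x (F x + 1) (by linarith)
    rw [hsplit, hsplit x (F x)] at this
    linarith
  set l : V →L[ℝ] ℝ := L.comp (ContinuousLinearMap.inl ℝ V ℝ) with hl
  have hly : ∀ y, l y = L (y, 0) := fun y => rfl
  refine ⟨(InnerProductSpace.toDual ℝ V).symm ((-(L (0, 1)))⁻¹ • l), fun y => ?_⟩
  rw [InnerProductSpace.toDual_symm_apply]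
  have hle : l y + F y * L (0, 1) ≤ l x + F x * L (0, 1) := by
    refine le_of_forall_pos_le_add fun ε hε => ?_
    have hd : 0 < ε / -(L (0, 1)) := div_pos hε (neg_pos.2 hneg)
    have := hLe y (F y + ε / -(L (0, 1))) (by linarith)
    rw [hsplit, hsplit x (F x), ← hly, ← hly, add_mul] at this
    have h2 : ε / -(L (0, 1)) * L (0, 1) = -ε := by
      rw [div_neg, neg_mul, div_mul_cancel₀ _ hneg.ne]
    linarith
  have h3 : ((-(L (0, 1)))⁻¹ • l) (y - x) = (l y - l x) / -(L (0, 1)) := by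
    simp [div_eq_inv_mul]
  rw [h3, ← le_sub_iff_add_le', div_le_iff₀ (neg_pos.2 hneg)]
  linarith

/-- A convex function that is also semiconcave is of class `C^{1,1}`. -/
theorem differentiable_of_convex_of_semiconcave {F : V → ℝ} (hF : ConvexOn ℝ univ F) {M : ℝ}
    (hM : 0 ≤ M) (hsc : ∀ x u, F (x + u) + F (x - u) ≤ 2 * F x + 2 * M * ‖u‖ ^ 2) :
    Differentiable ℝ F ∧ ∀ x y, ‖gradient F x - gradient F y‖ ≤ 8 * M * ‖x - y‖ := by
  choose p hp using exists_subgradient hF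
  have hup : ∀ x u, F (x + u) ≤ F x + inner ℝ (p x) u + 2 * M * ‖u‖ ^ 2 := by
    intro x u
    have h1 := hp x (x - u)
    rw [sub_sub_cancel_left, inner_neg_right] at h1
    linarith [hsc x u]
  have hgrad : ∀ x, HasGradientAt F (p x) x := by
    intro x
    rw [hasGradientAt_iff_isLittleO_nhds_zero]
    have hO : (fun u : V => F (x + u) - F x - inner ℝ (p x) u) =O[𝓝 0] fun u => ‖u‖ ^ 2 := by
      refine Asymptotics.IsBigO.of_bound (2 * M) (Eventually.of_forall fun u => ?_)
      have h1 := hp x (x + u)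
      rw [add_sub_cancel_left] at h1
      rw [Real.norm_of_nonneg (by linarith), Real.norm_of_nonneg (by positivity)]
      linarith [hup x u]
    exact hO.trans_isLittleO (Asymptotics.isLittleO_norm_pow_id one_lt_two)
  refine ⟨fun x => (hgrad x).differentiableAt, fun x y => ?_⟩
  rw [(hgrad x).gradient, (hgrad y).gradient]
  rcases eq_or_ne (p x) (p y) with h | h
  · rw [h, sub_self, norm_zero]; positivity
  have hpos : 0 < ‖p x - p y‖ := norm_pos_iff.2 (sub_ne_zero.2 h)
  -- test the two-sided estimate with a vector of length `‖x - y‖` in the direction `p x - p y`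
  set w : V := (‖x - y‖ / ‖p x - p y‖) • (p x - p y) with hw
  have hwn : ‖w‖ = ‖x - y‖ := by
    rw [hw, norm_smul, Real.norm_of_nonneg (by positivity), div_mul_cancel₀ _ hpos.ne']
  have hin : inner ℝ (p x - p y) w = ‖x - y‖ * ‖p x - p y‖ := by
    rw [hw, inner_smul_right, real_inner_self_eq_norm_sq]
    field_simp
  have h1 := hp x (x + w)
  have h2 := hup y (x - y + w)
  have h3 := hp y x
  rw [add_sub_cancel_left] at h1
  rw [show y + (x - y + w) = x + w by abel, inner_add_right] at h2
  have h4 : ‖x - y + w‖ ≤ 2 * ‖x - y‖ := (norm_add_le _ _).trans (by rw [hwn]; linarith)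
  have h5 : ‖x - y + w‖ ^ 2 ≤ (2 * ‖x - y‖) ^ 2 := by gcongr
  rw [inner_sub_left] at hin
  have h6 : ‖x - y‖ * ‖p x - p y‖ ≤ ‖x - y‖ * (8 * M * ‖x - y‖) := by nlinarith
  rcases (norm_nonneg (x - y)).eq_or_lt with h0 | h0
  · have : x = y := by rw [← sub_eq_zero, ← norm_eq_zero, ← h0]
    exact absurd (congrArg p this) h
  · exact le_of_mul_le_mul_left h6 h0

/-- Whitney's extension theorem for `C^{1,1}` functions. The extension is `F - M/2 ‖x‖²`, where `F`
is the largest convex function below all the paraboloids of curvature `2 M` that the data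
prescribe from above. -/
theorem exists_c11_extension {S : Set V} (hS : S.Nonempty) {f : V → ℝ} {G : V → V} {A : ℝ}
    (hA : 0 ≤ A)
    (h1 : ∀ y ∈ S, ∀ z ∈ S, |f y - f z - inner ℝ (G z) (y - z)| ≤ A * ‖y - z‖ ^ 2)
    (h2 : ∀ y ∈ S, ∀ z ∈ S, ‖G y - G z‖ ≤ A * ‖y - z‖) :
    ∃ (F : V → ℝ) (L : ℝ), 0 ≤ L ∧ Differentiable ℝ F ∧
      (∀ x y, ‖gradient F x - gradient F y‖ ≤ L * ‖x - y‖) ∧ ∀ x ∈ S, F x = f x := by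
  set M : ℝ := 8 * A with hM
  have hM0 : 0 ≤ M := by positivity
  set Q : V → V → ℝ := fun y x =>
    f y + inner ℝ (G y) (x - y) + M / 2 * ‖x - y‖ ^ 2 + M / 2 * ‖x‖ ^ 2 with hQ
  set ℓ : V → V → ℝ := fun z x =>
    f z + inner ℝ (G z) (x - z) - M / 2 * ‖x - z‖ ^ 2 + M / 2 * ‖x‖ ^ 2 with hℓ
  -- `M = 8 A` makes every lower paraboloid lie below every upper one
  have hℓQ : ∀ z ∈ S, ∀ y ∈ S, ∀ x, ℓ z x ≤ Q y x := by
    intro z hz y hy x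
    have e1 := (abs_le.1 (h1 y hy z hz)).1
    have e2 : inner ℝ (G z - G y) (x - y) ≤ A * ‖y - z‖ * ‖x - y‖ :=
      (real_inner_le_norm _ _).trans (by
        gcongr
        rw [norm_sub_rev]
        exact h2 y hy z hz)
    have e3 : ‖y - z‖ ≤ ‖x - y‖ + ‖x - z‖ := by
      have := norm_sub_le (x - z) (x - y)
      rw [sub_sub_sub_cancel_left] at this
      linarith
    have e4 : inner ℝ (G z) (x - z) = inner ℝ (G z) (y - z) + inner ℝ (G z) (x - y) := by
      rw [← inner_add_right]; congr 1; abel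
    rw [inner_sub_left] at e2
    simp only [hℓ, hQ]
    have e5 : ‖y - z‖ ^ 2 ≤ 2 * ‖x - y‖ ^ 2 + 2 * ‖x - z‖ ^ 2 := by
      nlinarith [norm_nonneg (y - z), sq_nonneg (‖x - y‖ - ‖x - z‖)]
    have e6 : ‖y - z‖ * ‖x - y‖ ≤ (‖y - z‖ ^ 2 + ‖x - y‖ ^ 2) / 2 := by
      nlinarith [sq_nonneg (‖y - z‖ - ‖x - y‖)]
    have e7 : A * ‖y - z‖ ^ 2 + A * ‖y - z‖ * ‖x - y‖
        ≤ M / 2 * ‖x - y‖ ^ 2 + M / 2 * ‖x - z‖ ^ 2 := by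
      have : ‖y - z‖ ^ 2 + ‖y - z‖ * ‖x - y‖ ≤ 4 * ‖x - y‖ ^ 2 + 4 * ‖x - z‖ ^ 2 := by
        nlinarith [sq_nonneg ‖x - z‖]
      rw [hM]
      nlinarith [mul_le_mul_of_nonneg_left this hA]
    linarith
  set H : Set (V → ℝ) := {h | ConvexOn ℝ univ h ∧ ∀ y ∈ S, ∀ x, h x ≤ Q y x} with hH
  -- the lower paraboloids become affine after adding `M / 2 * ‖x‖ ^ 2`
  have hℓmem : ∀ z ∈ S, ℓ z ∈ H := by
    intro z hz
    refine ⟨⟨convex_univ, fun x _ y _ a b ha hb hab => le_of_eq ?_⟩, fun y hy x => hℓQ z hz y hy x⟩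
    have key : ∀ x, ℓ z x = f z - inner ℝ (G z) z - M / 2 * ‖z‖ ^ 2 + inner ℝ (G z + M • z) x := by
      intro x
      simp only [hℓ]
      rw [norm_sub_sq_real, inner_sub_right, inner_add_left, inner_smul_left, real_inner_comm x z]
      simp
      ring
    simp only [key, inner_add_right, inner_smul_right, smul_eq_mul]
    obtain rfl : b = 1 - a := by linarith
    ring
  obtain ⟨y₀, hy₀⟩ := hS
  set F : V → ℝ := fun x => sSup ((fun h : V → ℝ => h x) '' H) with hFdef
  have hne : ∀ x, ((fun h : V → ℝ => h x) '' H).Nonempty := fun x => ⟨_, _, hℓmem y₀ hy₀, rfl⟩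
  have hbdd : ∀ x, BddAbove ((fun h : V → ℝ => h x) '' H) := fun x =>
    ⟨Q y₀ x, by rintro _ ⟨h, hh, rfl⟩; exact hh.2 y₀ hy₀ x⟩
  have hleF : ∀ h ∈ H, ∀ x, h x ≤ F x := fun h hh x => le_csSup (hbdd x) ⟨h, hh, rfl⟩
  have hFle : ∀ y ∈ S, ∀ x, F x ≤ Q y x := fun y hy x => csSup_le (hne x) (by
    rintro _ ⟨h, hh, rfl⟩; exact hh.2 y hy x)
  have hconv : ConvexOn ℝ univ F := by
    refine ⟨convex_univ, fun x _ y _ a b ha hb hab => csSup_le (hne _) ?_⟩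
    rintro _ ⟨h, hh, rfl⟩
    refine (hh.1.2 (mem_univ x) (mem_univ y) ha hb hab).trans ?_
    simp only [smul_eq_mul]
    gcongr <;> exact hleF h hh _
  -- the symmetrized translate of `F` is a competitor in the supremum defining `F`
  have hsc : ∀ x u, F (x + u) + F (x - u) ≤ 2 * F x + 2 * M * ‖u‖ ^ 2 := by
    intro x u
    have hmem : (fun x => (F (x + u) + F (x - u)) / 2 - M * ‖u‖ ^ 2) ∈ H := by
      refine ⟨⟨convex_univ, fun x _ y _ a b ha hb hab => ?_⟩, fun y hy x => ?_⟩
      · have c1 := hconv.2 (mem_univ (x + u)) (mem_univ (y + u)) ha hb hab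
        have c2 := hconv.2 (mem_univ (x - u)) (mem_univ (y - u)) ha hb hab
        have d1 : a • (x + u) + b • (y + u) = a • x + b • y + u := by
          rw [smul_add, smul_add, add_add_add_comm, ← add_smul, hab, one_smul]
        have d2 : a • (x - u) + b • (y - u) = a • x + b • y - u := by
          rw [smul_sub, smul_sub, sub_add_sub_comm, ← add_smul, hab, one_smul]
        rw [d1] at c1
        rw [d2] at c2
        simp only [smul_eq_mul] at c1 c2 ⊢
        obtain rfl : b = 1 - a := by linarith
        nlinarith
      · have c1 := hFle y hy (x + u)
        have c2 := hFle y hy (x - u)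
        have key : (Q y (x + u) + Q y (x - u)) / 2 = Q y x + M * ‖u‖ ^ 2 := by
          simp only [hQ]
          rw [show x + u - y = x - y + u by abel, show x - u - y = x - y - u by abel,
            norm_add_sq_real, norm_sub_sq_real (x - y) u, norm_add_sq_real, norm_sub_sq_real x u]
          simp only [inner_add_right, inner_sub_right]
          ring
        simp only
        linarith
    have := hleF _ hmem x
    linarith
  obtain ⟨hd, hLip⟩ := differentiable_of_convex_of_semiconcave hconv hM0 hsc
  have hsq : ∀ x : V, HasGradientAt (fun x : V => M / 2 * ‖x‖ ^ 2) (M • x) x := by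
    intro x
    rw [hasGradientAt_iff_hasFDerivAt]
    refine ((hasStrictFDerivAt_norm_sq x).hasFDerivAt.const_mul (M / 2)).congr_fderiv ?_
    ext v
    simp
    ring
  have hgr : ∀ x, HasGradientAt (fun x => F x - M / 2 * ‖x‖ ^ 2) (gradient F x - M • x) x := by
    intro x
    rw [hasGradientAt_iff_hasFDerivAt, map_sub]
    exact (hd x).hasGradientAt.hasFDerivAt.sub (hsq x).hasFDerivAt
  refine ⟨fun x => F x - M / 2 * ‖x‖ ^ 2, 8 * M + M, by positivity,
    fun x => (hgr x).differentiableAt, fun x y => ?_, fun x hx => ?_⟩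
  · rw [(hgr x).gradient, (hgr y).gradient]
    have e : gradient F x - M • x - (gradient F y - M • y)
        = (gradient F x - gradient F y) - M • (x - y) := by module
    rw [e]
    refine (norm_sub_le _ _).trans ?_
    rw [norm_smul, Real.norm_of_nonneg hM0, add_mul]
    gcongr
    exact hLip x y
  · have c1 := hFle x hx x
    have c2 := hleF _ (hℓmem x hx) x
    simp only [hQ, hℓ, sub_self, norm_zero, inner_zero_right] at c1 c2
    simp only
    linarith

/-- Multiplication by a bump function turns a `C^{1,1}` function into one with compact support. -/
theorem exists_c11_bounded {F : V → ℝ} {L : ℝ} (hL : 0 ≤ L) (hF : Differentiable ℝ F)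
    (hLip : ∀ x y, ‖gradient F x - gradient F y‖ ≤ L * ‖x - y‖) {C : Set V}
    (hC : Bornology.IsBounded C) :
    ∃ (Φ : V → ℝ) (K : ℝ), 0 < K ∧ ContDiff ℝ 1 Φ ∧ (∀ x ∈ C, Φ x = F x) ∧ (∀ x, |Φ x| ≤ K) ∧
      (∀ x, ‖gradient Φ x‖ ≤ K) ∧ ∀ x y, ‖gradient Φ x - gradient Φ y‖ ≤ K * ‖x - y‖ := by
  obtain ⟨R, hR0, hR⟩ := hC.subset_closedBall_lt 0 (0 : V)
  let χ : ContDiffBump (0 : V) := ⟨R, R + 1, hR0, by linarith⟩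
  have hχC : ContDiff ℝ 2 χ := χ.contDiff
  have hgFcont : Continuous (gradient F) :=
    (LipschitzWith.of_dist_le_mul (K := L.toNNReal) fun x y => by
      rw [Real.coe_toNNReal _ hL, dist_eq_norm, dist_eq_norm]; exact hLip x y).continuous
  have hFC1 : ContDiff ℝ 1 F := by
    rw [contDiff_one_iff_fderiv]
    refine ⟨hF, ?_⟩
    rw [← toDual_comp_gradient]
    exact (InnerProductSpace.toDual ℝ V).continuous.comp hgFcont
  have hχg : ContDiff ℝ 1 (gradient χ) := by
    have : gradient χ = (InnerProductSpace.toDual ℝ V).symm ∘ fderiv ℝ χ := rfl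
    rw [this]
    exact (InnerProductSpace.toDual ℝ V).symm.toContinuousLinearEquiv.toContinuousLinearMap.contDiff.comp
      (hχC.fderiv_right (m := 1) (by norm_num))
  have hΦC : ContDiff ℝ 1 (fun x => χ x * F x) := (hχC.of_le (by norm_num)).mul hFC1
  have hcs : HasCompactSupport (fun x => χ x * F x) := χ.hasCompactSupport.mul_right
  have hgr : ∀ x, gradient (fun x => χ x * F x) x = χ x • gradient F x + F x • gradient χ x := by
    intro x
    refine HasGradientAt.gradient ?_
    rw [hasGradientAt_iff_hasFDerivAt]
    have := ((hχC.differentiable (by norm_num)) x).hasGradientAt.hasFDerivAt.mul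
      (hF x).hasGradientAt.hasFDerivAt
    refine this.congr_fderiv ?_
    simp
  obtain ⟨K₁, hK₁⟩ := hcs.exists_bound_of_continuous hΦC.continuous
  have hgcs : HasCompactSupport (fun x => F x • gradient χ x) := by
    have : HasCompactSupport (gradient χ) := by
      have h0 : gradient χ = (InnerProductSpace.toDual ℝ V).symm ∘ fderiv ℝ χ := rfl
      rw [h0]
      exact (χ.hasCompactSupport.fderiv ℝ).comp_left (map_zero _)
    exact this.smul_left
  obtain ⟨K₂, hK₂⟩ := ContDiff.lipschitzWith_of_hasCompactSupport hgcs (hFC1.smul hχg) one_ne_zero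
  obtain ⟨K₃, hK₃⟩ := hgcs.exists_bound_of_continuous (hFC1.smul hχg).continuous
  have hgcs' : HasCompactSupport (fun x => χ x • gradient F x) := χ.hasCompactSupport.smul_right
  obtain ⟨K₄, hK₄⟩ := hgcs'.exists_bound_of_continuous (hχC.continuous.smul hgFcont)
  obtain ⟨K₅, hK₅⟩ := ContDiff.lipschitzWith_of_hasCompactSupport χ.hasCompactSupport hχC
    two_ne_zero
  obtain ⟨B, hB⟩ := (isCompact_closedBall (0 : V) (R + 1)).exists_bound_of_continuousOn
    hgFcont.continuousOn
  have hB0 : 0 ≤ B := (norm_nonneg _).trans (hB 0 (by simp; linarith))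
  have haux : ∀ x y : V, y ∈ Metric.closedBall (0 : V) (R + 1) →
      ‖χ x • gradient F x - χ y • gradient F y‖ ≤ (L + K₅ * B) * ‖x - y‖ := by
    intro x y hy
    have e : χ x • gradient F x - χ y • gradient F y
        = χ x • (gradient F x - gradient F y) + (χ x - χ y) • gradient F y := by module
    rw [e]
    refine (norm_add_le _ _).trans ?_
    rw [norm_smul, norm_smul, Real.norm_of_nonneg χ.nonneg]
    have e1 : χ x * ‖gradient F x - gradient F y‖ ≤ 1 * (L * ‖x - y‖) :=
      mul_le_mul χ.le_one (hLip x y) (norm_nonneg _) zero_le_one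
    have e2 : ‖χ x - χ y‖ * ‖gradient F y‖ ≤ (K₅ * ‖x - y‖) * B := by
      have := hK₅.dist_le_mul x y
      rw [dist_eq_norm, dist_eq_norm] at this
      exact mul_le_mul this (hB y hy) (norm_nonneg _) (by positivity)
    nlinarith
  have hzero : ∀ x : V, x ∉ Metric.closedBall (0 : V) (R + 1) → χ x = 0 := by
    intro x hx
    exact χ.zero_of_le_dist (by
      rw [Metric.mem_closedBall, not_le] at hx
      exact hx.le)
  have hLip1 : ∀ x y : V,
      ‖χ x • gradient F x - χ y • gradient F y‖ ≤ (L + K₅ * B) * ‖x - y‖ := by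
    intro x y
    by_cases hy : y ∈ Metric.closedBall (0 : V) (R + 1)
    · exact haux x y hy
    by_cases hx : x ∈ Metric.closedBall (0 : V) (R + 1)
    · rw [norm_sub_rev, norm_sub_rev x y]
      exact haux y x hx
    · rw [hzero x hx, hzero y hy]
      simp
      positivity
  have hK₁0 : 0 ≤ K₁ := (norm_nonneg _).trans (hK₁ 0)
  have hK₃0 : 0 ≤ K₃ := (norm_nonneg _).trans (hK₃ 0)
  have hK₄0 : 0 ≤ K₄ := (norm_nonneg _).trans (hK₄ 0)
  have hK₅B : 0 ≤ K₅ * B := by positivity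
  have hK₂0 : (0 : ℝ) ≤ K₂ := K₂.coe_nonneg
  refine ⟨fun x => χ x * F x, 1 + K₁ + K₂ + K₃ + K₄ + L + K₅ * B, by positivity, hΦC,
    fun x hx => ?_, fun x => ?_, fun x => ?_, fun x y => ?_⟩
  · have : χ x = 1 := χ.one_of_mem_closedBall (hR hx)
    simp [this]
  · have := hK₁ x
    rw [Real.norm_eq_abs] at this
    linarith
  · rw [hgr]
    have := norm_add_le (χ x • gradient F x) (F x • gradient χ x)
    linarith [hK₃ x, hK₄ x]
  · rw [hgr, hgr, add_sub_add_comm]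
    refine (norm_add_le _ _).trans ?_
    have e1 := hLip1 x y
    have e2 := hK₂.dist_le_mul x y
    rw [dist_eq_norm, dist_eq_norm] at e2
    have e3 : 0 ≤ (1 + K₁ + K₃ + K₄) * ‖x - y‖ := by positivity
    nlinarith

end Whitney

section

variable {n m r : ℕ} {ψ : Fin r → E n → ℝ} {ρ η Mψ : ℝ}

namespace ConstraintData

variable (D : ConstraintData ψ ρ η Mψ)
include D

/-- Around each point of `C` there are a ball, a direction `v` and a uniform cone of vectors around
`v` by which points of `C` in the ball are moved into the interior of `C`. -/
theorem exists_interior_cone {c : E n} (hc : c ∈ sweepingSet ψ) {L : ℝ}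
    (hL : ∀ i, ∀ x ∈ Metric.cthickening (ρ / 2) (sweepingSet ψ), ‖gradient (ψ i) x‖ ≤ L) :
    ∃ v : E n, ‖v‖ ≤ 1 ∧ ∃ ε > 0, (∀ i, ψ i c = 0 → ∀ x ∈ Metric.ball c ε,
        inner ℝ (gradient (ψ i) x) v ≤ -(2 * η)) ∧
      (∀ i, ψ i c ≠ 0 → ∀ x ∈ Metric.ball c ε, ψ i x < 0) ∧
      ∀ y ∈ sweepingSet ψ, y ∈ Metric.ball c ε → ∀ (s : ℝ) (w : E n), L * ‖w‖ < 2 * η * s →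
        0 ≤ s → y + (s • v + w) ∈ Metric.ball c ε → y + (s • v + w) ∈ interior (sweepingSet ψ) := by
  obtain ⟨v, hv1, hv⟩ := D.exists_inward hc
  have hball : ∀ᶠ x in 𝓝 c, x ∈ Metric.thickening (ρ / 2) (sweepingSet ψ) ∧ ∀ i,
      (ψ i c = 0 → inner ℝ (gradient (ψ i) x) v < -(2 * η)) ∧ (ψ i c ≠ 0 → ψ i x < 0) := by
    have h0 : ∀ᶠ x in 𝓝 c, x ∈ Metric.thickening (ρ / 2) (sweepingSet ψ) :=
      Metric.isOpen_thickening.mem_nhds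
        (Metric.self_subset_thickening (half_pos D.rho_pos) _ hc)
    refine h0.and ?_
    rw [eventually_all]
    intro i
    by_cases hi : ψ i c = 0
    · have h1 : ContinuousAt (fun x => inner ℝ (gradient (ψ i) x) v) c :=
        (D.continuousAt_gradient hc).inner continuousAt_const
      filter_upwards [h1.eventually_lt continuousAt_const (hv i hi)] with x hx
      exact ⟨fun _ => hx, fun h => absurd hi h⟩
    · have h1 : ψ i c < 0 := lt_of_le_of_ne (mem_sweepingSet.1 hc i) hi
      filter_upwards [(D.continuousAt (i := i) hc).eventually_lt continuousAt_const h1] with x hx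
      exact ⟨fun h => absurd h hi, fun _ => hx⟩
  obtain ⟨ε, hε, hb⟩ := Metric.eventually_nhds_iff_ball.1 hball
  refine ⟨v, hv1, ε, hε, fun i hi x hx => ((hb x hx).2 i).1 hi |>.le,
    fun i hi x hx => ((hb x hx).2 i).2 hi, fun y hy hyb s w hsw hs0 hyw => ?_⟩
  have hN : ∀ x ∈ Metric.ball c ε, x ∈ Metric.cthickening (ρ / 2) (sweepingSet ψ) := fun x hx =>
    Metric.thickening_subset_cthickening _ _ (hb x hx).1
  have hneg : ∀ i, ψ i (y + (s • v + w)) < 0 := by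
    intro i
    by_cases hi : ψ i c = 0
    · obtain ⟨p, hp, hmv⟩ := domain_mvt (f := ψ i) (s := Metric.ball c ε) (x := y)
        (y := y + (s • v + w)) (f' := fun x => fderiv ℝ (ψ i) x)
        (fun x hx => (D.differentiableAt i (hN x hx)).hasFDerivAt.hasFDerivWithinAt)
        (convex_ball c ε) hyb hyw
      have hpb : p ∈ Metric.ball c ε := (convex_ball c ε).segment_subset hyb hyw hp
      rw [← inner_gradient_left, add_sub_cancel_left, inner_add_right, inner_smul_right] at hmv
      have h1 := ((hb p hpb).2 i).1 hi
      have h2 : inner ℝ (gradient (ψ i) p) w ≤ L * ‖w‖ :=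
        (real_inner_le_norm _ _).trans (by gcongr; exact hL i p (hN p hpb))
      have h3 := mem_sweepingSet.1 hy i
      have h4 := mul_le_mul_of_nonneg_left h1.le hs0
      linarith
    · exact ((hb _ hyw).2 i).2 hi
  have hev : ∀ᶠ x in 𝓝 (y + (s • v + w)), ∀ i, ψ i x < 0 := by
    rw [eventually_all]
    exact fun i => (D.differentiableAt i (hN _ hyw)).continuousAt.eventually_lt
      continuousAt_const (hneg i)
  rw [mem_interior_iff_mem_nhds]
  filter_upwards [hev] with x hx
  exact mem_sweepingSet.2 fun i => (hx i).le

/-- Every point of `C` is a limit of interior points, along an inward direction. -/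
theorem closure_interior : closure (interior (sweepingSet ψ)) = sweepingSet ψ := by
  refine subset_antisymm ?_ fun c hc => ?_
  · exact (closure_mono interior_subset).trans D.compact.isClosed.closure_eq.subset
  · obtain ⟨L, hL0, hL⟩ := D.exists_gradient_bound
    obtain ⟨v, hv, ε, hε, -, -, hcone⟩ := D.exists_interior_cone hc hL
    have hlim : Tendsto (fun s : ℝ => c + (s • v + 0)) (𝓝[>] 0) (𝓝 c) := by
      have : Continuous fun s : ℝ => c + (s • v + 0) := by fun_prop
      have h := this.tendsto 0
      simp only [zero_smul, add_zero] at h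
      simpa using h.mono_left nhdsWithin_le_nhds
    refine mem_closure_of_tendsto hlim ?_
    filter_upwards [hlim (Metric.ball_mem_nhds c hε), self_mem_nhdsWithin] with s hs hs0
    exact hcone c hc (Metric.mem_ball_self hε) s 0
      (by simpa using mul_pos (mul_pos two_pos D.eta_pos) hs0) (le_of_lt hs0) hs

/-- A function that is `C^{1,1}` on `int C` satisfies Whitney's condition there: nearby points are
joined in `int C` by polygonal paths of comparable length. -/
theorem exists_whitney_bound {f : E n → ℝ}
    (hd : ∀ x ∈ interior (sweepingSet ψ), DifferentiableAt ℝ f x) {Λ : ℝ} (hΛ : 0 ≤ Λ)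
    (hg : ∀ x ∈ interior (sweepingSet ψ), ∀ y ∈ interior (sweepingSet ψ),
      ‖gradient f x - gradient f y‖ ≤ Λ * ‖x - y‖)
    {B : ℝ} (hB : ∀ x ∈ sweepingSet ψ, |f x| ≤ B) :
    ∃ A, 0 ≤ A ∧ ∀ y ∈ interior (sweepingSet ψ), ∀ z ∈ interior (sweepingSet ψ),
      |f y - f z - inner ℝ (gradient f z) (y - z)| ≤ A * ‖y - z‖ ^ 2 := by
  obtain ⟨L, hL0, hL⟩ := D.exists_gradient_bound
  have hη := D.eta_pos
  -- a step of length at least `κ d` along `v` absorbs any displacement of length `d`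
  set κ : ℝ := (L + 1) / (2 * η) with hκ
  have hκ0 : 0 < κ := by positivity
  set A₀ : ℝ := Λ * (1 + κ) * (1 + 2 * κ) with hA₀
  have hA₀0 : 0 ≤ A₀ := by positivity
  have hmv : ∀ z p q : E n, ∀ R : ℝ, z ∈ interior (sweepingSet ψ) →
      segment ℝ p q ⊆ interior (sweepingSet ψ) → segment ℝ p q ⊆ Metric.closedBall z R →
      |f q - f p - inner ℝ (gradient f z) (q - p)| ≤ Λ * R * ‖q - p‖ := by
    intro z p q R hz hseg hR
    have := (convex_segment p q).norm_image_sub_le_of_norm_fderiv_le' (f := f) (𝕜 := ℝ)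
      (φ := fderiv ℝ f z) (C := Λ * R) (fun x hx => hd x (hseg hx)) (fun x hx => by
        rw [← toDual_gradient, ← toDual_gradient, ← map_sub, LinearIsometryEquiv.norm_map]
        refine (hg x (hseg hx) z hz).trans ?_
        gcongr
        simpa [dist_eq_norm] using hR hx) (left_mem_segment ℝ p q) (right_mem_segment ℝ p q)
    rwa [← inner_gradient_left, Real.norm_eq_abs] at this
  -- Local estimate, with a constant that does not depend on the point: follow the path
  -- `z → z + s • v → y + s • v → y` with `s = κ ‖y - z‖`, which stays in the interior.
  have hloc : ∀ c ∈ sweepingSet ψ, ∃ ε > 0, ∀ y ∈ interior (sweepingSet ψ),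
      ∀ z ∈ interior (sweepingSet ψ), y ∈ Metric.ball c ε → z ∈ Metric.ball c ε →
      |f y - f z - inner ℝ (gradient f z) (y - z)| ≤ A₀ * ‖y - z‖ ^ 2 := by
    intro c hc
    obtain ⟨v, hv, ε, hε, -, -, hcone⟩ := D.exists_interior_cone hc hL
    refine ⟨ε / (1 + 2 * κ), by positivity, fun y hy z hz hyb hzb => ?_⟩
    rcases eq_or_ne y z with rfl | hyz
    · simp
    set d : ℝ := ‖y - z‖ with hdd
    have hd0 : 0 < d := norm_pos_iff.2 (sub_ne_zero.2 hyz)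
    set s : ℝ := κ * d with hs
    have hs0 : 0 < s := by positivity
    have hsv : ∀ σ ∈ Icc 0 s, ‖σ • v‖ ≤ s := fun σ hσ => by
      rw [norm_smul, Real.norm_of_nonneg hσ.1]
      exact (mul_le_of_le_one_right hσ.1 hv).trans hσ.2
    have hdε : d < 2 * (ε / (1 + 2 * κ)) := by
      have := dist_triangle_right y z c
      rw [dist_eq_norm] at this
      rw [Metric.mem_ball] at hyb hzb
      linarith
    have hεs : ε / (1 + 2 * κ) + s < ε := by
      have h1 : κ * d < κ * (2 * (ε / (1 + 2 * κ))) := mul_lt_mul_of_pos_left hdε hκ0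
      have h2 : ε / (1 + 2 * κ) * (1 + 2 * κ) = ε := div_mul_cancel₀ _ (by positivity)
      nlinarith
    have hmemball : ∀ x ∈ Metric.ball c (ε / (1 + 2 * κ)), ∀ σ ∈ Icc 0 s,
        x + σ • v ∈ Metric.ball c ε := by
      intro x hx σ hσ
      rw [Metric.mem_ball, dist_eq_norm] at hx ⊢
      rw [add_sub_right_comm]
      exact (norm_add_le _ _).trans_lt (by linarith [hsv σ hσ])
    have hsub : Metric.ball c (ε / (1 + 2 * κ)) ⊆ Metric.ball c ε := by
      apply Metric.ball_subset_ball
      linarith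
    have hvert : ∀ x ∈ interior (sweepingSet ψ), x ∈ Metric.ball c (ε / (1 + 2 * κ)) →
        ∀ σ ∈ Icc 0 s, x + σ • v ∈ interior (sweepingSet ψ) := by
      intro x hx hxb σ hσ
      rcases hσ.1.eq_or_lt with h0 | h0
      · rwa [← h0, zero_smul, add_zero]
      · have := hcone x (interior_subset hx) (hsub hxb) σ 0 (by simp; positivity) hσ.1
          (by simpa using hmemball x hxb σ hσ)
        simpa using this
    have hsegv : ∀ x ∈ interior (sweepingSet ψ), x ∈ Metric.ball c (ε / (1 + 2 * κ)) →
        segment ℝ x (x + s • v) ⊆ interior (sweepingSet ψ) := by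
      intro x hx hxb p hp
      rw [segment_eq_image'] at hp
      obtain ⟨τ, hτ, rfl⟩ := hp
      simp only [add_sub_cancel_left, smul_smul]
      exact hvert x hx hxb _ ⟨mul_nonneg hτ.1 hs0.le, mul_le_of_le_one_left hs0.le hτ.2⟩
    have hs_mem : s ∈ Icc 0 s := right_mem_Icc.2 hs0.le
    have hsegh : segment ℝ (z + s • v) (y + s • v) ⊆ interior (sweepingSet ψ) := by
      intro p hp
      have hpb : p ∈ Metric.ball c ε := (convex_ball c ε).segment_subset
        (hmemball z hzb s hs_mem) (hmemball y hyb s hs_mem) hp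
      rw [segment_eq_image'] at hp
      obtain ⟨τ, hτ, rfl⟩ := hp
      have e : z + s • v + τ • (y + s • v - (z + s • v)) = z + (s • v + τ • (y - z)) := by module
      simp only at hpb ⊢
      rw [e] at hpb ⊢
      refine hcone z (interior_subset hz) (hsub hzb) s _ ?_ hs0.le hpb
      rw [norm_smul, Real.norm_of_nonneg hτ.1]
      have h1 : 2 * η * s = (L + 1) * d := by
        rw [hs, hκ]; field_simp
      have h2 : L * (τ * ‖y - z‖) ≤ L * d := by
        gcongr
        exact mul_le_of_le_one_left (norm_nonneg _) hτ.2
      rw [h1]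
      linarith
    have hR0 : z ∈ Metric.closedBall z ((1 + κ) * d) := Metric.mem_closedBall_self (by positivity)
    have hR1 : z + s • v ∈ Metric.closedBall z ((1 + κ) * d) := by
      rw [Metric.mem_closedBall, dist_eq_norm, add_sub_cancel_left]
      linarith [hsv s hs_mem]
    have hR2 : y + s • v ∈ Metric.closedBall z ((1 + κ) * d) := by
      rw [Metric.mem_closedBall, dist_eq_norm, add_sub_right_comm]
      exact (norm_add_le _ _).trans (by linarith [hsv s hs_mem])
    have hR3 : y ∈ Metric.closedBall z ((1 + κ) * d) := by
      rw [Metric.mem_closedBall, dist_eq_norm]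
      linarith
    have hcb := convex_closedBall z ((1 + κ) * d)
    have e1 := hmv z z (z + s • v) _ hz (hsegv z hz hzb) (hcb.segment_subset hR0 hR1)
    have e2 := hmv z (z + s • v) (y + s • v) _ hz hsegh (hcb.segment_subset hR1 hR2)
    have e3 := hmv z (y + s • v) y _ hz (by
      rw [segment_symm]; exact hsegv y hy hyb) (hcb.segment_subset hR2 hR3)
    rw [add_sub_cancel_left] at e1
    rw [add_sub_add_right_eq_sub] at e2
    rw [sub_add_cancel_left, norm_neg, inner_neg_right] at e3
    have hn := hsv s hs_mem
    have hRΛ : 0 ≤ Λ * ((1 + κ) * d) := by positivity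
    have hn' := mul_le_mul_of_nonneg_left hn hRΛ
    have hA : A₀ * d ^ 2 = Λ * ((1 + κ) * d) * s + Λ * ((1 + κ) * d) * d
        + Λ * ((1 + κ) * d) * s := by
      rw [hA₀, hs]; ring
    rw [abs_le] at e1 e2 e3 ⊢
    rw [hA]
    constructor <;> linarith [e1.1, e1.2, e2.1, e2.2, e3.1, e3.2]
  choose! ε hε hεb using hloc
  -- a Lebesgue number of the cover makes the estimate uniform for close points
  obtain ⟨δ, hδ, hleb⟩ := lebesgue_number_lemma_of_metric (ι := sweepingSet ψ) D.compact
    (c := fun c => Metric.ball (c : E n) (ε c)) (fun c => Metric.isOpen_ball)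
    (fun x hx => mem_iUnion.2 ⟨⟨x, hx⟩, Metric.mem_ball_self (hε x hx)⟩)
  obtain ⟨R, hR⟩ := D.compact.isBounded.exists_norm_le
  rcases (interior (sweepingSet ψ)).eq_empty_or_nonempty with hemp | ⟨z₀, hz₀⟩
  · exact ⟨0, le_rfl, fun y hy => by simp [hemp] at hy⟩
  have hR0 : 0 ≤ R := (norm_nonneg _).trans (hR z₀ (interior_subset hz₀))
  have hB0 : 0 ≤ B := (abs_nonneg _).trans (hB z₀ (interior_subset hz₀))
  set G : ℝ := ‖gradient f z₀‖ + Λ * (2 * R) with hG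
  have hGb : ∀ z ∈ interior (sweepingSet ψ), ‖gradient f z‖ ≤ G := by
    intro z hz
    have h1 := hg z hz z₀ hz₀
    have h2 : ‖z - z₀‖ ≤ 2 * R := (norm_sub_le _ _).trans (by
      linarith [hR z (interior_subset hz), hR z₀ (interior_subset hz₀)])
    have h3 := norm_le_norm_add_norm_sub' (gradient f z) (gradient f z₀)
    have h4 := mul_le_mul_of_nonneg_left h2 hΛ
    linarith
  have hG0 : 0 ≤ G := by positivity
  refine ⟨A₀ + (2 * B + G * (2 * R)) / δ ^ 2, by positivity, fun y hy z hz => ?_⟩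
  by_cases hyz : ‖y - z‖ < δ
  · obtain ⟨⟨c, hc⟩, hball⟩ := hleb z (interior_subset hz)
    have := hεb c hc y hy z hz (hball (by rwa [Metric.mem_ball, dist_eq_norm]))
      (hball (Metric.mem_ball_self hδ))
    refine this.trans ?_
    gcongr
    exact le_add_of_nonneg_right (by positivity)
  · push Not at hyz
    have h2 : ‖y - z‖ ≤ 2 * R := (norm_sub_le _ _).trans (by
      linarith [hR z (interior_subset hz), hR y (interior_subset hy)])
    have h1 : |f y - f z - inner ℝ (gradient f z) (y - z)| ≤ 2 * B + G * (2 * R) := by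
      have a1 := hB y (interior_subset hy)
      have a2 := hB z (interior_subset hz)
      have a3 : |inner ℝ (gradient f z) (y - z)| ≤ G * (2 * R) :=
        (abs_real_inner_le_norm _ _).trans
          (mul_le_mul (hGb z hz) h2 (norm_nonneg _) hG0)
      rw [abs_le] at a1 a2 a3 ⊢
      constructor <;> linarith [a1.1, a1.2, a2.1, a2.2, a3.1, a3.2]
    refine h1.trans ?_
    have h3 : δ ^ 2 ≤ ‖y - z‖ ^ 2 := by gcongr
    have h4 : 2 * B + G * (2 * R) ≤ (2 * B + G * (2 * R)) / δ ^ 2 * ‖y - z‖ ^ 2 := by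
      rw [div_mul_eq_mul_div, le_div_iff₀ (by positivity)]
      gcongr
    nlinarith [sq_nonneg ‖y - z‖]

/-- A regular potential on `C` is the restriction of a bounded `C^{1,1}` function with bounded
gradient. -/
theorem exists_isExtension {φ : E n → EReal} (hφbot : ∀ x, φ x ≠ ⊥)
    (hdom : {x | φ x < ⊤} = sweepingSet ψ) (hint : (interior (sweepingSet ψ)).Nonempty)
    (hφ : RegularPotential (sweepingSet ψ) φ) :
    ∃ Φ K, IsExtension (sweepingSet ψ) φ Φ K := by
  obtain ⟨⟨L₁, hL₁⟩, hC1, Λ, hΛ⟩ := hφ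
  set f : E n → ℝ := fun x => (φ x).toReal with hf
  obtain ⟨B, hB⟩ := D.compact.exists_bound_of_continuousOn hL₁.continuousOn
  have hgrad : ∀ x ∈ interior (sweepingSet ψ), ∀ y ∈ interior (sweepingSet ψ),
      ‖gradient f x - gradient f y‖ ≤ Λ * ‖x - y‖ := by
    intro x hx y hy
    have := hΛ.dist_le_mul x hx y hy
    rwa [dist_eq_norm, dist_eq_norm] at this
  obtain ⟨A, hA0, hA⟩ := D.exists_whitney_bound (f := f)
    (fun x hx => (hC1.differentiableOn one_ne_zero).differentiableAt
      (isOpen_interior.mem_nhds hx)) Λ.coe_nonneg hgrad hB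
  obtain ⟨F, L, hL0, hFd, hFL, hFf⟩ := exists_c11_extension hint (f := f) (G := gradient f)
    (A := A + Λ) (by positivity)
    (fun y hy z hz => (hA y hy z hz).trans (by gcongr; exact le_add_of_nonneg_right Λ.coe_nonneg))
    (fun y hy z hz => (hgrad y hy z hz).trans (by gcongr; exact le_add_of_nonneg_left hA0))
  obtain ⟨Φ, K, hK, hΦ1, hΦF, hb, hgb, hgl⟩ := exists_c11_bounded hL0 hFd hFL D.compact.isBounded
  refine ⟨Φ, K, hK, hΦ1, fun x hx => ?_, hb, hgb, hgl⟩
  have hfin : φ x ≠ ⊤ := by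
    have : x ∈ {x | φ x < ⊤} := by rwa [hdom]
    exact ne_of_lt this
  have heq : EqOn F f (sweepingSet ψ) := by
    have h1 : EqOn F f (interior (sweepingSet ψ)) := hFf
    exact h1.of_subset_closure hFd.continuous.continuousOn hL₁.continuousOn
      interior_subset D.closure_interior.symm.subset
  rw [hΦF x hx, heq hx]
  exact EReal.coe_toReal hfin (hφbot x)

end ConstraintData

end

/-! ### Absolutely continuous curves -/

section Curves

theorem ae_timeMeasure_iff {T : ℝ} {p : ℝ → Prop} :
    (∀ᵐ t ∂timeMeasure T, p t) ↔ ∀ᵐ t, t ∈ Icc 0 T → p t :=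
  ae_restrict_iff' measurableSet_Icc

theorem ae_mem_timeMeasure (T : ℝ) : ∀ᵐ t ∂timeMeasure T, t ∈ Icc 0 T :=
  ae_timeMeasure_iff.2 (Eventually.of_forall fun _ h => h)

theorem ae_mem_Ioo_timeMeasure (T : ℝ) : ∀ᵐ t ∂timeMeasure T, t ∈ Ioo 0 T := by
  have h0 : ∀ᵐ t : ℝ, t ≠ 0 := by simp [ae_iff, measure_singleton]
  have h1 : ∀ᵐ t : ℝ, t ≠ T := by simp [ae_iff, measure_singleton]
  rw [ae_timeMeasure_iff]
  filter_upwards [h0, h1] with t h0 h1 h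
  exact ⟨lt_of_le_of_ne h.1 h0.symm, lt_of_le_of_ne h.2 h1⟩

instance isFiniteMeasure_timeMeasure (T : ℝ) : IsFiniteMeasure (timeMeasure T) :=
  ⟨by simp [timeMeasure]⟩

theorem timeMeasure_real_univ {T : ℝ} (hT : 0 ≤ T) : (timeMeasure T).real univ = T := by
  simp [timeMeasure, measureReal_def, hT]

theorem intervalIntegrable_of_timeMeasure {F : Type*} [NormedAddCommGroup F] {T : ℝ} {v : ℝ → F}
    (hv : Integrable v (timeMeasure T)) {a b : ℝ} (ha : a ∈ Icc 0 T) (hb : b ∈ Icc 0 T) :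
    IntervalIntegrable v volume a b := by
  have h : IntegrableOn v (uIcc a b) volume :=
    IntegrableOn.mono_set hv (uIcc_subset_Icc ha hb)
  exact h.intervalIntegrable

theorem ae_uIoc_of_timeMeasure {T : ℝ} {p : ℝ → Prop} (h : ∀ᵐ t ∂timeMeasure T, p t) {a b : ℝ}
    (ha : a ∈ Icc 0 T) (hb : b ∈ Icc 0 T) : ∀ᵐ t, t ∈ uIoc a b → p t := by
  filter_upwards [ae_timeMeasure_iff.1 h] with t ht hmem
  exact ht (uIcc_subset_Icc ha hb (uIoc_subset_uIcc hmem))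

theorem intervalIntegral_timeMeasure {F : Type*} [NormedAddCommGroup F] [NormedSpace ℝ F] {T : ℝ}
    (hT : 0 ≤ T) (v : ℝ → F) : ∫ t in (0 : ℝ)..T, v t = ∫ t, v t ∂timeMeasure T := by
  rw [intervalIntegral.integral_of_le hT, timeMeasure, integral_Icc_eq_integral_Ioc]

theorem absolutelyContinuousOnInterval_of_dist_le {X Y : Type*} [PseudoMetricSpace X]
    [PseudoMetricSpace Y] {f : ℝ → X} {g : ℝ → Y} {a b : ℝ}
    (hg : AbsolutelyContinuousOnInterval g a b)
    (h : ∀ s ∈ uIcc a b, ∀ t ∈ uIcc a b, dist (f s) (f t) ≤ dist (g s) (g t)) :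
    AbsolutelyContinuousOnInterval f a b := by
  rw [absolutelyContinuousOnInterval_iff] at hg ⊢
  intro ε hε
  obtain ⟨δ, hδ, hE⟩ := hg ε hε
  refine ⟨δ, hδ, fun I hI hlt => lt_of_le_of_lt (Finset.sum_le_sum fun i hi => ?_) (hE I hI hlt)⟩
  have := hI.1 i hi
  exact h _ this.1 _ this.2

variable {F : Type*} [NormedAddCommGroup F] [NormedSpace ℝ F]

theorem absolutelyContinuousOnInterval_integral {T : ℝ} (hT : 0 ≤ T) {v : ℝ → F}
    (hv : Integrable v (timeMeasure T)) (c : F) :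
    AbsolutelyContinuousOnInterval (fun t => c + ∫ s in (0 : ℝ)..t, v s) 0 T := by
  have h0 : (0 : ℝ) ∈ Icc 0 T := left_mem_Icc.2 hT
  have h1 : T ∈ Icc 0 T := right_mem_Icc.2 hT
  refine absolutelyContinuousOnInterval_of_dist_le
    ((intervalIntegrable_of_timeMeasure hv.norm h0 h1).absolutelyContinuousOnInterval_intervalIntegral
      (c := 0) (by simp)) fun s hs t ht => ?_
  rw [uIcc_of_le hT] at hs ht
  rw [dist_add_left, dist_eq_norm, dist_eq_norm,
    intervalIntegral.integral_interval_sub_left (intervalIntegrable_of_timeMeasure hv h0 hs)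
      (intervalIntegrable_of_timeMeasure hv h0 ht),
    intervalIntegral.integral_interval_sub_left (intervalIntegrable_of_timeMeasure hv.norm h0 hs)
      (intervalIntegrable_of_timeMeasure hv.norm h0 ht)]
  exact intervalIntegral.norm_integral_le_abs_integral_norm

theorem ae_hasDerivAt_integral [CompleteSpace F] {T : ℝ} (hT : 0 ≤ T) {v : ℝ → F}
    (hv : Integrable v (timeMeasure T)) (c : F) :
    ∀ᵐ t ∂timeMeasure T, HasDerivAt (fun t => c + ∫ s in (0 : ℝ)..t, v s) (v t) t := by
  have := (intervalIntegrable_of_timeMeasure hv (left_mem_Icc.2 hT)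
    (right_mem_Icc.2 hT)).ae_hasDerivAt_integral
  rw [ae_timeMeasure_iff]
  rw [uIcc_of_le hT] at this
  filter_upwards [this] with t ht hmem
  exact (ht hmem 0 (left_mem_Icc.2 hT)).const_add c

theorem hasDerivAt_congr_Icc {T : ℝ} {x y : ℝ → F} (h : EqOn x y (Icc 0 T)) {v : F} {t : ℝ}
    (ht : t ∈ Ioo 0 T) (hx : HasDerivAt x v t) : HasDerivAt y v t :=
  hx.congr_of_eventuallyEq (by
    filter_upwards [Icc_mem_nhds ht.1 ht.2] with s hs using (h hs).symm)

/-- The fundamental theorem of calculus for absolutely continuous curves in a normed space. -/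
theorem eq_add_integral [CompleteSpace F] {T : ℝ} (hT : 0 ≤ T) {x v : ℝ → F}
    (hx : AbsolutelyContinuousOnInterval x 0 T) (hv : Integrable v (timeMeasure T))
    (hd : ∀ᵐ t ∂timeMeasure T, HasDerivAt x (v t) t) {t : ℝ} (ht : t ∈ Icc 0 T) :
    x t = x 0 + ∫ s in (0 : ℝ)..t, v s := by
  have hac := hx.sub (absolutelyContinuousOnInterval_integral hT hv (x 0))
  have hz : ∀ᵐ t, t ∈ uIcc 0 T →
      HasDerivAt (x - fun t => x 0 + ∫ s in (0 : ℝ)..t, v s) 0 t := by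
    rw [uIcc_of_le hT, ← ae_timeMeasure_iff]
    filter_upwards [hd, ae_hasDerivAt_integral hT hv (x 0)] with t h1 h2
    simpa using h1.sub h2
  obtain ⟨k, hk⟩ := hac.const_of_ae_hasDerivAt_zero hz
  rw [uIcc_of_le hT] at hk
  have h0 := hk 0 (left_mem_Icc.2 hT)
  have h1 := hk t ht
  simp only [Pi.sub_apply, intervalIntegral.integral_same, add_zero, sub_self] at h0 h1
  rw [← h0, sub_eq_zero] at h1
  exact h1

theorem sub_eq_integral [CompleteSpace F] {T : ℝ} (hT : 0 ≤ T) {x v : ℝ → F}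
    (hx : AbsolutelyContinuousOnInterval x 0 T) (hv : Integrable v (timeMeasure T))
    (hd : ∀ᵐ t ∂timeMeasure T, HasDerivAt x (v t) t) {s t : ℝ} (hs : s ∈ Icc 0 T)
    (ht : t ∈ Icc 0 T) : x t - x s = ∫ τ in s..t, v τ := by
  rw [eq_add_integral hT hx hv hd ht, eq_add_integral hT hx hv hd hs, add_sub_add_left_eq_sub,
    intervalIntegral.integral_interval_sub_left
      (intervalIntegrable_of_timeMeasure hv (left_mem_Icc.2 hT) ht)
      (intervalIntegrable_of_timeMeasure hv (left_mem_Icc.2 hT) hs)]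

theorem integrable_of_ae_bound [CompleteSpace F] [SecondCountableTopology F] {T : ℝ}
    {x v : ℝ → F} (hd : ∀ᵐ t ∂timeMeasure T, HasDerivAt x (v t) t) {L : ℝ}
    (hL : ∀ᵐ t ∂timeMeasure T, ‖v t‖ ≤ L) : Integrable v (timeMeasure T) := by
  borelize F
  have hm : AEStronglyMeasurable v (timeMeasure T) :=
    ((measurable_deriv x).aestronglyMeasurable).congr (by
      filter_upwards [hd] with t ht using ht.deriv)
  exact (integrable_const L).mono' hm hL

theorem lipschitz_of_ae_bound [CompleteSpace F] [SecondCountableTopology F] {T : ℝ} (hT : 0 ≤ T)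
    {x v : ℝ → F} (hx : AbsolutelyContinuousOnInterval x 0 T)
    (hd : ∀ᵐ t ∂timeMeasure T, HasDerivAt x (v t) t) {L : ℝ}
    (hL : ∀ᵐ t ∂timeMeasure T, ‖v t‖ ≤ L) :
    ∀ s ∈ Icc 0 T, ∀ t ∈ Icc 0 T, ‖x t - x s‖ ≤ L * |t - s| := by
  intro s hs t ht
  rw [sub_eq_integral hT hx (integrable_of_ae_bound hd hL) hd hs ht]
  exact intervalIntegral.norm_integral_le_of_norm_le_const_ae (ae_uIoc_of_timeMeasure hL hs ht)

theorem le_of_ae_deriv_nonpos {a b : ℝ} (hab : a ≤ b) {f f' : ℝ → ℝ}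
    (hf : AbsolutelyContinuousOnInterval f a b)
    (hd : ∀ᵐ t, t ∈ Ioo a b → HasDerivAt f (f' t) t ∧ f' t ≤ 0) : f b ≤ f a := by
  have h := hf.integral_deriv_eq_sub
  have h0 : ∫ t in a..b, deriv f t ≤ 0 := by
    rw [intervalIntegral.integral_of_le hab, integral_Ioc_eq_integral_Ioo]
    refine setIntegral_nonpos_ae measurableSet_Ioo ?_
    filter_upwards [hd] with t ht hmem
    rw [(ht hmem).1.deriv]
    exact (ht hmem).2
  linarith

/-- Grönwall's inequality for absolutely continuous functions. -/
theorem nonpos_of_deriv_le_mul {T : ℝ} {f f' : ℝ → ℝ} (A : ℝ)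
    (hf : AbsolutelyContinuousOnInterval f 0 T)
    (hd : ∀ᵐ t ∂timeMeasure T, HasDerivAt f (f' t) t ∧ f' t ≤ A * f t) (h0 : f 0 ≤ 0) :
    ∀ t ∈ Icc 0 T, f t ≤ 0 := by
  intro t ht
  have hexp : AbsolutelyContinuousOnInterval (fun s => Real.exp (-A * s)) 0 t := by
    apply ContDiffOn.absolutelyContinuousOnInterval
    exact ((contDiff_const.mul contDiff_id).exp).contDiffOn
  have hft : AbsolutelyContinuousOnInterval f 0 t := hf.mono (by
    rw [uIcc_of_le ht.1, uIcc_of_le (ht.1.trans ht.2)]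
    exact Icc_subset_Icc_right ht.2)
  have h := le_of_ae_deriv_nonpos ht.1 (hft.mul hexp)
    (f' := fun s => f' s * Real.exp (-A * s) + f s * (Real.exp (-A * s) * -A)) (by
      filter_upwards [ae_timeMeasure_iff.1 hd] with s hs hmem
      obtain ⟨h1, h2⟩ := hs ⟨hmem.1.le, hmem.2.le.trans ht.2⟩
      refine ⟨h1.mul ?_, ?_⟩
      · simpa using ((hasDerivAt_id s).const_mul (-A)).exp
      · have : f' s * Real.exp (-A * s) + f s * (Real.exp (-A * s) * -A)
            = (f' s - A * f s) * Real.exp (-A * s) := by ring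
        rw [this]
        exact mul_nonpos_of_nonpos_of_nonneg (by linarith) (Real.exp_pos _).le)
  simp only [Pi.mul_apply, mul_zero, Real.exp_zero, mul_one] at h
  exact nonpos_of_mul_nonpos_left (h.trans h0) (Real.exp_pos _)

end Curves

/-! ### Carathéodory vector fields -/

section Caratheodory

variable {n k : ℕ}

theorem aemeasurable_comp_simpleFunc {μ : Measure ℝ} {F : ℝ → E n → E k} {C : Set (E n)}
    (hF : ∀ x ∈ C, AEMeasurable (fun t => F t x) μ) (s : SimpleFunc ℝ (E n))
    (hs : ∀ t, s t ∈ C) : AEMeasurable (fun t => F t (s t)) μ := by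
  classical
  have h : (fun t => F t (s t)) = fun t => ∑ c ∈ s.range, (s ⁻¹' {c}).indicator (fun t => F t c) t := by
    funext t
    rw [Finset.sum_eq_single_of_mem (s t) (s.mem_range_self t)]
    · simp
    · intro c _ hc
      exact indicator_of_notMem (by simpa using hc.symm) _
  rw [h]
  refine Finset.aemeasurable_fun_sum _ fun c hc => ?_
  obtain ⟨t, rfl⟩ := SimpleFunc.mem_range.1 hc
  exact (hF _ (hs t)).indicator (s.measurableSet_fiber _)

/-- The superposition of a Carathéodory function and a measurable curve is measurable. -/
theorem aemeasurable_comp_caratheodory {μ : Measure ℝ} {F : ℝ → E n → E k} {C : Set (E n)}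
    (hF : ∀ x ∈ C, AEMeasurable (fun t => F t x) μ) (hc : ∀ᵐ t ∂μ, ContinuousOn (F t) C)
    {x : ℝ → E n} (hx : AEMeasurable x μ) (hxC : ∀ᵐ t ∂μ, x t ∈ C) :
    AEMeasurable (fun t => F t (x t)) μ := by
  rcases C.eq_empty_or_nonempty with rfl | ⟨y₀, hy₀⟩
  · have : μ = 0 := by
      simpa using hxC
    simp [this]
  refine aemeasurable_of_tendsto_metrizable_ae atTop
    (f := fun j t => F t (SimpleFunc.approxOn (hx.mk x) hx.measurable_mk C y₀ hy₀ j t))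
    (fun j => aemeasurable_comp_simpleFunc hF _ fun t => SimpleFunc.approxOn_mem _ _ _ _) ?_
  filter_upwards [hc, hxC, hx.ae_eq_mk] with t h1 h2 h3
  rw [h3] at h2 ⊢
  have h4 := SimpleFunc.tendsto_approxOn hx.measurable_mk hy₀ (subset_closure h2)
  exact (h1 _ h2).tendsto.comp (tendsto_nhdsWithin_iff.2
    ⟨h4, Eventually.of_forall fun j => SimpleFunc.approxOn_mem _ _ _ _⟩)

/-- McShane's extension of a real Carathéodory function that is Lipschitz in the state; the
infimum over a countable dense set keeps the measurability in time. -/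
theorem exists_mcshane_extension {μ : Measure ℝ} {f : ℝ → E n → ℝ} {C : Set (E n)}
    (hC : C.Nonempty) {L B : ℝ} (hL : 0 ≤ L)
    (hf : ∀ x ∈ C, AEMeasurable (fun t => f t x) μ)
    (hlip : ∀ᵐ t ∂μ, ∀ x ∈ C, ∀ y ∈ C, |f t x - f t y| ≤ L * ‖x - y‖)
    (hb : ∀ᵐ t ∂μ, ∀ x ∈ C, |f t x| ≤ B) :
    ∃ g : ℝ → E n → ℝ, (∀ x, AEMeasurable (fun t => g t x) μ) ∧
      ∀ᵐ t ∂μ, (∀ x y, |g t x - g t y| ≤ L * ‖x - y‖) ∧ (∀ x, |g t x| ≤ |B|) ∧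
        ∀ x ∈ C, g t x = f t x := by
  have : Nonempty C := hC.to_subtype
  set d : ℕ → E n := fun j => (TopologicalSpace.denseSeq C j : E n) with hd
  have hdC : ∀ j, d j ∈ C := fun j => Subtype.coe_prop _
  set h : ℝ → E n → ℝ := fun t x => ⨅ j, (f t (d j) + L * ‖x - d j‖) with hh
  refine ⟨fun t x => max (-|B|) (min |B| (h t x)), fun x => ?_, ?_⟩
  · exact aemeasurable_const.max (aemeasurable_const.min
      (AEMeasurable.iInf fun j => (hf _ (hdC j)).add_const _))
  · filter_upwards [hlip, hb] with t hlip hb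
    have hbelow : ∀ x, BddBelow (range fun j => f t (d j) + L * ‖x - d j‖) := fun x => by
      refine ⟨-B, ?_⟩
      rintro _ ⟨j, rfl⟩
      have := (abs_le.1 (hb _ (hdC j))).1
      have h2 : 0 ≤ L * ‖x - d j‖ := by positivity
      simp only
      linarith
    have hone : ∀ x y, h t x ≤ h t y + L * ‖x - y‖ := by
      intro x y
      rw [← sub_le_iff_le_add]
      refine le_ciInf fun j => ?_
      rw [sub_le_iff_le_add]
      refine (ciInf_le (hbelow x) j).trans ?_
      have h1 : ‖x - d j‖ ≤ ‖y - d j‖ + ‖x - y‖ := by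
        have := norm_add_le (y - d j) (x - y)
        rwa [show y - d j + (x - y) = x - d j by abel] at this
      nlinarith
    have hLip : ∀ x y, |h t x - h t y| ≤ L * ‖x - y‖ := by
      intro x y
      rw [abs_le]
      have h1 := hone x y
      have h2 := hone y x
      rw [norm_sub_rev] at h2
      constructor <;> linarith
    refine ⟨fun x y => ?_, fun x => ?_, fun x hx => ?_⟩
    · refine (abs_max_sub_max_le_max (-|B|) _ (-|B|) _).trans ?_
      rw [sub_self, abs_zero, max_eq_right (abs_nonneg _)]
      refine le_trans ?_ (hLip x y)
      simpa using abs_min_sub_min_le_max |B| (h t x) |B| (h t y)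
    · rw [abs_le]
      exact ⟨le_max_left _ _, max_le (by linarith [abs_nonneg B]) (min_le_left _ _)⟩
    · have heq : h t x = f t x := by
        refine le_antisymm (le_of_forall_pos_le_add fun ε hε => ?_) (le_ciInf fun j => ?_)
        · obtain ⟨j, hj⟩ := (TopologicalSpace.denseRange_denseSeq C).exists_dist_lt ⟨x, hx⟩
            (ε := ε / (2 * L + 1)) (by positivity)
          refine (ciInf_le (hbelow x) j).trans ?_
          have h1 := (abs_le.1 (hlip _ hx _ (hdC j))).1
          have h2 : ‖x - d j‖ < ε / (2 * L + 1) := by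
            rw [← dist_eq_norm]; exact hj
          have h3 : (2 * L + 1) * ‖x - d j‖ ≤ ε := by
            rw [lt_div_iff₀ (by positivity)] at h2
            linarith
          nlinarith [norm_nonneg (x - d j)]
        · have := (abs_le.1 (hlip _ hx _ (hdC j))).2
          linarith
      have hB : |f t x| ≤ |B| := (hb x hx).trans (le_abs_self B)
      rw [heq]
      rw [abs_le] at hB
      rw [min_eq_right hB.2, max_eq_right hB.1]

theorem norm_le_sum_abs (v : E k) : ‖v‖ ≤ ∑ i, |v i| := by
  rw [EuclideanSpace.norm_eq]
  refine Real.sqrt_le_iff.2 ⟨Finset.sum_nonneg fun i _ => abs_nonneg _, ?_⟩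
  simp only [Real.norm_eq_abs]
  exact Finset.sum_sq_le_sq_sum_of_nonneg fun i _ => abs_nonneg _

/-- Extension of a vector field that is measurable in time and Lipschitz in the state on `C`
to the whole space, keeping these properties. -/
theorem exists_caratheodory_extension {μ : Measure ℝ} {F : ℝ → E n → E k} {C : Set (E n)}
    (hC : C.Nonempty) {L B : ℝ} (hL : 0 ≤ L)
    (hF : ∀ x ∈ C, AEMeasurable (fun t => F t x) μ)
    (hlip : ∀ᵐ t ∂μ, ∀ x ∈ C, ∀ y ∈ C, ‖F t x - F t y‖ ≤ L * ‖x - y‖)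
    (hb : ∀ᵐ t ∂μ, ∀ x ∈ C, ‖F t x‖ ≤ B) :
    ∃ G : ℝ → E n → E k, (∀ x, AEMeasurable (fun t => G t x) μ) ∧
      ∀ᵐ t ∂μ, (∀ x y, ‖G t x - G t y‖ ≤ k * L * ‖x - y‖) ∧ (∀ x, ‖G t x‖ ≤ k * |B|) ∧
        ∀ x ∈ C, G t x = F t x := by
  have hcoord : ∀ (v : E k) (i : Fin k), |v i| ≤ ‖v‖ := fun v i => by
    rw [← Real.norm_eq_abs]; exact PiLp.norm_apply_le v i
  have h : ∀ i : Fin k, ∃ g : ℝ → E n → ℝ, (∀ x, AEMeasurable (fun t => g t x) μ) ∧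
      ∀ᵐ t ∂μ, (∀ x y, |g t x - g t y| ≤ L * ‖x - y‖) ∧ (∀ x, |g t x| ≤ |B|) ∧
        ∀ x ∈ C, g t x = F t x i := by
    intro i
    refine exists_mcshane_extension hC hL (fun x hx => ?_) ?_ ?_
    · exact (EuclideanSpace.proj (𝕜 := ℝ) i).continuous.measurable.comp_aemeasurable (hF x hx)
    · filter_upwards [hlip] with t ht x hx y hy
      exact (hcoord (F t x - F t y) i).trans (ht x hx y hy)
    · filter_upwards [hb] with t ht x hx
      exact (hcoord _ i).trans (ht x hx)
  choose g hgm hg using h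
  refine ⟨fun t x => WithLp.toLp 2 fun i => g i t x, fun x => ?_, ?_⟩
  · exact (PiLp.continuous_toLp 2 _).measurable.comp_aemeasurable
      (aemeasurable_pi_iff.2 fun i => hgm i x)
  · filter_upwards [ae_all_iff.2 hg] with t ht
    refine ⟨fun x y => (norm_le_sum_abs _).trans ?_, fun x => (norm_le_sum_abs _).trans ?_,
      fun x hx => ?_⟩
    · calc ∑ i, |(WithLp.toLp 2 (fun i => g i t x) - WithLp.toLp 2 fun i => g i t y : E k) i|
          ≤ ∑ _i : Fin k, L * ‖x - y‖ := Finset.sum_le_sum fun i _ => by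
            simpa using (ht i).1 x y
        _ = k * L * ‖x - y‖ := by simp; ring
    · calc ∑ i, |(WithLp.toLp 2 (fun i => g i t x) : E k) i|
          ≤ ∑ _i : Fin k, |B| := Finset.sum_le_sum fun i _ => (ht i).2.1 x
        _ = k * |B| := by simp
    · ext i
      exact (ht i).2.2 x hx

end Caratheodory

/-- Carathéodory's existence theorem for a globally Lipschitz and bounded vector field: some
iterate of the Picard operator is a contraction of `C([0, T])`. -/
theorem exists_caratheodory_solution {n : ℕ} {T : ℝ} (hT : 0 ≤ T) {F : ℝ → E n → E n} {L B : ℝ}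
    (hL : 0 ≤ L) (hF : ∀ x, AEMeasurable (fun t => F t x) (timeMeasure T))
    (hlip : ∀ᵐ t ∂timeMeasure T, ∀ x y, ‖F t x - F t y‖ ≤ L * ‖x - y‖)
    (hb : ∀ᵐ t ∂timeMeasure T, ∀ x, ‖F t x‖ ≤ B) (c : E n) :
    ∃ x : ℝ → E n, x 0 = c ∧ AbsolutelyContinuousOnInterval x 0 T ∧
      ∀ᵐ t ∂timeMeasure T, HasDerivAt x (F t (x t)) t := by
  have h0 : (0 : ℝ) ∈ Icc 0 T := left_mem_Icc.2 hT
  have hint : ∀ y : ℝ → E n, Continuous y → Integrable (fun t => F t (y t)) (timeMeasure T) := by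
    intro y hy
    have hm : AEMeasurable (fun t => F t (y t)) (timeMeasure T) := by
      refine aemeasurable_comp_caratheodory (C := univ) (fun x _ => hF x) ?_
        hy.measurable.aemeasurable (by simp)
      filter_upwards [hlip] with t ht
      have : LipschitzWith L.toNNReal (F t) := LipschitzWith.of_dist_le_mul fun x y => by
        rw [dist_eq_norm, dist_eq_norm, Real.coe_toNNReal _ hL]; exact ht x y
      exact this.continuous.continuousOn
    exact (integrable_const B).mono' hm.aestronglyMeasurable (by
      filter_upwards [hb] with t ht using ht _)
  -- the Picard operator
  set ext : C(Icc (0 : ℝ) T, E n) → ℝ → E n := fun α => IccExtend hT α with hext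
  have hextc : ∀ α, Continuous (ext α) := fun α => α.continuous.Icc_extend'
  have hsol : ∀ α, AbsolutelyContinuousOnInterval
      (fun t => c + ∫ s in (0 : ℝ)..t, F s (ext α s)) 0 T := fun α =>
    absolutelyContinuousOnInterval_integral hT (hint _ (hextc α)) c
  set P : C(Icc (0 : ℝ) T, E n) → C(Icc (0 : ℝ) T, E n) := fun α =>
    ⟨fun t => c + ∫ s in (0 : ℝ)..t, F s (ext α s), by
      have := (hsol α).continuousOn
      rw [uIcc_of_le hT] at this
      exact this.domRestrict⟩ with hP
  have hPapp : ∀ α (t : Icc (0 : ℝ) T), P α t = c + ∫ s in (0 : ℝ)..t, F s (ext α s) :=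
    fun α t => rfl
  have hiter : ∀ (j : ℕ) (α β : C(Icc (0 : ℝ) T, E n)) (t : Icc (0 : ℝ) T),
      dist (P^[j] α t) (P^[j] β t) ≤ (L * t) ^ j / j.factorial * dist α β := by
    intro j
    induction j with
    | zero => intro α β t; simpa using ContinuousMap.dist_apply_le_dist (f := α) (g := β) t
    | succ j ih =>
      intro α β t
      rw [Function.iterate_succ_apply', Function.iterate_succ_apply', hPapp, hPapp, dist_add_left,
        dist_eq_norm, ← intervalIntegral.integral_sub
          (intervalIntegrable_of_timeMeasure (hint _ (hextc _)) h0 t.2)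
          (intervalIntegrable_of_timeMeasure (hint _ (hextc _)) h0 t.2)]
      have hbound : ∀ᵐ s, s ∈ Ioc 0 (t : ℝ) →
          ‖F s (ext (P^[j] α) s) - F s (ext (P^[j] β) s)‖
            ≤ L * ((L * s) ^ j / j.factorial * dist α β) := by
        filter_upwards [ae_timeMeasure_iff.1 hlip] with s hs hmem
        have hsT : s ∈ Icc 0 T := ⟨hmem.1.le, hmem.2.trans t.2.2⟩
        refine (hs hsT _ _).trans ?_
        gcongr
        simp only [hext]
        rw [IccExtend_of_mem hT _ hsT, IccExtend_of_mem hT _ hsT, ← dist_eq_norm]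
        exact ih α β ⟨s, hsT⟩
      refine (intervalIntegral.norm_integral_le_of_norm_le t.2.1 hbound
        (Continuous.intervalIntegrable (by fun_prop) _ _)).trans (le_of_eq ?_)
      have hfun : (fun s : ℝ => L * ((L * s) ^ j / j.factorial * dist α β))
          = fun s => (L ^ (j + 1) / j.factorial * dist α β) * s ^ j := by
        funext s; rw [mul_pow]; ring
      rw [hfun, intervalIntegral.integral_const_mul, integral_pow, Nat.factorial_succ]
      push_cast
      field_simp
      ring
  obtain ⟨j, hj⟩ := ((FloorSemiring.tendsto_pow_div_factorial_atTop (L * T)).eventually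
    (gt_mem_nhds zero_lt_one)).exists
  have hK : (0 : ℝ) ≤ (L * T) ^ j / j.factorial := by positivity
  have hcontr : ContractingWith (NNReal.mk _ hK) P^[j] := by
    refine ⟨hj, LipschitzWith.of_dist_le_mul fun α β => ?_⟩
    change dist (P^[j] α) (P^[j] β) ≤ (L * T) ^ j / j.factorial * dist α β
    rw [ContinuousMap.dist_le (mul_nonneg hK dist_nonneg)]
    intro t
    refine (hiter j α β t).trans ?_
    have : (L * (t : ℝ)) ^ j ≤ (L * T) ^ j := by
      have := t.2.1
      gcongr
      exact t.2.2
    gcongr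
  obtain ⟨α, hα⟩ : ∃ α, P α = α := ⟨_, hcontr.isFixedPt_fixedPoint_iterate⟩
  have heq : ∀ t ∈ Icc 0 T, c + ∫ s in (0 : ℝ)..t, F s (ext α s) = ext α t := by
    intro t ht
    have := hPapp α ⟨t, ht⟩
    rw [hα] at this
    rw [← this, hext]
    exact (IccExtend_of_mem hT α ht).symm
  refine ⟨fun t => c + ∫ s in (0 : ℝ)..t, F s (ext α s), by simp, hsol α, ?_⟩
  filter_upwards [ae_hasDerivAt_integral hT (hint _ (hextc α)) c, ae_mem_timeMeasure T]
    with t ht hmem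
  rwa [heq t hmem]

section

variable {n m r : ℕ} {ψ : Fin r → E n → ℝ} {ρ η Mψ : ℝ}

/-! ### The penalized equation -/

/-- A vector field on `C`, measurable in time, and bounded by `Mbar` and `Mbar`-Lipschitz in the
state. The fields `f_Φ(t, x, u(t))` are of this kind. -/
structure BoundedField (T : ℝ) (C : Set (E n)) (g : ℝ → E n → E n) (Mbar : ℝ) : Prop where
  measurable : ∀ x ∈ C, AEMeasurable (fun t => g t x) (timeMeasure T)
  lipschitz : ∀ᵐ t ∂timeMeasure T, ∀ x ∈ C, ∀ y ∈ C, ‖g t x - g t y‖ ≤ Mbar * ‖x - y‖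
  bound : ∀ᵐ t ∂timeMeasure T, ∀ x ∈ C, ‖g t x‖ ≤ Mbar

/-- A `C`-valued solution of `x' = g(t, x) - ∇(∑ i, exp (γ ψ_i))(x)`. -/
structure PenalizedCurve (T : ℝ) (g : ℝ → E n → E n) (ψ : Fin r → E n → ℝ) (γ : ℝ)
    (x : ℝ → E n) : Prop where
  absCont : AbsolutelyContinuousOnInterval x 0 T
  mem : ∀ t ∈ Icc 0 T, x t ∈ sweepingSet ψ
  equation : ∀ᵐ t ∂timeMeasure T, HasDerivAt x (g t (x t) - penaltyField ψ γ (x t)) t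

theorem continuousOn_Icc {T : ℝ} (hT : 0 ≤ T) {x : ℝ → E n}
    (hx : AbsolutelyContinuousOnInterval x 0 T) : ContinuousOn x (Icc 0 T) :=
  uIcc_of_le hT ▸ hx.continuousOn

theorem aemeasurable_of_absCont {T : ℝ} (hT : 0 ≤ T) {x : ℝ → E n}
    (hx : AbsolutelyContinuousOnInterval x 0 T) : AEMeasurable x (timeMeasure T) :=
  (continuousOn_Icc hT hx).aemeasurable measurableSet_Icc

theorem BoundedField.aemeasurable_comp {T : ℝ} {C : Set (E n)} {g : ℝ → E n → E n} {Mbar : ℝ}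
    (hg : BoundedField T C g Mbar) (hM : 0 ≤ Mbar) {x : ℝ → E n}
    (hx : AEMeasurable x (timeMeasure T)) (hxC : ∀ t ∈ Icc 0 T, x t ∈ C) :
    AEMeasurable (fun t => g t (x t)) (timeMeasure T) := by
  refine aemeasurable_comp_caratheodory hg.measurable ?_ hx ?_
  · filter_upwards [hg.lipschitz] with t ht
    have : LipschitzOnWith Mbar.toNNReal (g t) C := LipschitzOnWith.of_dist_le_mul
      fun x hx y hy => by
        rw [dist_eq_norm, dist_eq_norm, Real.coe_toNNReal _ hM]; exact ht x hx y hy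
    exact this.continuousOn
  · filter_upwards [ae_mem_timeMeasure T] with t ht using hxC t ht

/-- A one-sided Lipschitz estimate of the velocities forces two curves with the same initial point
to coincide. -/
theorem eqOn_of_inner_deriv_le {T : ℝ} (hT : 0 ≤ T) {x y v w : ℝ → E n} (A : ℝ)
    (hx : AbsolutelyContinuousOnInterval x 0 T) (hy : AbsolutelyContinuousOnInterval y 0 T)
    (h0 : x 0 = y 0) (hd : ∀ᵐ t ∂timeMeasure T, HasDerivAt x (v t) t ∧ HasDerivAt y (w t) t ∧
      inner ℝ (x t - y t) (v t - w t) ≤ A * ‖x t - y t‖ ^ 2) : EqOn x y (Icc 0 T) := by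
  have hz := hx.sub hy
  obtain ⟨R, hR⟩ := hz.exists_bound
  rw [uIcc_of_le hT] at hR
  have hR0 : 0 ≤ R := (norm_nonneg _).trans (hR 0 (left_mem_Icc.2 hT))
  have hac : AbsolutelyContinuousOnInterval (fun t => ‖x t - y t‖ ^ 2) 0 T := by
    refine absolutelyContinuousOnInterval_of_dist_le (hz.const_smul (2 * R)) fun s hs t ht => ?_
    rw [uIcc_of_le hT] at hs ht
    have h1 : ‖x s - y s‖ ≤ R := hR s hs
    have h2 : ‖x t - y t‖ ≤ R := hR t ht
    have h3 := abs_norm_sub_norm_le (x s - y s) (x t - y t)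
    rw [Real.dist_eq, dist_eq_norm]
    simp only [Pi.sub_apply]
    rw [← smul_sub, norm_smul, Real.norm_of_nonneg (by positivity), sq_sub_sq, abs_mul,
      abs_of_nonneg (by positivity)]
    have h4 : ‖x s - y s‖ + ‖x t - y t‖ ≤ 2 * R := by linarith
    gcongr
  have h := nonpos_of_deriv_le_mul (f' := fun t => 2 * inner ℝ (x t - y t) (v t - w t)) (2 * A) hac
    (by
      filter_upwards [hd] with t ⟨h1, h2, h3⟩
      exact ⟨(h1.sub h2).norm_sq, by linarith⟩) (by simp [h0])
  intro t ht
  have := h t ht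
  have h5 : ‖x t - y t‖ = 0 := by
    have := sq_nonneg ‖x t - y t‖
    exact pow_eq_zero_iff two_ne_zero |>.1 (by linarith)
  exact sub_eq_zero.1 (norm_eq_zero.1 h5)

namespace ConstraintData

variable (D : ConstraintData ψ ρ η Mψ)
include D

theorem exists_lipschitz_exp (i : Fin r) (γ : ℝ) : ∃ L : ℝ, 0 ≤ L ∧
    ∀ x ∈ Metric.cthickening (ρ / 2) (sweepingSet ψ),
    ∀ y ∈ Metric.cthickening (ρ / 2) (sweepingSet ψ),
    |Real.exp (γ * ψ i x) - Real.exp (γ * ψ i y)| ≤ L * ‖x - y‖ := by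
  have hfd : ContinuousOn (fderiv ℝ (ψ i)) (Metric.thickening ρ (sweepingSet ψ)) := by
    rw [← toDual_comp_gradient]
    exact (InnerProductSpace.toDual ℝ (E n)).continuous.comp_continuousOn
      (D.smooth.2 i).2.continuousOn
  have hloc : LocallyLipschitzOn (Metric.cthickening (ρ / 2) (sweepingSet ψ))
      (fun x => Real.exp (γ * ψ i x)) := by
    intro x hx
    have h1 : ContDiffAt ℝ 1 (ψ i) x := contDiffAt_one_iff.2
      ⟨fderiv ℝ (ψ i), _, Metric.isOpen_thickening.mem_nhds (D.cthickening_subset hx), hfd,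
        fun y hy => ((D.smooth.2 i).1.differentiableAt
          (Metric.isOpen_thickening.mem_nhds hy)).hasFDerivAt⟩
    have h2 : ContDiffAt ℝ 1 (fun x => Real.exp (γ * ψ i x)) x := (contDiffAt_const.mul h1).exp
    obtain ⟨K, t, ht, hK⟩ := h2.exists_lipschitzOnWith
    exact ⟨K, t, mem_nhdsWithin_of_mem_nhds ht, hK⟩
  obtain ⟨L, hL⟩ := hloc.exists_lipschitzOnWith_of_compact (D.isCompact_cthickening _)
  refine ⟨L, L.coe_nonneg, fun x hx y hy => ?_⟩
  have := hL.dist_le_mul x hx y hy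
  rwa [Real.dist_eq, dist_eq_norm] at this

theorem exists_lipschitz_penaltySum (γ : ℝ) : ∃ L : ℝ, 0 ≤ L ∧
    ∀ x ∈ Metric.cthickening (ρ / 2) (sweepingSet ψ),
    ∀ y ∈ Metric.cthickening (ρ / 2) (sweepingSet ψ),
    |penaltySum ψ γ x - penaltySum ψ γ y| ≤ L * ‖x - y‖ := by
  choose L hL0 hL using fun i => D.exists_lipschitz_exp i γ
  refine ⟨∑ i, L i, Finset.sum_nonneg fun i _ => hL0 i, fun x hx y hy => ?_⟩
  simp only [penaltySum]
  rw [← Finset.sum_sub_distrib, Finset.sum_mul]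
  exact (Finset.abs_sum_le_sum_abs _ _).trans (Finset.sum_le_sum fun i _ => hL i x hx y hy)

theorem continuousOn_penaltyField (γ : ℝ) :
    ContinuousOn (penaltyField ψ γ) (Metric.cthickening (ρ / 2) (sweepingSet ψ)) := by
  refine continuousOn_finsetSum _ fun i _ => ContinuousOn.fun_smul ?_ (D.continuousOn_gradient i)
  exact continuousOn_const.mul (continuousOn_const.mul (D.continuousOn i)).rexp

theorem continuousOn_penaltySum (γ : ℝ) :
    ContinuousOn (penaltySum ψ γ) (Metric.cthickening (ρ / 2) (sweepingSet ψ)) :=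
  continuousOn_finsetSum _ fun i _ => (continuousOn_const.mul (D.continuousOn i)).rexp

theorem exists_bound_penaltyField (γ : ℝ) : ∃ B : ℝ, 0 ≤ B ∧
    ∀ x ∈ Metric.cthickening (ρ / 2) (sweepingSet ψ), ‖penaltyField ψ γ x‖ ≤ B := by
  obtain ⟨B, hB⟩ := (D.isCompact_cthickening (ρ / 2)).exists_bound_of_continuousOn
    (D.continuousOn_penaltyField γ)
  obtain ⟨x, hx⟩ := D.nonempty
  exact ⟨B, (norm_nonneg _).trans (hB x (mem_cthickening hx)), hB⟩

theorem exists_lipschitz_penaltyField (γ : ℝ) : ∃ L : ℝ, 0 ≤ L ∧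
    ∀ x ∈ Metric.cthickening (ρ / 2) (sweepingSet ψ),
    ∀ y ∈ Metric.cthickening (ρ / 2) (sweepingSet ψ),
    ‖penaltyField ψ γ x - penaltyField ψ γ y‖ ≤ L * ‖x - y‖ := by
  choose L hL0 hL using fun i => D.exists_lipschitz_exp i γ
  have hbd : ∀ i, ∃ B : ℝ, ∀ x ∈ Metric.cthickening (ρ / 2) (sweepingSet ψ),
      ‖Real.exp (γ * ψ i x)‖ ≤ B := fun i =>
    (D.isCompact_cthickening (ρ / 2)).exists_bound_of_continuousOn
      (continuousOn_const.mul (D.continuousOn i)).rexp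
  choose B hB using hbd
  obtain ⟨G, hG0, hG⟩ := D.exists_gradient_bound
  have hMψ := D.Mψ_pos
  refine ⟨∑ i, |γ| * (|B i| * (2 * Mψ) + L i * G), Finset.sum_nonneg fun i _ => by
    have := hL0 i; positivity, fun x hx y hy => ?_⟩
  simp only [penaltyField]
  rw [← Finset.sum_sub_distrib, Finset.sum_mul]
  refine (norm_sum_le _ _).trans (Finset.sum_le_sum fun i _ => ?_)
  have e : (γ * Real.exp (γ * ψ i x)) • gradient (ψ i) x
      - (γ * Real.exp (γ * ψ i y)) • gradient (ψ i) y
      = γ • (Real.exp (γ * ψ i x) • (gradient (ψ i) x - gradient (ψ i) y)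
        + (Real.exp (γ * ψ i x) - Real.exp (γ * ψ i y)) • gradient (ψ i) y) := by module
  rw [e, norm_smul, Real.norm_eq_abs, mul_assoc]
  gcongr
  refine (norm_add_le _ _).trans ?_
  rw [norm_smul, norm_smul, add_mul]
  have h1 : ‖Real.exp (γ * ψ i x)‖ * ‖gradient (ψ i) x - gradient (ψ i) y‖
      ≤ |B i| * (2 * Mψ * ‖x - y‖) :=
    mul_le_mul ((hB i x hx).trans (le_abs_self _)) (D.lip i x hx y hy) (norm_nonneg _)
      (abs_nonneg _)
  have h2 : ‖Real.exp (γ * ψ i x) - Real.exp (γ * ψ i y)‖ * ‖gradient (ψ i) y‖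
      ≤ L i * ‖x - y‖ * G :=
    mul_le_mul (hL i x hx y hy) (hG i y hy) (norm_nonneg _)
      (mul_nonneg (hL0 i) (norm_nonneg _))
  linarith

theorem hasDerivAt_penaltySum (γ : ℝ) {x : ℝ → E n} {v : E n} {t : ℝ}
    (hxt : x t ∈ Metric.cthickening (ρ / 2) (sweepingSet ψ)) (hx : HasDerivAt x v t) :
    HasDerivAt (fun s => penaltySum ψ γ (x s)) (inner ℝ (penaltyField ψ γ (x t)) v) t := by
  have h : ∀ i ∈ Finset.univ, HasDerivAt (fun s => Real.exp (γ * ψ i (x s)))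
      (Real.exp (γ * ψ i (x t)) * (γ * inner ℝ (gradient (ψ i) (x t)) v)) t := fun i _ =>
    ((hasDerivAt_comp_gradient (D.differentiableAt i hxt) hx).const_mul γ).exp
  refine (HasDerivAt.fun_sum h).congr_deriv ?_
  rw [penaltyField, sum_inner]
  refine Finset.sum_congr rfl fun i _ => ?_
  rw [real_inner_smul_left]
  ring

theorem isClosed_approxSet {γ : ℝ} (hγ : 0 < γ) : IsClosed (approxSet ψ γ) := by
  have h : approxSet ψ γ = sweepingSet ψ ∩ penaltySum ψ γ ⁻¹' Iic 1 := by
    ext x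
    exact ⟨fun hx => ⟨approxSet_subset hγ hx, hx⟩, fun hx => hx.2⟩
  rw [h]
  exact ((D.continuousOn_penaltySum γ).mono fun x hx => mem_cthickening hx).preimage_isClosed_of_isClosed
    D.compact.isClosed isClosed_Iic

/-- For large `γ` the penalized equation has a solution, and `C^γ` is invariant: on its boundary
the penalty term dominates the bounded drift. The threshold for `γ` makes the penalty at least
`n * |Mbar|`, which bounds the Lipschitz extension of the field to the whole space. -/
theorem exists_penalizedCurve {T : ℝ} (hT : 0 ≤ T) {Mbar : ℝ} (hM : 0 ≤ Mbar) :
    ∃ γ₀, 0 < γ₀ ∧ ∀ γ, γ₀ ≤ γ → ∀ g, BoundedField T (sweepingSet ψ) g Mbar →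
      ∀ c ∈ approxSet ψ γ, ∃ x, PenalizedCurve T g ψ γ x ∧ x 0 = c ∧
        ∀ t ∈ Icc 0 T, x t ∈ approxSet ψ γ := by
  obtain ⟨δ, hδ, hδρ, B, hB0, hlow⟩ := D.exists_penalty_lower_bound
  have hη := D.eta_pos
  refine ⟨(B + n * |Mbar| + 1) / (2 * η), by positivity, fun γ hγ g hg c hc => ?_⟩
  have hγ0 : 0 < γ := lt_of_lt_of_le (by positivity) hγ
  have hγη : B + n * |Mbar| + 1 ≤ 2 * η * γ := by
    rw [div_le_iff₀ (by positivity)] at hγ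
    linarith
  have hsub : Metric.cthickening δ (sweepingSet ψ) ⊆ Metric.cthickening (ρ / 2) (sweepingSet ψ) :=
    Metric.cthickening_mono hδρ _
  obtain ⟨Lp, hLp0, hLp⟩ := D.exists_lipschitz_penaltyField γ
  obtain ⟨Bp, hBp0, hBp⟩ := D.exists_bound_penaltyField γ
  obtain ⟨G, hGm, hG⟩ := exists_caratheodory_extension D.nonempty hM hg.measurable hg.lipschitz
    hg.bound
  obtain ⟨Q, hQm, hQ⟩ := exists_caratheodory_extension (μ := timeMeasure T)
    (F := fun _ x => penaltyField ψ γ x) (C := Metric.cthickening (ρ / 2) (sweepingSet ψ))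
    (D.nonempty.mono fun x hx => mem_cthickening hx) hLp0 (fun x _ => aemeasurable_const)
    (Eventually.of_forall fun t => hLp) (Eventually.of_forall fun t => hBp)
  -- `G` and `Q` extend the field, given on `C`, and the penalty, given near `C`, to the whole space
  obtain ⟨x, hx0, hxac, hxd⟩ := exists_caratheodory_solution hT (F := fun t x => G t x - Q t x)
    (L := n * Mbar + n * Lp) (B := n * |Mbar| + n * |Bp|) (by positivity)
    (fun x => (hGm x).sub (hQm x))
    (by
      filter_upwards [hG, hQ] with t h1 h2 x y
      rw [sub_sub_sub_comm, add_mul]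
      exact (norm_sub_le _ _).trans (add_le_add (h1.1 x y) (h2.1 x y)))
    (by
      filter_upwards [hG, hQ] with t h1 h2 x
      exact (norm_sub_le _ _).trans (add_le_add (h1.2.1 x) (h2.2.1 x))) c
  have hxc := continuousOn_Icc hT hxac
  have hxlip := lipschitz_of_ae_bound hT hxac hxd (L := n * |Mbar| + n * |Bp|) (by
      filter_upwards [hG, hQ] with t h1 h2
      exact (norm_sub_le _ _).trans (add_le_add (h1.2.1 _) (h2.2.1 _)))
  -- if the curve left `C^γ` after `t₀`, the penalty sum would decrease from `t₀` on
  have hinv : Icc 0 T ⊆ {t | x t ∈ approxSet ψ γ} := by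
    refine IsClosed.Icc_subset_of_forall_exists_gt ?_ (by simpa [hx0] using hc) ?_
    · have := hxc.preimage_isClosed_of_isClosed isClosed_Icc (D.isClosed_approxSet hγ0)
      rwa [inter_comm] at this
    rintro t₀ ⟨ht₀, ht₀T⟩ y hy
    simp only [mem_Ioi] at hy
    by_contra hcon
    have hout : ∀ t ∈ Ioc t₀ y, 1 < penaltySum ψ γ (x t) := by
      intro t ht
      by_contra h
      exact hcon ⟨t, not_lt.1 h, ht⟩
    have ht₀I : t₀ ∈ Icc 0 T := Ico_subset_Icc_self ht₀T
    have hev : ∀ᶠ t in 𝓝[Icc 0 T] t₀, x t ∈ Metric.cthickening δ (sweepingSet ψ) :=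
      (hxc t₀ ht₀I) (cthickening_mem_nhds (approxSet_subset hγ0 ht₀) hδ)
    rw [eventually_nhdsWithin_iff, Metric.eventually_nhds_iff] at hev
    obtain ⟨ε, hε, hball⟩ := hev
    set t₁ : ℝ := min (t₀ + ε / 2) (min y T) with ht₁
    have h01 : t₀ < t₁ := lt_min (by linarith) (lt_min hy ht₀T.2)
    have h1y : t₁ ≤ y := (min_le_right _ _).trans (min_le_left _ _)
    have h1T : t₁ ≤ T := (min_le_right _ _).trans (min_le_right _ _)
    have h1ε : t₁ ≤ t₀ + ε / 2 := min_le_left _ _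
    have hmemT : ∀ t ∈ Icc t₀ t₁, t ∈ Icc 0 T := fun t ht =>
      ⟨ht₀T.1.trans ht.1, ht.2.trans h1T⟩
    have hnear : ∀ t ∈ Icc t₀ t₁, x t ∈ Metric.cthickening δ (sweepingSet ψ) := by
      intro t ht
      refine hball ?_ (hmemT t ht)
      rw [Real.dist_eq, abs_of_nonneg (by linarith [ht.1])]
      linarith [ht.2]
    obtain ⟨Ls, hLs0, hLs⟩ := D.exists_lipschitz_penaltySum γ
    have hac : AbsolutelyContinuousOnInterval (fun t => penaltySum ψ γ (x t)) t₀ t₁ := by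
      refine absolutelyContinuousOnInterval_of_dist_le (g := fun t => Ls • x t)
        ((hxac.const_smul Ls).mono ?_) fun s hs t ht => ?_
      · rw [uIcc_of_le h01.le, uIcc_of_le hT]
        exact hmemT
      · rw [uIcc_of_le h01.le] at hs ht
        rw [Real.dist_eq, dist_eq_norm, ← smul_sub, norm_smul, Real.norm_of_nonneg hLs0]
        exact hLs _ (hsub (hnear s hs)) _ (hsub (hnear t ht))
    have hle := le_of_ae_deriv_nonpos h01.le hac
      (f' := fun t => inner ℝ (penaltyField ψ γ (x t)) (G t (x t) - Q t (x t))) (by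
        filter_upwards [ae_timeMeasure_iff.1 hxd, ae_timeMeasure_iff.1 hG,
          ae_timeMeasure_iff.1 hQ] with t h1 h2 h3 hmem
        have htI := Ioo_subset_Icc_self hmem
        have htT := hmemT t htI
        refine ⟨D.hasDerivAt_penaltySum γ (hsub (hnear t htI)) (h1 htT), ?_⟩
        rw [(h3 htT).2.2 _ (hsub (hnear t htI)), inner_sub_right, real_inner_self_eq_norm_sq]
        have e1 := hlow γ hγ0 (x t) (hnear t htI)
        have e2 := hout t ⟨hmem.1, hmem.2.le.trans h1y⟩
        have e3 : inner ℝ (penaltyField ψ γ (x t)) (G t (x t))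
            ≤ ‖penaltyField ψ γ (x t)‖ * (n * |Mbar|) :=
          (real_inner_le_norm _ _).trans (by gcongr; exact (h2 htT).2.1 _)
        have e4 : 2 * η * γ ≤ 2 * η * (γ * penaltySum ψ γ (x t)) := by
          rw [← mul_assoc]
          exact le_mul_of_one_le_right (by positivity) e2.le
        have e5 : n * |Mbar| ≤ ‖penaltyField ψ γ (x t)‖ := by linarith
        nlinarith [norm_nonneg (penaltyField ψ γ (x t))])
    have h1 := hout t₁ ⟨h01, h1y⟩
    have h2 : penaltySum ψ γ (x t₀) ≤ 1 := ht₀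
    linarith
  refine ⟨x, ⟨hxac, fun t ht => approxSet_subset hγ0 (hinv ht), ?_⟩, hx0, fun t ht => hinv ht⟩
  filter_upwards [hxd, hG, hQ, ae_mem_timeMeasure T] with t h1 h2 h3 ht
  have hC : x t ∈ sweepingSet ψ := approxSet_subset hγ0 (hinv ht)
  rw [h2.2.2 _ hC, h3.2.2 _ (mem_cthickening hC)] at h1
  exact h1

end ConstraintData

namespace PenalizedCurve

variable {T : ℝ} {g : ℝ → E n → E n} {γ Mbar : ℝ} {x y : ℝ → E n}

theorem eqOn (D : ConstraintData ψ ρ η Mψ) (hT : 0 ≤ T)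
    (hg : BoundedField T (sweepingSet ψ) g Mbar) (hx : PenalizedCurve T g ψ γ x)
    (hy : PenalizedCurve T g ψ γ y) (h0 : x 0 = y 0) : EqOn x y (Icc 0 T) := by
  obtain ⟨L, hL0, hL⟩ := D.exists_lipschitz_penaltyField γ
  refine eqOn_of_inner_deriv_le hT (v := fun t => g t (x t) - penaltyField ψ γ (x t))
    (w := fun t => g t (y t) - penaltyField ψ γ (y t)) (Mbar + L) hx.absCont hy.absCont h0 ?_
  filter_upwards [hx.equation, hy.equation, hg.lipschitz, ae_mem_timeMeasure T] with t h1 h2 h3 ht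
  refine ⟨h1, h2, (real_inner_le_norm _ _).trans ?_⟩
  rw [sub_sub_sub_comm]
  have e1 := h3 _ (hx.mem t ht) _ (hy.mem t ht)
  have e2 := hL _ (mem_cthickening (hx.mem t ht)) _ (mem_cthickening (hy.mem t ht))
  have e3 := norm_sub_le (g t (x t) - g t (y t)) (penaltyField ψ γ (x t) - penaltyField ψ γ (y t))
  have e4 : ‖g t (x t) - g t (y t) - (penaltyField ψ γ (x t) - penaltyField ψ γ (y t))‖
      ≤ (Mbar + L) * ‖x t - y t‖ := by linarith
  calc _ ≤ ‖x t - y t‖ * ((Mbar + L) * ‖x t - y t‖) := by gcongr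
    _ = _ := by ring

theorem exists_deriv_bound (D : ConstraintData ψ ρ η Mψ)
    (hg : BoundedField T (sweepingSet ψ) g Mbar) (hx : PenalizedCurve T g ψ γ x) :
    ∃ B, ∀ᵐ t ∂timeMeasure T, ‖g t (x t) - penaltyField ψ γ (x t)‖ ≤ B := by
  obtain ⟨B, hB0, hB⟩ := D.exists_bound_penaltyField γ
  refine ⟨Mbar + B, ?_⟩
  filter_upwards [hg.bound, ae_mem_timeMeasure T] with t h1 ht
  exact (norm_sub_le _ _).trans (add_le_add (h1 _ (hx.mem t ht))
    (hB _ (mem_cthickening (hx.mem t ht))))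

theorem memLp_deriv (D : ConstraintData ψ ρ η Mψ)
    (hg : BoundedField T (sweepingSet ψ) g Mbar) (hx : PenalizedCurve T g ψ γ x) :
    MemLp (deriv x) 2 (timeMeasure T) := by
  obtain ⟨B, hB⟩ := hx.exists_deriv_bound D hg
  refine MemLp.of_bound (measurable_deriv x).aestronglyMeasurable B ?_
  filter_upwards [hB, hx.equation] with t h1 h2
  rwa [h2.deriv]

/-- The energy estimate: multiplying the equation by `x'` gives
`‖x'‖² = ⟪g, x'⟫ - (d/dt) ∑ i, exp (γ ψ_i x)`, and the penalty sum drops by at most `1`. -/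
theorem integral_norm_deriv_sq_le (D : ConstraintData ψ ρ η Mψ) (hT : 0 ≤ T)
    (hg : BoundedField T (sweepingSet ψ) g Mbar) (hx : PenalizedCurve T g ψ γ x)
    (h0 : x 0 ∈ approxSet ψ γ) :
    ∫ t, ‖deriv x t‖ ^ 2 ∂timeMeasure T ≤ Mbar ^ 2 * T + 2 := by
  obtain ⟨Ls, hLs0, hLs⟩ := D.exists_lipschitz_penaltySum γ
  have hac : AbsolutelyContinuousOnInterval (fun t => penaltySum ψ γ (x t)) 0 T := by
    refine absolutelyContinuousOnInterval_of_dist_le (g := fun t => Ls • x t)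
      (hx.absCont.const_smul Ls) fun s hs t ht => ?_
    rw [uIcc_of_le hT] at hs ht
    rw [Real.dist_eq, dist_eq_norm, ← smul_sub, norm_smul, Real.norm_of_nonneg hLs0]
    exact hLs _ (mem_cthickening (hx.mem s hs)) _ (mem_cthickening (hx.mem t ht))
  have hint := hac.integral_deriv_eq_sub
  rw [intervalIntegral_timeMeasure hT] at hint
  have hderint : Integrable (deriv fun t => penaltySum ψ γ (x t)) (timeMeasure T) := by
    have := (intervalIntegrable_iff_integrableOn_Icc_of_le hT).1 hac.intervalIntegrable_deriv
    exact this
  have hV0 : penaltySum ψ γ (x 0) ≤ 1 := h0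
  have hVT : 0 ≤ penaltySum ψ γ (x T) := penaltySum_nonneg _ _
  calc ∫ t, ‖deriv x t‖ ^ 2 ∂timeMeasure T
      ≤ ∫ t, (Mbar ^ 2 - 2 * deriv (fun t => penaltySum ψ γ (x t)) t) ∂timeMeasure T := by
        refine integral_mono_ae ((hx.memLp_deriv D hg).integrable_norm_pow two_ne_zero)
          ((integrable_const _).sub (hderint.const_mul 2)) ?_
        filter_upwards [hx.equation, hg.bound, ae_mem_timeMeasure T] with t h1 h2 ht
        have h3 := D.hasDerivAt_penaltySum γ (mem_cthickening (hx.mem t ht)) h1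
        have h4 := h2 _ (hx.mem t ht)
        rw [h3.deriv, h1.deriv, inner_sub_right, real_inner_self_eq_norm_sq, norm_sub_sq_real,
          real_inner_comm]
        -- with `x' = g - p`: `‖g - p‖² + 2 ⟪p, g - p⟫ = ‖g‖² - ‖p‖²`
        have h5 : ‖g t (x t)‖ ^ 2 ≤ Mbar ^ 2 := by gcongr
        have h6 : 0 ≤ ‖g t (x t)‖ ^ 2 - 2 * inner ℝ (penaltyField ψ γ (x t)) (g t (x t))
            + ‖penaltyField ψ γ (x t)‖ ^ 2 := by
          rw [real_inner_comm, ← norm_sub_sq_real]; positivity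
        nlinarith
    _ = Mbar ^ 2 * T - 2 * (penaltySum ψ γ (x T) - penaltySum ψ γ (x 0)) := by
        rw [integral_sub (integrable_const _) (hderint.const_mul 2), integral_const_mul, hint,
          integral_const, timeMeasure_real_univ hT, smul_eq_mul, mul_comm T]
    _ ≤ Mbar ^ 2 * T + 2 := by linarith

end PenalizedCurve

end

/-! ### Weak convergence in `L²([0, T])` -/

section Weak

variable {H : Type*} [NormedAddCommGroup H] [InnerProductSpace ℝ H]
variable {T : ℝ} {v : ℕ → ℝ → H} {w : ℝ → H}

theorem integrable_inner_of_memLp {f g : ℝ → H} (hf : MemLp f 2 (timeMeasure T))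
    (hg : MemLp g 2 (timeMeasure T)) : Integrable (fun t => inner ℝ (f t) (g t)) (timeMeasure T) :=
  (L2.integrable_inner (𝕜 := ℝ) (hf.toLp f) (hg.toLp g)).congr (by
    filter_upwards [hf.coeFn_toLp, hg.coeFn_toLp] with t h1 h2
    rw [h1, h2])

theorem inner_toLp {f g : ℝ → H} (hf : MemLp f 2 (timeMeasure T))
    (hg : MemLp g 2 (timeMeasure T)) :
    inner ℝ (hf.toLp f) (hg.toLp g) = ∫ t, inner ℝ (f t) (g t) ∂timeMeasure T := by
  rw [L2.inner_def]
  refine integral_congr_ae ?_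
  filter_upwards [hf.coeFn_toLp, hg.coeFn_toLp] with t h1 h2
  rw [h1, h2]

theorem norm_toLp_sq {f : ℝ → H} (hf : MemLp f 2 (timeMeasure T)) :
    ‖hf.toLp f‖ ^ 2 = ∫ t, ‖f t‖ ^ 2 ∂timeMeasure T := by
  rw [← real_inner_self_eq_norm_sq, inner_toLp]
  simp only [real_inner_self_eq_norm_sq]

/-- Bounded sequences in `L²` have weakly convergent subsequences. -/
theorem exists_weakL2Tendsto_subseq [CompleteSpace H] [SecondCountableTopology H]
    (hv : ∀ j, MemLp (v j) 2 (timeMeasure T)) {B : ℝ}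
    (hB : ∀ j, ∫ t, ‖v j t‖ ^ 2 ∂timeMeasure T ≤ B) :
    ∃ (s : ℕ → ℕ) (w : ℝ → H), StrictMono s ∧ WeakL2Tendsto T (fun j => v (s j)) w := by
  have hball : ∀ j, StrongDual.toWeakDual
      (InnerProductSpace.toDual ℝ (Lp H 2 (timeMeasure T)) ((hv j).toLp (v j))) ∈
      WeakDual.toStrongDual ⁻¹' Metric.closedBall
        (0 : StrongDual ℝ (Lp H 2 (timeMeasure T))) (Real.sqrt B) := by
    intro j
    have : ‖InnerProductSpace.toDual ℝ (Lp H 2 (timeMeasure T)) ((hv j).toLp (v j))‖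
        ≤ Real.sqrt B := by
      rw [LinearIsometryEquiv.norm_map]
      exact Real.le_sqrt_of_sq_le (by rw [norm_toLp_sq]; exact hB j)
    change dist (InnerProductSpace.toDual ℝ (Lp H 2 (timeMeasure T)) ((hv j).toLp (v j))) 0 ≤ _
    rwa [dist_zero_right]
  have : Fact ((2 : ENNReal) ≠ ⊤) := ⟨ENNReal.ofNat_ne_top⟩
  obtain ⟨ℓ, -, s, hs, hlim⟩ := WeakDual.isSeqCompact_closedBall ℝ (Lp H 2 (timeMeasure T)) 0
    (Real.sqrt B) hball
  set w : Lp H 2 (timeMeasure T) :=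
    (InnerProductSpace.toDual ℝ _).symm (WeakDual.toStrongDual ℓ) with hw
  refine ⟨s, w, hs, fun j => hv (s j), Lp.memLp w, fun g hg => ?_⟩
  have h1 := ((WeakDual.eval_continuous (hg.toLp g)).tendsto ℓ).comp hlim
  have h2 : ∀ j, inner ℝ ((hv (s j)).toLp (v (s j))) (hg.toLp g)
      = ∫ t, inner ℝ (g t) (v (s j) t) ∂timeMeasure T := by
    intro j
    rw [real_inner_comm, inner_toLp]
  have h3 : ℓ (hg.toLp g) = ∫ t, inner ℝ (g t) (w t) ∂timeMeasure T := by
    have e1 : ℓ (hg.toLp g) = inner ℝ w (hg.toLp g) := by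
      rw [hw, InnerProductSpace.toDual_symm_apply]; rfl
    rw [e1, real_inner_comm, L2.inner_def]
    refine integral_congr_ae ?_
    filter_upwards [hg.coeFn_toLp] with t h1
    rw [h1]
  rw [h3] at h1
  exact h1.congr h2

namespace WeakL2Tendsto

theorem comp (h : WeakL2Tendsto T v w) {s : ℕ → ℕ} (hs : Tendsto s atTop atTop) :
    WeakL2Tendsto T (fun j => v (s j)) w :=
  ⟨fun _ => h.1 _, h.2.1, fun g hg => (h.2.2 g hg).comp hs⟩

theorem congr (h : WeakL2Tendsto T v w) {v' : ℕ → ℝ → H} {w' : ℝ → H}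
    (hv : ∀ j, v j =ᵐ[timeMeasure T] v' j) (hw : w =ᵐ[timeMeasure T] w') :
    WeakL2Tendsto T v' w' := by
  refine ⟨fun j => (memLp_congr_ae (hv j)).1 (h.1 j), (memLp_congr_ae hw).1 h.2.1,
    fun g hg => ?_⟩
  have e1 : ∫ t, inner ℝ (g t) (w t) ∂timeMeasure T
      = ∫ t, inner ℝ (g t) (w' t) ∂timeMeasure T :=
    integral_congr_ae (by filter_upwards [hw] with t ht; rw [ht])
  have e2 : ∀ j, ∫ t, inner ℝ (g t) (v j t) ∂timeMeasure T
      = ∫ t, inner ℝ (g t) (v' j t) ∂timeMeasure T := fun j =>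
    integral_congr_ae (by filter_upwards [hv j] with t ht; rw [ht])
  rw [← e1]
  exact (h.2.2 g hg).congr e2

/-- The norm of `L²` is weakly lower semicontinuous. -/
theorem integral_norm_sq_le (h : WeakL2Tendsto T v w) {B : ℝ}
    (hB : ∀ j, ∫ t, ‖v j t‖ ^ 2 ∂timeMeasure T ≤ B) :
    ∫ t, ‖w t‖ ^ 2 ∂timeMeasure T ≤ B := by
  have hlim := h.2.2 w h.2.1
  simp only [real_inner_self_eq_norm_sq] at hlim
  have hle : ∀ j, ∫ t, inner ℝ (w t) (v j t) ∂timeMeasure T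
      ≤ (∫ t, ‖w t‖ ^ 2 ∂timeMeasure T + B) / 2 := by
    intro j
    have hi1 := h.2.1.integrable_norm_pow two_ne_zero
    have hi2 := (h.1 j).integrable_norm_pow two_ne_zero
    calc ∫ t, inner ℝ (w t) (v j t) ∂timeMeasure T
        ≤ ∫ t, (‖w t‖ ^ 2 + ‖v j t‖ ^ 2) / 2 ∂timeMeasure T := by
          refine integral_mono (integrable_inner_of_memLp h.2.1 (h.1 j))
            ((hi1.add hi2).div_const 2) fun t => ?_
          have := real_inner_le_norm (w t) (v j t)
          simp only
          nlinarith [sq_nonneg (‖w t‖ - ‖v j t‖)]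
      _ = (∫ t, ‖w t‖ ^ 2 ∂timeMeasure T + ∫ t, ‖v j t‖ ^ 2 ∂timeMeasure T) / 2 := by
          rw [integral_div, integral_add hi1 hi2]
      _ ≤ _ := by linarith [hB j]
  have := le_of_tendsto' hlim hle
  linarith

theorem ae_nonneg {v : ℕ → ℝ → ℝ} {w : ℝ → ℝ} (h : WeakL2Tendsto T v w)
    (hv : ∀ j, ∀ᵐ t ∂timeMeasure T, 0 ≤ v j t) : ∀ᵐ t ∂timeMeasure T, 0 ≤ w t := by
  -- test with the negative part of the limit
  have hg : MemLp (fun t => max (-(w t)) 0) 2 (timeMeasure T) := h.2.1.neg.pos_part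
  have hlim := h.2.2 _ hg
  have hpos : 0 ≤ ∫ t, inner ℝ (max (-(w t)) 0) (w t) ∂timeMeasure T := by
    refine ge_of_tendsto' hlim fun j => integral_nonneg_of_ae ?_
    filter_upwards [hv j] with t ht
    simpa using mul_nonneg ht (le_max_right _ _)
  have heq : ∀ t, inner ℝ (max (-(w t)) 0) (w t) = -(max (-(w t)) 0) ^ 2 := by
    intro t
    simp only [RCLike.inner_apply, conj_trivial]
    rcases le_total (w t) 0 with h0 | h0
    · rw [max_eq_left (by linarith)]; ring
    · rw [max_eq_right (by linarith)]; ring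
  simp only [heq, integral_neg] at hpos
  have h0 : ∫ t, (max (-(w t)) 0) ^ 2 ∂timeMeasure T = 0 :=
    le_antisymm (by linarith) (integral_nonneg fun t => sq_nonneg _)
  rw [integral_eq_zero_iff_of_nonneg (fun t => sq_nonneg _) hg.integrable_sq] at h0
  filter_upwards [h0] with t ht
  simp only [Pi.zero_apply, pow_eq_zero_iff two_ne_zero] at ht
  have := le_max_left (-(w t)) 0
  linarith

/-- If the sequence also tends to zero uniformly on a measurable set, the weak limit vanishes
there. -/
theorem ae_eq_zero {v : ℕ → ℝ → ℝ} {w : ℝ → ℝ} (h : WeakL2Tendsto T v w) {A : Set ℝ}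
    (hA : MeasurableSet A) {ε : ℕ → ℝ} (hε : Tendsto ε atTop (𝓝 0))
    (hv : ∀ᶠ j in atTop, ∀ t ∈ A, |v j t| ≤ ε j) : ∀ᵐ t ∂timeMeasure T, t ∈ A → w t = 0 := by
  have hg : MemLp (A.indicator w) 2 (timeMeasure T) := h.2.1.indicator hA
  have hlim := h.2.2 _ hg
  have hg1 : Integrable (fun t => ‖A.indicator w t‖) (timeMeasure T) :=
    (hg.integrable one_le_two).norm
  have hzero : Tendsto (fun j => ∫ t, inner ℝ (A.indicator w t) (v j t) ∂timeMeasure T) atTop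
      (𝓝 0) := by
    refine squeeze_zero_norm' (a := fun j => ε j * ∫ t, ‖A.indicator w t‖ ∂timeMeasure T) ?_
      (by simpa using hε.mul_const (∫ t, ‖A.indicator w t‖ ∂timeMeasure T))
    filter_upwards [hv] with j hj
    rw [← integral_const_mul]
    refine norm_integral_le_of_norm_le (hg1.const_mul _) (Eventually.of_forall fun t => ?_)
    by_cases ht : t ∈ A
    · refine (norm_inner_le_norm _ _).trans ?_
      rw [mul_comm]
      gcongr
      exact hj t ht
    · simp [ht]
  have heq := tendsto_nhds_unique hlim hzero
  have hsq : ∀ t, inner ℝ (A.indicator w t) (w t) = (A.indicator w t) ^ 2 := by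
    intro t
    by_cases ht : t ∈ A
    · simp [ht, sq]
    · simp [ht]
  simp only [hsq] at heq
  rw [integral_eq_zero_iff_of_nonneg (fun t => sq_nonneg _) hg.integrable_sq] at heq
  filter_upwards [heq] with t ht hmem
  simpa [hmem] using ht

end WeakL2Tendsto

theorem intervalIntegral_eq_indicator {F : Type*} [NormedAddCommGroup F] [NormedSpace ℝ F]
    (f : ℝ → F) {t : ℝ} (ht : t ∈ Icc 0 T) :
    ∫ s in (0 : ℝ)..t, f s = ∫ s, (Icc 0 t).indicator f s ∂timeMeasure T := by
  rw [integral_indicator measurableSet_Icc, timeMeasure, Measure.restrict_restrict measurableSet_Icc,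
    inter_eq_left.2 (Icc_subset_Icc_right ht.2), intervalIntegral.integral_of_le ht.1,
    integral_Icc_eq_integral_Ioc]

theorem tendsto_of_tendsto_inner [FiniteDimensional ℝ H] {ι : Type*} {l : Filter ι} {y : ι → H}
    {z : H} (h : ∀ e, Tendsto (fun j => inner ℝ e (y j)) l (𝓝 (inner ℝ e z))) :
    Tendsto y l (𝓝 z) := by
  set b := stdOrthonormalBasis ℝ H
  have h1 : Tendsto (fun j => ∑ i, inner ℝ (b i) (y j) • b i) l
      (𝓝 (∑ i, inner ℝ (b i) z • b i)) :=
    tendsto_finsetSum _ fun i _ => (h (b i)).smul_const _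
  simpa only [b.sum_repr'] using h1

theorem WeakL2Tendsto.tendsto_integral [FiniteDimensional ℝ H] (h : WeakL2Tendsto T v w) {t : ℝ}
    (ht : t ∈ Icc 0 T) :
    Tendsto (fun j => ∫ s in (0 : ℝ)..t, v j s) atTop (𝓝 (∫ s in (0 : ℝ)..t, w s)) := by
  have h0 : (0 : ℝ) ∈ Icc 0 T := left_mem_Icc.2 (ht.1.trans ht.2)
  have key : ∀ (u : ℝ → H), MemLp u 2 (timeMeasure T) → ∀ e,
      inner ℝ e (∫ s in (0 : ℝ)..t, u s)
        = ∫ s, inner ℝ ((Icc 0 t).indicator (fun _ => e) s) (u s) ∂timeMeasure T := by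
    intro u hu e
    rw [intervalIntegral_eq_indicator u ht, ← integral_inner
      ((hu.integrable one_le_two).indicator measurableSet_Icc)]
    refine integral_congr_ae (Eventually.of_forall fun s => ?_)
    by_cases hs : s ∈ Icc 0 t <;> simp [indicator, hs]
  refine tendsto_of_tendsto_inner fun e => ?_
  rw [key w h.2.1 e]
  simp only [key _ (h.1 _) e]
  exact h.2.2 _ ((memLp_const e).indicator measurableSet_Icc)

/-- Products of weakly convergent scalars and uniformly convergent vectors. -/
theorem WeakL2Tendsto.tendsto_integral_smul [FiniteDimensional ℝ H] {ξ : ℕ → ℝ → ℝ} {ζ : ℝ → ℝ}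
    (h : WeakL2Tendsto T ξ ζ) {B : ℝ} (hB : ∀ j, ∫ t, ‖ξ j t‖ ∂timeMeasure T ≤ B)
    {G : ℕ → ℝ → H} {G₀ : ℝ → H} (hG : TendstoUniformlyOn G G₀ atTop (Icc 0 T))
    (hGm : ∀ j, AEStronglyMeasurable (G j) (timeMeasure T))
    (hG₀m : AEStronglyMeasurable G₀ (timeMeasure T)) {R : ℝ} (hR : ∀ t ∈ Icc 0 T, ‖G₀ t‖ ≤ R)
    {t : ℝ} (ht : t ∈ Icc 0 T) :
    Tendsto (fun j => ∫ s in (0 : ℝ)..t, ξ j s • G j s) atTop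
      (𝓝 (∫ s in (0 : ℝ)..t, ζ s • G₀ s)) := by
  have h0 : (0 : ℝ) ∈ Icc 0 T := left_mem_Icc.2 (ht.1.trans ht.2)
  have hB0 : 0 ≤ B := (integral_nonneg fun t => norm_nonneg _).trans (hB 0)
  have hG₀L : MemLp G₀ ⊤ (timeMeasure T) := by
    refine memLp_top_of_bound hG₀m R ?_
    filter_upwards [ae_mem_timeMeasure T] with s hs using hR s hs
  have hint : ∀ f : ℝ → ℝ, MemLp f 2 (timeMeasure T) →
      Integrable (fun s => f s • G₀ s) (timeMeasure T) := fun f hf =>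
    ((hf.integrable one_le_two).smul_of_top_left hG₀L)
  -- the limit with the fixed factor `G₀`
  have h1 : Tendsto (fun j => ∫ s in (0 : ℝ)..t, ξ j s • G₀ s) atTop
      (𝓝 (∫ s in (0 : ℝ)..t, ζ s • G₀ s)) := by
    refine tendsto_of_tendsto_inner fun e => ?_
    have key : ∀ (f : ℝ → ℝ), MemLp f 2 (timeMeasure T) →
        inner ℝ e (∫ s in (0 : ℝ)..t, f s • G₀ s)
        = ∫ s, inner ℝ ((Icc 0 t).indicator (fun s => inner ℝ e (G₀ s)) s) (f s) ∂timeMeasure T := by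
      intro f hf
      rw [intervalIntegral_eq_indicator _ ht, ← integral_inner
        ((hint f hf).indicator measurableSet_Icc)]
      refine integral_congr_ae (Eventually.of_forall fun s => ?_)
      by_cases hs : s ∈ Icc 0 t <;> simp [indicator, hs, inner_smul_right]
    rw [key ζ h.2.1]
    simp only [key _ (h.1 _)]
    exact h.2.2 _ (((hG₀L.const_inner e).mono_exponent le_top).indicator measurableSet_Icc)
  have h2 : Tendsto (fun j => ∫ s in (0 : ℝ)..t, ξ j s • G j s - ξ j s • G₀ s) atTop (𝓝 0) := by
    rw [Metric.tendsto_nhds]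
    intro ε hε
    have hδ : 0 < ε / (B + 1) := by positivity
    filter_upwards [Metric.tendstoUniformlyOn_iff.1 hG _ hδ] with j hj
    rw [dist_zero_right]
    refine lt_of_le_of_lt (intervalIntegral.norm_integral_le_of_norm_le ht.1
      (g := fun s => ε / (B + 1) * ‖ξ j s‖) ?_ ?_) ?_
    · refine Eventually.of_forall fun s hs => ?_
      have hsT : s ∈ Icc 0 T := ⟨hs.1.le, hs.2.trans ht.2⟩
      rw [← smul_sub, norm_smul, mul_comm]
      have := hj s hsT
      rw [dist_comm, dist_eq_norm] at this
      gcongr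
    · exact intervalIntegrable_of_timeMeasure
        (((h.1 j).integrable one_le_two).norm.const_mul _) h0 ht
    · rw [intervalIntegral.integral_const_mul]
      have h3 : ∫ s in (0 : ℝ)..t, ‖ξ j s‖ ≤ B := by
        refine le_trans ?_ (hB j)
        rw [intervalIntegral_eq_indicator _ ht]
        refine integral_mono_of_nonneg
          (Eventually.of_forall fun s => indicator_nonneg (fun _ _ => norm_nonneg _) s)
          ((h.1 j).integrable one_le_two).norm (Eventually.of_forall fun s => ?_)
        exact indicator_le_self' (fun _ _ => norm_nonneg _) s
      calc ε / (B + 1) * ∫ s in (0 : ℝ)..t, ‖ξ j s‖ ≤ ε / (B + 1) * B := by gcongr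
        _ < ε / (B + 1) * (B + 1) := by gcongr; linarith
        _ = ε := div_mul_cancel₀ _ (by positivity)
  have hev : ∀ᶠ j in atTop, ∫ s in (0 : ℝ)..t, ξ j s • G j s
      = (∫ s in (0 : ℝ)..t, ξ j s • G j s - ξ j s • G₀ s) + ∫ s in (0 : ℝ)..t, ξ j s • G₀ s := by
    filter_upwards [Metric.tendstoUniformlyOn_iff.1 hG 1 one_pos] with j hj
    have hGjL : MemLp (G j) ⊤ (timeMeasure T) := by
      refine memLp_top_of_bound (hGm j) (R + 1) ?_
      filter_upwards [ae_mem_timeMeasure T] with s hs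
      have e1 := (hj s hs).le
      rw [dist_comm, dist_eq_norm] at e1
      have e2 := norm_le_norm_add_norm_sub' (G j s) (G₀ s)
      linarith [hR s hs]
    have hGi : Integrable (fun s => ξ j s • G j s) (timeMeasure T) :=
      ((h.1 j).integrable one_le_two).smul_of_top_left hGjL
    rw [intervalIntegral.integral_sub (intervalIntegrable_of_timeMeasure hGi h0 ht)
      (intervalIntegrable_of_timeMeasure (hint _ (h.1 j)) h0 ht), sub_add_cancel]
  have h3 := h2.add h1
  rw [zero_add] at h3
  exact h3.congr' (hev.mono fun j hj => hj.symm)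

end Weak

/-! ### Compactness of families of curves with bounded energy -/

section Compactness

variable {n : ℕ} {T : ℝ}

/-- By Cauchy–Schwarz, a curve of bounded energy is Hölder continuous of exponent `1 / 2`. -/
theorem integral_norm_le_sqrt {F : Type*} [NormedAddCommGroup F] {v : ℝ → F}
    (hv : MemLp v 2 (timeMeasure T)) {A : ℝ} (hA : ∫ t, ‖v t‖ ^ 2 ∂timeMeasure T ≤ A) {s t : ℝ}
    (hs : 0 ≤ s) (hst : s ≤ t) (ht : t ≤ T) :
    ∫ τ in s..t, ‖v τ‖ ≤ Real.sqrt ((t - s) * A) := by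
  have hsT : s ∈ Icc 0 T := ⟨hs, hst.trans ht⟩
  have htT : t ∈ Icc 0 T := ⟨hs.trans hst, ht⟩
  have hi1 : IntervalIntegrable (fun τ => ‖v τ‖) volume s t :=
    intervalIntegrable_of_timeMeasure (hv.integrable one_le_two).norm hsT htT
  have hi2 : IntervalIntegrable (fun τ => ‖v τ‖ ^ 2) volume s t :=
    intervalIntegrable_of_timeMeasure (hv.integrable_norm_pow two_ne_zero) hsT htT
  set I := ∫ τ in s..t, ‖v τ‖ with hI
  have hJ : ∫ τ in s..t, ‖v τ‖ ^ 2 ≤ A := by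
    refine le_trans ?_ hA
    rw [intervalIntegral.integral_of_le hst]
    refine setIntegral_mono_set (s := Ioc s t) (t := Icc 0 T) ?_
      (Eventually.of_forall fun τ => by positivity)
      (Eventually.of_forall fun τ hτ => ⟨hs.trans hτ.1.le, hτ.2.trans ht⟩)
    exact hv.integrable_norm_pow two_ne_zero
  refine Real.le_sqrt_of_sq_le ?_
  rcases hst.eq_or_lt with rfl | hlt
  · simp [hI]
  -- the variance of `‖v‖` on `[s, t]` is nonnegative
  have hvar : 0 ≤ ∫ τ in s..t, (‖v τ‖ - I / (t - s)) ^ 2 :=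
    intervalIntegral.integral_nonneg hst fun τ _ => sq_nonneg _
  have hexp : ∫ τ in s..t, (‖v τ‖ - I / (t - s)) ^ 2
      = (∫ τ in s..t, ‖v τ‖ ^ 2) - 2 * (I / (t - s)) * I + (t - s) * (I / (t - s)) ^ 2 := by
    have : ∀ τ, (‖v τ‖ - I / (t - s)) ^ 2
        = ‖v τ‖ ^ 2 - 2 * (I / (t - s)) * ‖v τ‖ + (I / (t - s)) ^ 2 := fun τ => by ring
    simp only [this]
    rw [intervalIntegral.integral_add (hi2.sub (hi1.const_mul _)) (by simp),
      intervalIntegral.integral_sub hi2 (hi1.const_mul _), intervalIntegral.integral_const_mul,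
      intervalIntegral.integral_const, smul_eq_mul]
  rw [hexp] at hvar
  have hpos : 0 < t - s := by linarith
  have e : (t - s) * ((∫ τ in s..t, ‖v τ‖ ^ 2) - 2 * (I / (t - s)) * I
      + (t - s) * (I / (t - s)) ^ 2) = (t - s) * (∫ τ in s..t, ‖v τ‖ ^ 2) - I ^ 2 := by
    field_simp
    ring
  have := mul_nonneg hpos.le hvar
  rw [e] at this
  have := mul_le_mul_of_nonneg_left hJ hpos.le
  linarith

/-- A sequence of curves with bounded energy and convergent initial points has a subsequence that
converges uniformly, with weakly convergent velocities. -/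
theorem exists_uniform_subseq (hT : 0 ≤ T) {X V : ℕ → ℝ → E n} {x₀ : E n} {A : ℝ}
    (hV : ∀ j, MemLp (V j) 2 (timeMeasure T))
    (hA : ∀ j, ∫ t, ‖V j t‖ ^ 2 ∂timeMeasure T ≤ A)
    (hX : ∀ j, ∀ t ∈ Icc 0 T, X j t = X j 0 + ∫ s in (0 : ℝ)..t, V j s)
    (h0 : Tendsto (fun j => X j 0) atTop (𝓝 x₀)) :
    ∃ (s : ℕ → ℕ) (x w : ℝ → E n), StrictMono s ∧
      TendstoUniformlyOn (fun j => X (s j)) x atTop (Icc 0 T) ∧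
      WeakL2Tendsto T (fun j => V (s j)) w ∧
      ∀ t, x t = x₀ + ∫ s in (0 : ℝ)..t, w s := by
  obtain ⟨s, w, hs, hw⟩ := exists_weakL2Tendsto_subseq hV hA
  refine ⟨s, fun t => x₀ + ∫ s in (0 : ℝ)..t, w s, w, hs, ?_, hw, fun t => rfl⟩
  have hpt : ∀ t ∈ Icc 0 T, Tendsto (fun j => X (s j) t) atTop
      (𝓝 (x₀ + ∫ s in (0 : ℝ)..t, w s)) := by
    intro t ht
    simp only [hX _ t ht]
    exact (h0.comp hs.tendsto_atTop).add (hw.tendsto_integral ht)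
  have hmod : ∀ j, ∀ a ∈ Icc 0 T, ∀ b ∈ Icc 0 T, ‖X j b - X j a‖ ≤ Real.sqrt (|b - a| * A) := by
    intro j
    have hone : ∀ a ∈ Icc 0 T, ∀ b ∈ Icc 0 T, a ≤ b →
        ‖X j b - X j a‖ ≤ Real.sqrt (|b - a| * A) := by
      intro a ha b hb hab
      have hi := (hV j).integrable one_le_two
      rw [hX j b hb, hX j a ha, add_sub_add_left_eq_sub,
        intervalIntegral.integral_interval_sub_left
          (intervalIntegrable_of_timeMeasure hi (left_mem_Icc.2 hT) hb)
          (intervalIntegrable_of_timeMeasure hi (left_mem_Icc.2 hT) ha),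
        abs_of_nonneg (sub_nonneg.2 hab)]
      exact (intervalIntegral.norm_integral_le_integral_norm hab).trans
        (integral_norm_le_sqrt (hV j) (hA j) ha.1 hab hb.2)
    intro a ha b hb
    rcases le_total a b with hab | hab
    · exact hone a ha b hb hab
    · rw [norm_sub_rev, abs_sub_comm]
      exact hone b hb a ha hab
  -- the curves are equicontinuous on the compact interval, so pointwise convergence is uniform
  set F : ℕ → Icc (0 : ℝ) T → E n := fun j t => X (s j) t with hF
  have hequi : Equicontinuous F := by
    refine Metric.equicontinuous_of_continuity_modulus (fun d => Real.sqrt (d * A)) ?_ F ?_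
    · have : Continuous fun d : ℝ => Real.sqrt (d * A) := by fun_prop
      simpa using this.tendsto 0
    · intro a b j
      rw [dist_eq_norm, dist_comm, Subtype.dist_eq, Real.dist_eq, norm_sub_rev, abs_sub_comm, abs_sub_comm]
      exact hmod (s j) a a.2 b b.2
  have hpi : Tendsto F atTop (𝓝 fun t : Icc (0 : ℝ) T => x₀ + ∫ s in (0 : ℝ)..t, w s) :=
    tendsto_pi_nhds.2 fun t => hpt t t.2
  have hunif := (hequi.tendsto_uniformFun_iff_pi atTop _).2 hpi
  rw [UniformFun.tendsto_iff_tendstoUniformly] at hunif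
  rw [tendstoUniformlyOn_iff_restrict]
  exact hunif

end Compactness

section

variable {n m r : ℕ} {ψ : Fin r → E n → ℝ} {ρ η Mψ : ℝ}

/-! ### The Clarke subdifferential and the sweeping process -/

/-- `N` is normal to `C` at `x`: it belongs to the polar of the linearized cone
`{v | ⟪∇ψ_i x, v⟫ ≤ 0 for all active i}`. -/
def IsNormal (ψ : Fin r → E n → ℝ) (x N : E n) : Prop :=
  ∀ v, (∀ i, ψ i x = 0 → inner ℝ (gradient (ψ i) x) v ≤ 0) → inner ℝ N v ≤ 0

theorem isNormal_sum {x : E n} {ξ : Fin r → ℝ} (h0 : ∀ i, 0 ≤ ξ i)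
    (hs : ∀ i, ψ i x ≠ 0 → ξ i = 0) : IsNormal ψ x (∑ i, ξ i • gradient (ψ i) x) := by
  intro v hv
  rw [sum_inner]
  refine Finset.sum_nonpos fun i _ => ?_
  rw [real_inner_smul_left]
  by_cases hi : ψ i x = 0
  · exact mul_nonpos_of_nonneg_of_nonpos (h0 i) (hv i hi)
  · simp [hs i hi]

/-- A curve in `C` is tangent to the boundaries of the active constraints. -/
theorem inner_gradient_eq_zero_of_viable (D : ConstraintData ψ ρ η Mψ) {T : ℝ} {x : ℝ → E n}
    (hx : ∀ t ∈ Icc 0 T, x t ∈ sweepingSet ψ) {t : ℝ} (ht : t ∈ Ioo 0 T) {v : E n}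
    (hv : HasDerivAt x v t) (i : Fin r) (hi : ψ i (x t) = 0) :
    inner ℝ (gradient (ψ i) (x t)) v = 0 := by
  have h1 := hasDerivAt_comp_gradient
    (D.differentiableAt i (mem_cthickening (hx t (Ioo_subset_Icc_self ht)))) hv
  refine IsLocalMax.hasDerivAt_eq_zero ?_ h1
  filter_upwards [Icc_mem_nhds ht.1 ht.2] with s hs
  rw [hi]
  exact mem_sweepingSet.1 (hx s hs) i

theorem IsNormal.inner_eq_zero_of_viable (D : ConstraintData ψ ρ η Mψ) {T : ℝ} {x : ℝ → E n}
    (hx : ∀ t ∈ Icc 0 T, x t ∈ sweepingSet ψ) {t : ℝ} (ht : t ∈ Ioo 0 T) {v N : E n}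
    (hN : IsNormal ψ (x t) N) (hv : HasDerivAt x v t) : inner ℝ N v = 0 := by
  have h := inner_gradient_eq_zero_of_viable D hx ht hv
  refine le_antisymm (hN v fun i hi => (h i hi).le) ?_
  have := hN (-v) fun i hi => by rw [inner_neg_right, h i hi, neg_zero]
  rw [inner_neg_right] at this
  linarith

/-- The normal component of a viable velocity `g - N` is at most as large as `g`. -/
theorem IsNormal.norm_le_of_viable (D : ConstraintData ψ ρ η Mψ) {T : ℝ} {x : ℝ → E n}
    (hx : ∀ t ∈ Icc 0 T, x t ∈ sweepingSet ψ) {t : ℝ} (ht : t ∈ Ioo 0 T) {g N : E n}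
    (hN : IsNormal ψ (x t) N) (hv : HasDerivAt x (g - N) t) : ‖N‖ ≤ ‖g‖ := by
  have h := hN.inner_eq_zero_of_viable D hx ht hv
  rw [inner_sub_right, real_inner_self_eq_norm_sq, sub_eq_zero] at h
  have h1 := real_inner_le_norm N g
  rw [h, sq] at h1
  rcases (norm_nonneg N).eq_or_lt with h0 | h0
  · rw [← h0]; exact norm_nonneg _
  · exact le_of_mul_le_mul_left h1 h0

/-- `C` is prox-regular: normals satisfy a quadratic one-sided estimate on all of `C`. -/
theorem IsNormal.inner_sub_le (D : ConstraintData ψ ρ η Mψ) {x z N : E n}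
    (hN : IsNormal ψ x N) (hx : x ∈ sweepingSet ψ) (hz : z ∈ sweepingSet ψ) :
    inner ℝ N (z - x) ≤ ‖N‖ * (Mψ / (2 * η)) * ‖z - x‖ ^ 2 := by
  have hη := D.eta_pos
  have hMψ := D.Mψ_pos
  have hρ := D.rho_pos
  by_cases hzx : ‖z - x‖ ≤ ρ
  · obtain ⟨v, hv1, hv⟩ := D.exists_inward hx
    -- correct `z - x` by an inward vector to make it admissible in the definition of a normal
    set s : ℝ := Mψ / (2 * η) * ‖z - x‖ ^ 2 with hs
    have hs0 : 0 ≤ s := by positivity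
    have h := hN (z - x + s • v) fun i hi => by
      have h1 := (abs_le.1 (D.abs_sub_sub_inner_le i hx hz hzx)).1
      have h2 := mem_sweepingSet.1 hz i
      have h3 := mul_le_mul_of_nonneg_left (hv i hi).le hs0
      have h4 : s * (2 * η) = Mψ * ‖z - x‖ ^ 2 := by rw [hs]; field_simp
      rw [inner_add_right, inner_smul_right]
      linarith
    rw [inner_add_right, inner_smul_right] at h
    have h5 : -(‖N‖ * 1) ≤ inner ℝ N v := by
      have := (abs_le.1 (abs_real_inner_le_norm N v)).1
      have h6 : ‖N‖ * ‖v‖ ≤ ‖N‖ * 1 := by gcongr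
      linarith
    have h7 := mul_le_mul_of_nonneg_left h5 hs0
    have h8 : ‖N‖ * (Mψ / (2 * η)) * ‖z - x‖ ^ 2 = s * ‖N‖ := by rw [hs]; ring
    rw [h8]
    linarith
  · push Not at hzx
    have h1 : 1 ≤ Mψ / (2 * η) * ρ := by
      have := D.le_mul
      rw [div_le_iff₀ hρ] at this
      rw [div_mul_eq_mul_div, le_div_iff₀ (by positivity)]
      linarith
    have h2 : 1 ≤ Mψ / (2 * η) * ‖z - x‖ := h1.trans (by gcongr)
    calc inner ℝ N (z - x) ≤ ‖N‖ * ‖z - x‖ := real_inner_le_norm _ _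
      _ ≤ ‖N‖ * ‖z - x‖ * (Mψ / (2 * η) * ‖z - x‖) :=
          le_mul_of_one_le_right (by positivity) h2
      _ = _ := by ring

/-- The qualification condition bounds multipliers by the normal vector they represent. -/
theorem sum_multipliers_le (D : ConstraintData ψ ρ η Mψ) {x : E n} (hx : x ∈ sweepingSet ψ)
    {ξ : Fin r → ℝ} (h0 : ∀ i, 0 ≤ ξ i) (hs : ∀ i, ψ i x ≠ 0 → ξ i = 0) :
    2 * η * ∑ i, ξ i ≤ ‖∑ i, ξ i • gradient (ψ i) x‖ := by
  rcases (Finset.sum_nonneg fun i (_ : i ∈ Finset.univ) => h0 i).eq_or_lt with h | hpos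
  · rw [← h]; simp
  · have h1 := D.qualified.2 x hx (fun i => (∑ j, ξ j)⁻¹ * ξ i)
      (fun i => mul_nonneg (inv_nonneg.2 hpos.le) (h0 i)) (fun i hi => by simp [hs i hi])
      (by rw [← Finset.mul_sum, inv_mul_cancel₀ hpos.ne'])
    have h2 : ∑ i, ((∑ j, ξ j)⁻¹ * ξ i) • gradient (ψ i) x
        = (∑ j, ξ j)⁻¹ • ∑ i, ξ i • gradient (ψ i) x := by
      rw [Finset.smul_sum]; simp only [mul_smul]
    rw [h2, norm_smul, norm_inv, Real.norm_of_nonneg hpos.le, inv_mul_eq_div,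
      lt_div_iff₀ hpos] at h1
    exact h1.le

section Clarke

variable {φ : E n → EReal} {Φ : E n → ℝ} {K : ℝ}

theorem mem_epigraph_iff (hdom : {x | φ x < ⊤} = sweepingSet ψ)
    (hΦ : IsExtension (sweepingSet ψ) φ Φ K) {p : E n × ℝ} :
    p ∈ epigraph φ ↔ p.1 ∈ sweepingSet ψ ∧ Φ p.1 ≤ p.2 := by
  constructor
  · intro h
    have h1 : φ p.1 ≤ (p.2 : EReal) := h
    have h2 : p.1 ∈ sweepingSet ψ := by
      rw [← hdom]
      exact lt_of_le_of_lt h1 (EReal.coe_lt_top _)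
    refine ⟨h2, ?_⟩
    rw [← hΦ.eq_on _ h2] at h1
    exact EReal.coe_le_coe_iff.1 h1
  · rintro ⟨h1, h2⟩
    change φ p.1 ≤ (p.2 : EReal)
    rw [← hΦ.eq_on _ h1]
    exact EReal.coe_le_coe_iff.2 h2

theorem IsExtension.continuous_gradient {C : Set (E n)} (hΦ : IsExtension C φ Φ K) :
    Continuous (gradient Φ) :=
  (LipschitzWith.of_dist_le_mul (K := K.toNNReal) fun x y => by
    rw [Real.coe_toNNReal _ hΦ.pos.le, dist_eq_norm, dist_eq_norm]
    exact hΦ.gradient_lipschitz x y).continuous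

theorem IsExtension.differentiable {C : Set (E n)} (hΦ : IsExtension C φ Φ K) :
    Differentiable ℝ Φ := hΦ.contDiff.differentiable one_ne_zero

/-- Strictly inward directions are hypertangent to `C`. -/
theorem eventually_add_smul_mem (D : ConstraintData ψ ρ η Mψ) {x v : E n}
    (hx : x ∈ sweepingSet ψ) (hv : ∀ i, ψ i x = 0 → inner ℝ (gradient (ψ i) x) v < 0) :
    ∀ᶠ p : E n × ℝ in 𝓝 (x, 0), p.1 ∈ sweepingSet ψ → 0 < p.2 →
      p.1 + p.2 • v ∈ sweepingSet ψ := by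
  have h1 : ∀ᶠ y in 𝓝 x, y ∈ Metric.cthickening (ρ / 2) (sweepingSet ψ) ∧
      ∀ i, (ψ i x = 0 → inner ℝ (gradient (ψ i) y) v < 0) ∧ (ψ i x ≠ 0 → ψ i y < 0) := by
    have h0 : ∀ᶠ y in 𝓝 x, y ∈ Metric.cthickening (ρ / 2) (sweepingSet ψ) :=
      cthickening_mem_nhds hx (half_pos D.rho_pos)
    refine h0.and ?_
    rw [eventually_all]
    intro i
    by_cases hi : ψ i x = 0
    · have h1 : ContinuousAt (fun y => inner ℝ (gradient (ψ i) y) v) x :=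
        (D.continuousAt_gradient hx).inner continuousAt_const
      filter_upwards [h1.eventually_lt continuousAt_const (hv i hi)] with y hy
      exact ⟨fun _ => hy, fun h => absurd hi h⟩
    · have h1 : ψ i x < 0 := lt_of_le_of_ne (mem_sweepingSet.1 hx i) hi
      filter_upwards [(D.continuousAt (i := i) hx).eventually_lt continuousAt_const h1] with y hy
      exact ⟨fun h => absurd h hi, fun _ => hy⟩
  obtain ⟨ε, hε, hb⟩ := Metric.eventually_nhds_iff_ball.1 h1
  have hlim1 : Tendsto (fun p : E n × ℝ => p.1) (𝓝 (x, 0)) (𝓝 x) := continuous_fst.tendsto _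
  have hlim2 : Tendsto (fun p : E n × ℝ => p.1 + p.2 • v) (𝓝 (x, 0)) (𝓝 x) := by
    have : Continuous fun p : E n × ℝ => p.1 + p.2 • v := by fun_prop
    simpa using this.tendsto (x, 0)
  filter_upwards [hlim1 (Metric.ball_mem_nhds x hε), hlim2 (Metric.ball_mem_nhds x hε)]
    with p hp1 hp2 hpC hp0
  refine mem_sweepingSet.2 fun i => ?_
  by_cases hi : ψ i x = 0
  · obtain ⟨q, hq, hmv⟩ := domain_mvt (f := ψ i) (s := Metric.ball x ε) (x := p.1)
      (y := p.1 + p.2 • v) (f' := fun y => fderiv ℝ (ψ i) y)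
      (fun y hy => (D.differentiableAt i (hb y hy).1).hasFDerivAt.hasFDerivWithinAt)
      (convex_ball x ε) hp1 hp2
    have hqb : q ∈ Metric.ball x ε := (convex_ball x ε).segment_subset hp1 hp2 hq
    rw [← inner_gradient_left, add_sub_cancel_left, inner_smul_right] at hmv
    have h2 := ((hb q hqb).2 i).1 hi
    have h3 := mem_sweepingSet.1 hpC i
    have h4 := mul_neg_of_pos_of_neg hp0 h2
    linarith
  · exact (((hb _ hp2).2 i).2 hi).le

/-- Directions that strictly decrease all active constraints are Clarke tangent to the epigraph,
with the slope prescribed by `∇Φ`. -/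
theorem mem_clarkeTangentCone_of_inward (D : ConstraintData ψ ρ η Mψ)
    (hdom : {x | φ x < ⊤} = sweepingSet ψ) (hΦ : IsExtension (sweepingSet ψ) φ Φ K) {x v : E n}
    (hx : x ∈ sweepingSet ψ) (hv : ∀ i, ψ i x = 0 → inner ℝ (gradient (ψ i) x) v < 0) :
    (v, inner ℝ (gradient Φ x) v) ∈ clarkeTangentCone (epigraph φ) (x, Φ x) := by
  classical
  intro y τ hy hyx hτ hτ0
  have hmem := fun k => (mem_epigraph_iff hdom hΦ).1 (hy k)
  have hy1 : Tendsto (fun k => (y k).1) atTop (𝓝 x) := (continuous_fst.tendsto _).comp hyx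
  have hev : ∀ᶠ k in atTop, (y k).1 + τ k • v ∈ sweepingSet ψ := by
    filter_upwards [(hy1.prodMk_nhds hτ0).eventually (eventually_add_smul_mem D hx hv)] with k hk
    exact hk (hmem k).1 (hτ k)
  set q : ℕ → E n × ℝ := fun k => (v, (Φ ((y k).1 + τ k • v) - Φ (y k).1) / τ k) with hq
  refine ⟨fun k => if (y k).1 + τ k • v ∈ sweepingSet ψ then q k else 0, ?_, fun k => ?_⟩
  · have hlim : Tendsto q atTop (𝓝 (v, inner ℝ (gradient Φ x) v)) := by
      refine tendsto_const_nhds.prodMk_nhds ?_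
      have h1 : Tendsto (fun k => inner ℝ (gradient Φ (y k).1) v) atTop
          (𝓝 (inner ℝ (gradient Φ x) v)) :=
        ((hΦ.continuous_gradient.tendsto x).comp hy1).inner tendsto_const_nhds
      have h2 : Tendsto (fun k => K / 2 * ‖v‖ ^ 2 * τ k) atTop (𝓝 0) := by
        simpa using hτ0.const_mul (K / 2 * ‖v‖ ^ 2)
      have h3 : Tendsto (fun k => (Φ ((y k).1 + τ k • v) - Φ (y k).1) / τ k
          - inner ℝ (gradient Φ (y k).1) v) atTop (𝓝 0) := by
        refine squeeze_zero_norm (fun k => ?_) h2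
        have := abs_sub_sub_inner_gradient_le (f := Φ) (x := (y k).1) (z := (y k).1 + τ k • v)
          (L := K) (fun p _ => hΦ.differentiable p) (fun p _ => hΦ.gradient_lipschitz p _)
        rw [add_sub_cancel_left, inner_smul_right, norm_smul, Real.norm_of_nonneg (hτ k).le] at this
        have e : (Φ ((y k).1 + τ k • v) - Φ (y k).1) / τ k - inner ℝ (gradient Φ (y k).1) v
            = (Φ ((y k).1 + τ k • v) - Φ (y k).1 - τ k * inner ℝ (gradient Φ (y k).1) v) / τ k := by
          have := (hτ k).ne'
          field_simp
        rw [e, Real.norm_eq_abs, abs_div, abs_of_pos (hτ k), div_le_iff₀ (hτ k)]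
        refine this.trans (le_of_eq ?_)
        ring
      simpa using h3.add h1
    refine hlim.congr' ?_
    filter_upwards [hev] with k hk
    rw [if_pos hk]
  · beta_reduce
    split_ifs with hk
    · rw [mem_epigraph_iff hdom hΦ]
      refine ⟨by simpa [hq] using hk, ?_⟩
      have h1 := (hmem k).2
      have h2 := (hτ k).ne'
      simp only [hq, Prod.fst_add, Prod.smul_fst, Prod.snd_add, Prod.smul_snd, smul_eq_mul]
      rw [mul_div_cancel₀ _ h2]
      linarith
    · simpa using hy k

/-- Elements of the Clarke subdifferential are sums of the gradient of the extension and of a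
normal vector. -/
theorem isNormal_of_mem_clarkeSubdifferential (D : ConstraintData ψ ρ η Mψ)
    (hdom : {x | φ x < ⊤} = sweepingSet ψ) (hΦ : IsExtension (sweepingSet ψ) φ Φ K) {x ζ : E n}
    (h : ζ ∈ clarkeSubdifferential φ x) :
    x ∈ sweepingSet ψ ∧ IsNormal ψ x (ζ - gradient Φ x) := by
  obtain ⟨hfin, hpol⟩ := h
  have hx : x ∈ sweepingSet ψ := by
    rw [← hdom]
    exact lt_top_iff_ne_top.2 hfin
  rw [← hΦ.eq_on x hx, EReal.toReal_coe] at hpol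
  refine ⟨hx, fun v hv => ?_⟩
  obtain ⟨v₀, -, hv₀⟩ := D.exists_inward hx
  have hlim : Tendsto (fun s : ℝ => inner ℝ (ζ - gradient Φ x) (v + s • v₀)) (𝓝[>] 0)
      (𝓝 (inner ℝ (ζ - gradient Φ x) v)) := by
    have : Continuous fun s : ℝ => inner ℝ (ζ - gradient Φ x) (v + s • v₀) := by fun_prop
    have h := this.tendsto 0
    rw [zero_smul, add_zero] at h
    exact h.mono_left nhdsWithin_le_nhds
  refine le_of_tendsto hlim ?_
  filter_upwards [self_mem_nhdsWithin] with s hs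
  have h1 := hpol _ (mem_clarkeTangentCone_of_inward D hdom hΦ (v := v + s • v₀) hx fun i hi => by
    rw [inner_add_right, inner_smul_right]
    have h2 := hv i hi
    have h3 : s * inner ℝ (gradient (ψ i) x) v₀ < 0 :=
      mul_neg_of_pos_of_neg hs (by linarith [hv₀ i hi, D.eta_pos])
    linarith)
  rw [inner_sub_left]
  simp only at h1
  linarith

/-- Nonnegative combinations of active constraint gradients, added to `∇Φ`, are Clarke subgradients:
a Clarke tangent `(p, q)` of the epigraph makes no acute angle with an active gradient and
satisfies `⟪∇Φ x, p⟫ ≤ q`. -/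
theorem mem_clarkeSubdifferential_of_multipliers (D : ConstraintData ψ ρ η Mψ)
    (hdom : {x | φ x < ⊤} = sweepingSet ψ) (hΦ : IsExtension (sweepingSet ψ) φ Φ K) {x : E n}
    (hx : x ∈ sweepingSet ψ) {ξ : Fin r → ℝ} (h0 : ∀ i, 0 ≤ ξ i)
    (hs : ∀ i, ψ i x ≠ 0 → ξ i = 0) :
    gradient Φ x + ∑ i, ξ i • gradient (ψ i) x ∈ clarkeSubdifferential φ x := by
  have hφx := hΦ.eq_on x hx
  refine ⟨by rw [← hφx]; exact EReal.coe_ne_top _, fun p hp => ?_⟩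
  rw [← hφx, EReal.toReal_coe] at hp
  set τ : ℕ → ℝ := fun k => 1 / ((k : ℝ) + 1) with hτ
  have hτ0 : ∀ k, 0 < τ k := fun k => by positivity
  have hτlim : Tendsto τ atTop (𝓝 0) := tendsto_one_div_add_atTop_nhds_zero_nat
  -- the constant sequence is enough: tangents are limits of difference quotients at `(x, Φ x)`
  obtain ⟨w, hw, hmem⟩ := hp (fun _ => (x, Φ x)) τ
    (fun _ => (mem_epigraph_iff hdom hΦ).2 ⟨hx, le_rfl⟩) tendsto_const_nhds hτ0 hτlim
  have hw1 : Tendsto (fun k => (w k).1) atTop (𝓝 p.1) := (continuous_fst.tendsto _).comp hw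
  have hw2 : Tendsto (fun k => (w k).2) atTop (𝓝 p.2) := (continuous_snd.tendsto _).comp hw
  have hmem' := fun k => (mem_epigraph_iff hdom hΦ).1 (hmem k)
  have hslope : ∀ F : E n → ℝ, DifferentiableAt ℝ F x →
      Tendsto (fun k => (τ k)⁻¹ • (F (x + τ k • (w k).1) - F x)) atTop
        (𝓝 (inner ℝ (gradient F x) p.1)) := by
    intro F hF
    have hd : Tendsto (fun k => τ k • (w k).1) atTop (𝓝 0) := by
      simpa using hτlim.smul hw1
    rw [inner_gradient_left]
    refine (hF.hasFDerivAt.hasFDerivWithinAt (s := univ)).lim hd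
      (Eventually.of_forall fun _ => mem_univ _) (hw1.congr fun k => ?_)
    rw [inv_smul_smul₀ (hτ0 k).ne']
  have hact : ∀ i, ψ i x = 0 → inner ℝ (gradient (ψ i) x) p.1 ≤ 0 := by
    intro i hi
    refine le_of_tendsto' (hslope _ (D.differentiableAt i (mem_cthickening hx))) fun k => ?_
    have := mem_sweepingSet.1 (hmem' k).1 i
    simp only [Prod.fst_add, Prod.smul_fst] at this
    rw [hi, sub_zero, smul_eq_mul]
    exact mul_nonpos_of_nonneg_of_nonpos (inv_nonneg.2 (hτ0 k).le) this
  have hΦle : inner ℝ (gradient Φ x) p.1 ≤ p.2 := by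
    refine le_of_tendsto_of_tendsto' (hslope _ (hΦ.differentiable x)) hw2 fun k => ?_
    have := (hmem' k).2
    simp only [Prod.fst_add, Prod.smul_fst, Prod.snd_add, Prod.smul_snd, smul_eq_mul] at this
    rw [smul_eq_mul, inv_mul_le_iff₀ (hτ0 k)]
    linarith
  have hN := isNormal_sum h0 hs p.1 hact
  rw [inner_add_left]
  linarith

end Clarke

section Solutions

variable {T : ℝ} {f : ℝ → E n → E m → E n} {U : ℝ → Set (E m)} {φ : E n → EReal} {Φ : E n → ℝ}
  {M K : ℝ} {C₀ : Set (E n)}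

/-- The field `f_Φ(t, x, u(t))` is bounded by `M + K` and `M + K`-Lipschitz. -/
theorem boundedField_of_control {C : Set (E n)} (hf : RegularDynamics T C U f M)
    (hΦ : IsExtension C φ Φ K) {u : ℝ → E m} (hu : u ∈ controls T U) :
    BoundedField T C (fun t x => fExt f Φ t x (u t)) (M + K) := by
  refine ⟨fun x hx => (hf.measurable_control x hx u hu).sub aemeasurable_const, ?_, ?_⟩
  · filter_upwards [hf.regular, hu.2] with t h1 h2 x hx y hy
    simp only [fExt]
    rw [sub_sub_sub_comm, add_mul]
    exact (norm_sub_le _ _).trans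
      (add_le_add (h1.2.1 _ h2 x hx y hy) (hΦ.gradient_lipschitz x y))
  · filter_upwards [hf.regular, hu.2] with t h1 h2 x hx
    exact (norm_sub_le _ _).trans (add_le_add (h1.2.2 x hx _ h2) (hΦ.gradient_bound x))

theorem IsSweepingSolution.mem (D : ConstraintData ψ ρ η Mψ) (hT : 0 < T)
    (hdom : {x | φ x < ⊤} = sweepingSet ψ) (hΦ : IsExtension (sweepingSet ψ) φ Φ K)
    {x₀ : E n} {u : ℝ → E m} {x : ℝ → E n} (hx : IsSweepingSolution T f φ C₀ x₀ u x) :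
    ∀ t ∈ Icc 0 T, x t ∈ sweepingSet ψ := by
  have hae : (fun t => Metric.infDist (x t) (sweepingSet ψ)) =ᵐ[volume.restrict (Icc 0 T)]
      fun _ => 0 := by
    filter_upwards [hx.inclusion] with t ⟨ζ, hζ, _⟩
    exact Metric.infDist_zero_of_mem (isNormal_of_mem_clarkeSubdifferential D hdom hΦ hζ).1
  have heq := Measure.eqOn_Icc_of_ae_eq volume hT.ne hae
    ((Metric.continuous_infDist_pt _).comp_continuousOn (continuousOn_Icc hT.le hx.absCont))
    continuousOn_const
  intro t ht
  rw [← D.compact.isClosed.closure_eq, Metric.mem_closure_iff_infDist_zero D.nonempty]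
  exact heq ht

/-- Solutions of the sweeping process are unique: the normal parts of the velocities are bounded
by `M + K` and hypomonotone. -/
theorem IsSweepingSolution.eqOn (D : ConstraintData ψ ρ η Mψ) (hT : 0 < T)
    (hdom : {x | φ x < ⊤} = sweepingSet ψ) (hΦ : IsExtension (sweepingSet ψ) φ Φ K)
    (hf : RegularDynamics T (sweepingSet ψ) U f M) {x₀ : E n} {u : ℝ → E m}
    (hu : u ∈ controls T U) {x y : ℝ → E n} (hx : IsSweepingSolution T f φ C₀ x₀ u x)
    (hy : IsSweepingSolution T f φ C₀ x₀ u y) : EqOn x y (Icc 0 T) := by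
  have hg := boundedField_of_control hf hΦ hu
  have hη := D.eta_pos
  have hMψ := D.Mψ_pos
  have key : ∀ z : ℝ → E n, IsSweepingSolution T f φ C₀ x₀ u z → ∀ᵐ t ∂timeMeasure T,
      ∃ N, IsNormal ψ (z t) N ∧ ‖N‖ ≤ M + K ∧
        HasDerivAt z (fExt f Φ t (z t) (u t) - N) t := by
    intro z hz
    have hzC := hz.mem D hT hdom hΦ
    filter_upwards [hz.inclusion, hg.bound, ae_mem_Ioo_timeMeasure T] with t ⟨ζ, hζ, hd⟩ hb ht
    obtain ⟨hzt, hN⟩ := isNormal_of_mem_clarkeSubdifferential D hdom hΦ hζ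
    have hd' : HasDerivAt z (fExt f Φ t (z t) (u t) - (ζ - gradient Φ (z t))) t := by
      simpa [fExt] using hd
    exact ⟨_, hN, (hN.norm_le_of_viable D hzC ht hd').trans (hb _ hzt), hd'⟩
  have hxC := hx.mem D hT hdom hΦ
  have hyC := hy.mem D hT hdom hΦ
  refine eqOn_of_inner_deriv_le hT.le (v := deriv x) (w := deriv y)
    (M + K + 2 * ((M + K) * (Mψ / (2 * η)))) hx.absCont hy.absCont
    (by rw [hx.initial, hy.initial]) ?_
  filter_upwards [key x hx, key y hy, hg.lipschitz, ae_mem_timeMeasure T]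
    with t ⟨N₁, hN₁, hb₁, hd₁⟩ ⟨N₂, hN₂, hb₂, hd₂⟩ hl ht
  refine ⟨hd₁.differentiableAt.hasDerivAt, hd₂.differentiableAt.hasDerivAt, ?_⟩
  rw [hd₁.deriv, hd₂.deriv, sub_sub_sub_comm, inner_sub_right, inner_sub_right _ N₁ N₂]
  have e1 : inner ℝ (x t - y t) (fExt f Φ t (x t) (u t) - fExt f Φ t (y t) (u t))
      ≤ (M + K) * ‖x t - y t‖ ^ 2 := by
    refine (real_inner_le_norm _ _).trans ?_
    have := mul_le_mul_of_nonneg_left (hl _ (hxC t ht) _ (hyC t ht)) (norm_nonneg (x t - y t))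
    refine this.trans (le_of_eq (by ring))
  have e2 := hN₁.inner_sub_le D (hxC t ht) (hyC t ht)
  have e3 := hN₂.inner_sub_le D (hyC t ht) (hxC t ht)
  rw [← neg_sub (x t) (y t), inner_neg_right, norm_neg, real_inner_comm] at e2
  rw [real_inner_comm] at e3
  have e4 : ‖N₁‖ * (Mψ / (2 * η)) * ‖x t - y t‖ ^ 2
      ≤ (M + K) * (Mψ / (2 * η)) * ‖x t - y t‖ ^ 2 := by gcongr
  have e5 : ‖N₂‖ * (Mψ / (2 * η)) * ‖x t - y t‖ ^ 2
      ≤ (M + K) * (Mψ / (2 * η)) * ‖x t - y t‖ ^ 2 := by gcongr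
  linarith

end Solutions

end

section

variable {n m r : ℕ} {ψ : Fin r → E n → ℝ} {ρ η Mψ T Mbar : ℝ}

/-! ### Multipliers along penalized curves -/

theorem sum_multiplier (ψ : Fin r → E n → ℝ) (γ : ℝ) (x : ℝ → E n) (t : ℝ) :
    ∑ i, multiplier ψ γ x i t = γ * penaltySum ψ γ (x t) := by
  simp only [multiplier, penaltySum, Finset.mul_sum]

theorem multiplier_nonneg {γ : ℝ} (hγ : 0 < γ) (x : ℝ → E n) (i : Fin r) (t : ℝ) :
    0 ≤ multiplier ψ γ x i t := mul_nonneg hγ.le (Real.exp_pos _).le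

theorem multiplier_le_sum {γ : ℝ} (hγ : 0 < γ) (x : ℝ → E n) (i : Fin r) (t : ℝ) :
    multiplier ψ γ x i t ≤ ∑ i, multiplier ψ γ x i t :=
  Finset.single_le_sum (f := fun i => multiplier ψ γ x i t)
    (fun i _ => multiplier_nonneg hγ x i t) (Finset.mem_univ i)

theorem continuousOn_multiplier (D : ConstraintData ψ ρ η Mψ) {x : ℝ → E n} {S : Set ℝ}
    (hx : ContinuousOn x S) (hxC : ∀ t ∈ S, x t ∈ sweepingSet ψ) (γ : ℝ) (i : Fin r) :
    ContinuousOn (multiplier ψ γ x i) S :=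
  continuousOn_const.mul (continuousOn_const.mul ((D.continuousOn i).comp hx
    fun t ht => mem_cthickening (hxC t ht))).rexp

/-- The energy estimate and the lower bound on the penalty field bound the multipliers in `L²`,
uniformly in the penalty parameter. -/
theorem exists_multiplier_bound (D : ConstraintData ψ ρ η Mψ) (hT : 0 ≤ T) (Mbar : ℝ) :
    ∃ Mξ : ℝ, 0 < Mξ ∧ ∀ (γ : ℝ) (g : ℝ → E n → E n) (x : ℝ → E n), 0 < γ →
      BoundedField T (sweepingSet ψ) g Mbar → PenalizedCurve T g ψ γ x → x 0 ∈ approxSet ψ γ →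
      MemLp (fun t => ∑ i, multiplier ψ γ x i t) 2 (timeMeasure T) ∧
        ∫ t, (∑ i, multiplier ψ γ x i t) ^ 2 ∂timeMeasure T ≤ Mξ := by
  obtain ⟨δ, hδ, hδρ, B, hB0, hlow⟩ := D.exists_penalty_lower_bound
  have hη := D.eta_pos
  refine ⟨1 / (2 * η ^ 2) * ((B + Mbar) ^ 2 * T + (Mbar ^ 2 * T + 2)), by positivity,
    fun γ g x hγ hg hx h0 => ?_⟩
  have hdL := hx.memLp_deriv D hg
  have hle : ∀ᵐ t ∂timeMeasure T,
      ∑ i, multiplier ψ γ x i t ≤ (B + Mbar + ‖deriv x t‖) / (2 * η) := by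
    filter_upwards [hx.equation, hg.bound, ae_mem_timeMeasure T] with t h1 h2 ht
    rw [sum_multiplier, le_div_iff₀ (by positivity), h1.deriv]
    have h3 := hlow γ hγ (x t) (Metric.self_subset_cthickening _ (hx.mem t ht))
    have h4 := h2 _ (hx.mem t ht)
    have h5 := norm_sub_norm_le (penaltyField ψ γ (x t)) (g t (x t))
    rw [norm_sub_rev] at h5
    linarith
  have hnn : ∀ t, 0 ≤ ∑ i, multiplier ψ γ x i t := fun t =>
    Finset.sum_nonneg fun i _ => multiplier_nonneg hγ x i t
  have hm : AEStronglyMeasurable (fun t => ∑ i, multiplier ψ γ x i t) (timeMeasure T) :=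
    (continuousOn_finsetSum _ fun i _ => continuousOn_multiplier D (continuousOn_Icc hT hx.absCont)
      hx.mem γ i).aestronglyMeasurable measurableSet_Icc
  have hmem : MemLp (fun t => (B + Mbar + ‖deriv x t‖) / (2 * η)) 2 (timeMeasure T) := by
    have h1 : MemLp (fun t => B + Mbar + ‖deriv x t‖) 2 (timeMeasure T) :=
      (memLp_const (B + Mbar)).add hdL.norm
    simpa only [div_eq_inv_mul] using h1.const_mul (2 * η)⁻¹
  have hL : MemLp (fun t => ∑ i, multiplier ψ γ x i t) 2 (timeMeasure T) := by
    refine hmem.mono hm ?_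
    filter_upwards [hle] with t ht
    rw [Real.norm_of_nonneg (hnn t)]
    exact ht.trans (le_abs_self _)
  refine ⟨hL, ?_⟩
  have hsq : Integrable (fun t => ‖deriv x t‖ ^ 2) (timeMeasure T) := hdL.integrable_norm_pow two_ne_zero
  calc ∫ t, (∑ i, multiplier ψ γ x i t) ^ 2 ∂timeMeasure T
      ≤ ∫ t, 1 / (2 * η ^ 2) * ((B + Mbar) ^ 2 + ‖deriv x t‖ ^ 2) ∂timeMeasure T := by
        refine integral_mono_ae hL.integrable_sq
          (((integrable_const _).add hsq).const_mul _) ?_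
        filter_upwards [hle] with t ht
        have h1 : (∑ i, multiplier ψ γ x i t) ^ 2 ≤ ((B + Mbar + ‖deriv x t‖) / (2 * η)) ^ 2 :=
          pow_le_pow_left₀ (hnn t) ht 2
        refine h1.trans ?_
        rw [div_pow, mul_pow, one_div, inv_mul_eq_div, div_le_div_iff₀ (by positivity) (by positivity)]
        nlinarith [mul_nonneg (sq_nonneg η) (sq_nonneg (B + Mbar - ‖deriv x t‖))]
    _ = 1 / (2 * η ^ 2) * ((B + Mbar) ^ 2 * T + ∫ t, ‖deriv x t‖ ^ 2 ∂timeMeasure T) := by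
        rw [integral_const_mul, integral_add (integrable_const _) hsq, integral_const,
          timeMeasure_real_univ hT, smul_eq_mul, mul_comm T]
    _ ≤ _ := by
        gcongr
        exact hx.integral_norm_deriv_sq_le D hT hg h0

/-! ### Limits of penalized curves -/

/-- Curves solving penalized equations with parameters `γ j → ∞`, under fields with common bounds,
whose initial points lie in the approximating sets and converge to `x₀`. -/
structure PenalizedSequence (T : ℝ) (ψ : Fin r → E n → ℝ) (Mbar : ℝ) (g : ℕ → ℝ → E n → E n)
    (γ : ℕ → ℝ) (X : ℕ → ℝ → E n) (x₀ : E n) : Prop where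
  pos : ∀ j, 0 < γ j
  tendsto : Tendsto γ atTop atTop
  field : ∀ j, BoundedField T (sweepingSet ψ) (g j) Mbar
  curve : ∀ j, PenalizedCurve T (g j) ψ (γ j) (X j)
  initial_mem : ∀ j, X j 0 ∈ approxSet ψ (γ j)
  initial : Tendsto (fun j => X j 0) atTop (𝓝 x₀)

theorem HasStateBounds.congr {C : Set (E n)} {x₀ : E n} {x y : ℝ → E n} (hT : 0 ≤ T)
    (h : HasStateBounds T Mbar C x₀ x) (hxy : EqOn x y (Icc 0 T)) :
    HasStateBounds T Mbar C x₀ y := by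
  have hd : deriv x =ᵐ[timeMeasure T] deriv y := by
    filter_upwards [ae_mem_Ioo_timeMeasure T] with t ht
    refine EventuallyEq.deriv_eq ?_
    filter_upwards [Icc_mem_nhds ht.1 ht.2] with s hs using hxy hs
  refine ⟨⟨?_, (memLp_congr_ae hd).1 h.inW12.2⟩, fun t ht => hxy ht ▸ h.mem t ht,
    fun t ht => hxy ht ▸ h.sup_bound t ht, ?_⟩
  · refine absolutelyContinuousOnInterval_of_dist_le h.inW12.1 fun s hs t ht => ?_
    rw [uIcc_of_le hT] at hs ht
    rw [hxy hs, hxy ht]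
  · refine le_trans (le_of_eq (integral_congr_ae ?_)) h.energy_bound
    filter_upwards [hd] with t ht
    rw [ht]

namespace PenalizedSequence

variable {g : ℕ → ℝ → E n → E n} {γ : ℕ → ℝ} {X : ℕ → ℝ → E n} {x₀ : E n} {x : ℝ → E n}

theorem comp (h : PenalizedSequence T ψ Mbar g γ X x₀) {s : ℕ → ℕ} (hs : StrictMono s) :
    PenalizedSequence T ψ Mbar (fun j => g (s j)) (fun j => γ (s j)) (fun j => X (s j)) x₀ :=
  ⟨fun _ => h.pos _, h.tendsto.comp hs.tendsto_atTop, fun _ => h.field _, fun _ => h.curve _,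
    fun _ => h.initial_mem _, h.initial.comp hs.tendsto_atTop⟩

/-- Compactness of the penalized curves: their energies are bounded independently of `γ`. -/
theorem exists_subseq (h : PenalizedSequence T ψ Mbar g γ X x₀) (D : ConstraintData ψ ρ η Mψ)
    (hT : 0 ≤ T) :
    ∃ (s : ℕ → ℕ) (x : ℝ → E n), StrictMono s ∧
      TendstoUniformlyOn (fun j => X (s j)) x atTop (Icc 0 T) ∧
      WeakL2Tendsto T (fun j => deriv (X (s j))) (deriv x) ∧
      HasStateBounds T Mbar (sweepingSet ψ) x₀ x := by
  have hmem := fun j => (h.curve j).memLp_deriv D (h.field j)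
  have hen := fun j => (h.curve j).integral_norm_deriv_sq_le D hT (h.field j) (h.initial_mem j)
  have hint : ∀ j, ∀ t ∈ Icc 0 T, X j t = X j 0 + ∫ s in (0 : ℝ)..t, deriv (X j) s := by
    intro j t ht
    refine eq_add_integral hT (h.curve j).absCont ((hmem j).integrable one_le_two) ?_ ht
    filter_upwards [(h.curve j).equation] with t ht
    exact ht.differentiableAt.hasDerivAt
  obtain ⟨s, x, w, hs, hunif, hw, hx⟩ := exists_uniform_subseq hT hmem hen hint h.initial
  obtain rfl : x = fun t => x₀ + ∫ s in (0 : ℝ)..t, w s := funext hx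
  have hwi := hw.2.1.integrable one_le_two
  have hdx : w =ᵐ[timeMeasure T] deriv (fun t => x₀ + ∫ s in (0 : ℝ)..t, w s) := by
    filter_upwards [ae_hasDerivAt_integral hT hwi x₀] with t ht
    exact ht.deriv.symm
  have hw' := hw.congr (fun _ => EventuallyEq.rfl) hdx
  have hwb := hw.integral_norm_sq_le fun j => hen (s j)
  refine ⟨s, _, hs, hunif, hw', ⟨absolutelyContinuousOnInterval_integral hT hwi x₀, hw'.2.1⟩,
    fun t ht => ?_, fun t ht => ?_, hw'.integral_norm_sq_le fun j => hen (s j)⟩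
  · exact D.compact.isClosed.mem_of_tendsto (hunif.tendsto_at ht)
      (Eventually.of_forall fun j => (h.curve (s j)).mem t ht)
  · refine (norm_add_le _ _).trans ?_
    gcongr
    refine (intervalIntegral.norm_integral_le_integral_norm ht.1).trans
      ((integral_norm_le_sqrt hw.2.1 hwb le_rfl ht.1 ht.2).trans (Real.sqrt_le_sqrt ?_))
    have h1 : (t - 0) * (Mbar ^ 2 * T + 2) ≤ T * (Mbar ^ 2 * T + 2) := by
      have := ht.2
      gcongr
      linarith
    refine h1.trans (le_of_eq ?_)
    ring

theorem hasStateBounds (h : PenalizedSequence T ψ Mbar g γ X x₀) (D : ConstraintData ψ ρ η Mψ)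
    (hT : 0 ≤ T) (hx : TendstoUniformlyOn X x atTop (Icc 0 T)) :
    HasStateBounds T Mbar (sweepingSet ψ) x₀ x := by
  obtain ⟨s, y, hs, hy, -, hb⟩ := h.exists_subseq D hT
  refine hb.congr hT fun t ht => ?_
  exact tendsto_nhds_unique (hy.tendsto_at ht) ((hx.tendsto_at ht).comp hs.tendsto_atTop)

end PenalizedSequence

/-! ### Weak limits of the multipliers -/

theorem WeakL2Tendsto.clm {H H' : Type*} [NormedAddCommGroup H] [InnerProductSpace ℝ H]
    [CompleteSpace H] [NormedAddCommGroup H'] [InnerProductSpace ℝ H'] [CompleteSpace H']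
    {v : ℕ → ℝ → H} {w : ℝ → H} (h : WeakL2Tendsto T v w) (L : H →L[ℝ] H') :
    WeakL2Tendsto T (fun j t => L (v j t)) (fun t => L (w t)) := by
  refine ⟨fun j => L.comp_memLp' (h.1 j), L.comp_memLp' h.2.1, fun g hg => ?_⟩
  simpa only [ContinuousLinearMap.adjoint_inner_left] using
    h.2.2 (fun t => L.adjoint (g t)) (L.adjoint.comp_memLp' hg)

theorem WeakL2Tendsto.sum {ι H : Type*} [Fintype ι] [NormedAddCommGroup H] [InnerProductSpace ℝ H]
    {v : ι → ℕ → ℝ → H} {w : ι → ℝ → H} (h : ∀ i, WeakL2Tendsto T (v i) (w i)) :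
    WeakL2Tendsto T (fun j t => ∑ i, v i j t) (fun t => ∑ i, w i t) := by
  refine ⟨fun j => memLp_finsetSum _ fun i _ => (h i).1 j,
    memLp_finsetSum _ fun i _ => (h i).2.1, fun g hg => ?_⟩
  have e : ∀ u : ι → ℝ → H, (∀ i, MemLp (u i) 2 (timeMeasure T)) →
      ∫ t, inner ℝ (g t) (∑ i, u i t) ∂timeMeasure T
        = ∑ i, ∫ t, inner ℝ (g t) (u i t) ∂timeMeasure T := by
    intro u hu
    simp only [inner_sum]
    exact integral_finsetSum _ fun i _ => integrable_inner_of_memLp hg (hu i)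
  rw [e w fun i => (h i).2.1]
  simp only [fun j => e (fun i => v i j) fun i => (h i).1 j]
  exact tendsto_finsetSum _ fun i _ => (h i).2.2 g hg

/-- Interior points of `C_i` in `C` satisfy the constraint strictly, because the gradient of an
active constraint does not vanish. -/
theorem neg_of_mem_interior_sublevel (D : ConstraintData ψ ρ η Mψ) {x : E n} {i : Fin r}
    (hx : x ∈ sweepingSet ψ) (hi : x ∈ interior (sublevel ψ i)) : ψ i x < 0 := by
  refine lt_of_le_of_ne (mem_sweepingSet.1 hx i) fun h0 => ?_
  obtain ⟨v, -, hv⟩ := D.exists_inward hx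
  have hmax : IsLocalMax (ψ i) x := by
    filter_upwards [mem_interior_iff_mem_nhds.1 hi] with y hy
    rw [h0]
    exact hy
  have h1 := hv i h0
  rw [inner_gradient_left, hmax.fderiv_eq_zero, zero_apply] at h1
  linarith [D.eta_pos]

namespace PenalizedSequence

variable {g : ℕ → ℝ → E n → E n} {γ : ℕ → ℝ} {X : ℕ → ℝ → E n} {x₀ : E n} {x : ℝ → E n}

/-- The multipliers are bounded in `L²`; taken together they form a curve in `E r`, so that one
subsequence serves all of them. -/
theorem exists_multiplier_subseq (h : PenalizedSequence T ψ Mbar g γ X x₀)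
    (D : ConstraintData ψ ρ η Mψ) (hT : 0 ≤ T) :
    ∃ (s : ℕ → ℕ) (ξ : Fin r → ℝ → ℝ), StrictMono s ∧ MultipliersTendsto T ψ γ X s ξ := by
  obtain ⟨Mξ, -, hM⟩ := exists_multiplier_bound D hT Mbar
  have hM' := fun j => hM (γ j) (g j) (X j) (h.pos j) (h.field j) (h.curve j) (h.initial_mem j)
  set v : ℕ → ℝ → E r := fun j t => WithLp.toLp 2 fun i => multiplier ψ (γ j) (X j) i t with hv
  have hle : ∀ j t, ‖v j t‖ ≤ ∑ i, multiplier ψ (γ j) (X j) i t := fun j t =>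
    (norm_le_sum_abs _).trans (le_of_eq (Finset.sum_congr rfl fun i _ =>
      abs_of_nonneg (multiplier_nonneg (h.pos j) _ i t)))
  have hvm : ∀ j, AEStronglyMeasurable (v j) (timeMeasure T) := fun j => by
    refine ContinuousOn.aestronglyMeasurable ?_ measurableSet_Icc
    refine (PiLp.continuous_toLp 2 _).comp_continuousOn (continuousOn_pi.2 fun i => ?_)
    exact continuousOn_multiplier D (continuousOn_Icc hT (h.curve j).absCont) (h.curve j).mem _ i
  have hvL : ∀ j, MemLp (v j) 2 (timeMeasure T) := fun j =>
    (hM' j).1.mono (hvm j) (Eventually.of_forall fun t => (hle j t).trans (le_abs_self _))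
  obtain ⟨s, w, hs, hw⟩ := exists_weakL2Tendsto_subseq hvL (B := Mξ) fun j => by
    refine (integral_mono (hvL j).integrable_norm_pow' (hM' j).1.integrable_sq fun t => ?_).trans
      (hM' j).2
    exact pow_le_pow_left₀ (norm_nonneg _) (hle j t) 2
  exact ⟨s, fun i t => w t i, hs, fun i => hw.clm (EuclideanSpace.proj i)⟩

/-- Complementary slackness of the limiting multipliers. -/
theorem ae_multiplier_limit (h : PenalizedSequence T ψ Mbar g γ X x₀)
    (D : ConstraintData ψ ρ η Mψ) (hT : 0 ≤ T) (hx : TendstoUniformlyOn X x atTop (Icc 0 T))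
    {i : Fin r} {ζ : ℝ → ℝ} (hζ : WeakL2Tendsto T (fun j => multiplier ψ (γ j) (X j) i) ζ) :
    ∀ᵐ t ∂timeMeasure T, 0 ≤ ζ t ∧ (ψ i (x t) ≠ 0 → ζ t = 0) := by
  have hb := h.hasStateBounds D hT hx
  have hnn := hζ.ae_nonneg fun j => Eventually.of_forall fun t =>
    multiplier_nonneg (h.pos j) (X j) i t
  have hcont : ContinuousOn (fun t => ψ i (x t)) (Icc 0 T) :=
    (D.continuousOn i).comp (continuousOn_Icc hT hb.inW12.1) fun t ht => mem_cthickening (hb.mem t ht)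
  have huc := D.compact.uniformContinuousOn_of_continuous
    ((D.continuousOn i).mono fun y hy => mem_cthickening hy)
  -- on `{ψ_i (x t) ≤ -δ}` the multipliers are eventually at most `γ exp (-γ δ / 2)`
  have hzero : ∀ k : ℕ, ∀ᵐ t ∂timeMeasure T,
      t ∈ Icc 0 T ∩ (fun t => ψ i (x t)) ⁻¹' Iic (-(1 / ((k : ℝ) + 1))) → ζ t = 0 := by
    intro k
    set δ : ℝ := 1 / ((k : ℝ) + 1) with hδ
    have hδ0 : 0 < δ := by positivity
    refine hζ.ae_eq_zero (hcont.preimage_isClosed_of_isClosed isClosed_Icc isClosed_Iic).measurableSet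
      (ε := fun j => γ j * Real.exp (-(δ / 2) * γ j)) ?_ ?_
    · have h1 := ((Real.tendsto_pow_mul_exp_neg_atTop_nhds_zero 1).comp
        (h.tendsto.const_mul_atTop (half_pos hδ0))).const_mul (δ / 2)⁻¹
      rw [mul_zero] at h1
      refine h1.congr fun j => ?_
      simp only [Function.comp_apply, pow_one, neg_mul]
      rw [← mul_assoc, inv_mul_cancel_left₀ (half_pos hδ0).ne']
    · obtain ⟨d, hd, hdd⟩ := Metric.uniformContinuousOn_iff.1 huc (δ / 2) (half_pos hδ0)
      filter_upwards [Metric.tendstoUniformlyOn_iff.1 hx d hd] with j hj t ht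
      have h1 := hdd _ (hb.mem t ht.1) _ ((h.curve j).mem t ht.1) (hj t ht.1)
      rw [Real.dist_eq, abs_lt] at h1
      have h2 : ψ i (x t) ≤ -δ := ht.2
      rw [abs_of_nonneg (multiplier_nonneg (h.pos j) _ i t), multiplier, mul_comm (-(δ / 2))]
      have := h.pos j
      gcongr
      linarith
  filter_upwards [hnn, ae_all_iff.2 hzero, ae_mem_timeMeasure T] with t h1 h2 ht
  refine ⟨h1, fun hne => ?_⟩
  have hneg : 0 < -ψ i (x t) := neg_pos.2 (lt_of_le_of_ne (mem_sweepingSet.1 (hb.mem t ht) i) hne)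
  obtain ⟨k, hk⟩ := exists_nat_one_div_lt hneg
  exact h2 k ⟨ht, by simp only [mem_preimage, mem_Iic]; linarith⟩

/-- The weak limits of the multipliers have representatives satisfying complementary slackness
everywhere. -/
theorem exists_isSlack (h : PenalizedSequence T ψ Mbar g γ X x₀)
    (D : ConstraintData ψ ρ η Mψ) (hT : 0 ≤ T) (hx : TendstoUniformlyOn X x atTop (Icc 0 T)) :
    ∃ (s : ℕ → ℕ) (ξ : Fin r → ℝ → ℝ), StrictMono s ∧ MultipliersTendsto T ψ γ X s ξ ∧
      IsSlack T ψ x ξ := by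
  classical
  obtain ⟨s, ξ, hs, hξ⟩ := h.exists_multiplier_subseq D hT
  have hb := h.hasStateBounds D hT hx
  have hx' : TendstoUniformlyOn (fun j => X (s j)) x atTop (Icc 0 T) :=
    fun u hu => hs.tendsto_atTop.eventually (hx u hu)
  refine ⟨s, fun i t => if x t ∈ interior (sublevel ψ i) then 0 else max (ξ i t) 0, hs,
    fun i => (hξ i).congr (fun _ => EventuallyEq.rfl) ?_, ?_, ?_, ?_⟩
  · filter_upwards [(h.comp hs).ae_multiplier_limit D hT hx' (hξ i), ae_mem_timeMeasure T]
      with t ht htT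
    split_ifs with hi
    · exact ht.2 (neg_of_mem_interior_sublevel D (hb.mem t htT) hi).ne
    · rw [max_eq_left ht.1]
  · intro i t _
    split_ifs
    · exact le_rfl
    · exact le_max_right _ _
  · intro i t _ hi
    exact if_pos hi
  · intro t _ ht
    refine Finset.sum_eq_zero fun i _ => if_pos (interior_mono (iInter_subset _ i) ht)

/-! ### The limit equation -/

/-- Passage to the limit in the integrated penalized equations, when the integrals of the fields
along the curves converge. -/
theorem hasDerivAt_limit (h : PenalizedSequence T ψ Mbar g γ X x₀)
    (D : ConstraintData ψ ρ η Mψ) (hT : 0 ≤ T) (hM : 0 ≤ Mbar)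
    (hx : TendstoUniformlyOn X x atTop (Icc 0 T)) {ξ : Fin r → ℝ → ℝ}
    (hξ : ∀ i, WeakL2Tendsto T (fun j => multiplier ψ (γ j) (X j) i) (ξ i)) {G : ℝ → E n}
    (hG : Integrable G (timeMeasure T))
    (hlim : ∀ t ∈ Icc 0 T, Tendsto (fun j => ∫ s in (0 : ℝ)..t, g j s (X j s)) atTop
      (𝓝 (∫ s in (0 : ℝ)..t, G s))) :
    ∀ᵐ t ∂timeMeasure T, HasDerivAt x (G t - ∑ i, ξ i t • gradient (ψ i) (x t)) t := by
  have h0 : (0 : ℝ) ∈ Icc 0 T := left_mem_Icc.2 hT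
  have hb := h.hasStateBounds D hT hx
  obtain ⟨L, hL0, hL⟩ := D.exists_gradient_bound
  have hgradm : ∀ (i : Fin r) (y : ℝ → E n), AbsolutelyContinuousOnInterval y 0 T →
      (∀ t ∈ Icc 0 T, y t ∈ sweepingSet ψ) →
      AEStronglyMeasurable (fun t => gradient (ψ i) (y t)) (timeMeasure T) := fun i y hy hyC =>
    ((D.continuousOn_gradient i).comp (continuousOn_Icc hT hy)
      fun t ht => mem_cthickening (hyC t ht)).aestronglyMeasurable measurableSet_Icc
  have hprod : ∀ (i : Fin r) (ζ : ℝ → ℝ) (y : ℝ → E n), MemLp ζ 2 (timeMeasure T) →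
      AbsolutelyContinuousOnInterval y 0 T → (∀ t ∈ Icc 0 T, y t ∈ sweepingSet ψ) →
      Integrable (fun t => ζ t • gradient (ψ i) (y t)) (timeMeasure T) := by
    intro i ζ y hζ hy hyC
    refine (hζ.integrable one_le_two).smul_bdd L (hgradm i y hy hyC) ?_
    filter_upwards [ae_mem_timeMeasure T] with t ht
    exact hL i _ (mem_cthickening (hyC t ht))
  have hgi : ∀ j, Integrable (fun t => g j t (X j t)) (timeMeasure T) := by
    intro j
    refine (integrable_const Mbar).mono' ((h.field j).aemeasurable_comp hM
      (aemeasurable_of_absCont hT (h.curve j).absCont) (h.curve j).mem).aestronglyMeasurable ?_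
    filter_upwards [(h.field j).bound, ae_mem_timeMeasure T] with t ht htT
    exact ht _ ((h.curve j).mem t htT)
  have hsumi : ∀ (ζ : Fin r → ℝ → ℝ) (y : ℝ → E n), (∀ i, MemLp (ζ i) 2 (timeMeasure T)) →
      AbsolutelyContinuousOnInterval y 0 T → (∀ t ∈ Icc 0 T, y t ∈ sweepingSet ψ) →
      Integrable (fun t => ∑ i, ζ i t • gradient (ψ i) (y t)) (timeMeasure T) :=
    fun ζ y hζ hy hyC => integrable_finsetSum _ fun i _ => hprod i _ y (hζ i) hy hyC
  -- splitting of the integrated right-hand sides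
  have hsplit : ∀ (F : ℝ → E n) (ζ : Fin r → ℝ → ℝ) (y : ℝ → E n), Integrable F (timeMeasure T) →
      (∀ i, MemLp (ζ i) 2 (timeMeasure T)) → AbsolutelyContinuousOnInterval y 0 T →
      (∀ t ∈ Icc 0 T, y t ∈ sweepingSet ψ) → ∀ t ∈ Icc 0 T,
      ∫ s in (0 : ℝ)..t, (F s - ∑ i, ζ i s • gradient (ψ i) (y s))
        = (∫ s in (0 : ℝ)..t, F s) - ∑ i, ∫ s in (0 : ℝ)..t, ζ i s • gradient (ψ i) (y s) := by
    intro F ζ y hF hζ hy hyC t ht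
    rw [intervalIntegral.integral_sub (intervalIntegrable_of_timeMeasure hF h0 ht)
      (intervalIntegrable_of_timeMeasure (hsumi ζ y hζ hy hyC) h0 ht),
      intervalIntegral.integral_finsetSum fun i _ =>
        intervalIntegrable_of_timeMeasure (hprod i _ y (hζ i) hy hyC) h0 ht]
  have hXeq : ∀ j, ∀ t ∈ Icc 0 T, X j t = X j 0 + ((∫ s in (0 : ℝ)..t, g j s (X j s))
      - ∑ i, ∫ s in (0 : ℝ)..t, multiplier ψ (γ j) (X j) i s • gradient (ψ i) (X j s)) := by
    intro j t ht
    have hζ := fun i => (hξ i).1 j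
    rw [← hsplit _ (multiplier ψ (γ j) (X j)) (X j) (hgi j) hζ (h.curve j).absCont
      (h.curve j).mem t ht]
    exact eq_add_integral hT (h.curve j).absCont ((hgi j).sub
      (hsumi _ (X j) hζ (h.curve j).absCont (h.curve j).mem)) (h.curve j).equation ht
  obtain ⟨Mξ, hMξ0, hMξ⟩ := exists_multiplier_bound D hT Mbar
  have hL1 : ∀ i j, ∫ t, ‖multiplier ψ (γ j) (X j) i t‖ ∂timeMeasure T ≤ Real.sqrt (T * Mξ) := by
    intro i j
    have h1 := hMξ (γ j) (g j) (X j) (h.pos j) (h.field j) (h.curve j) (h.initial_mem j)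
    have h2 : ∫ t, ‖multiplier ψ (γ j) (X j) i t‖ ^ 2 ∂timeMeasure T ≤ Mξ := by
      refine (integral_mono ((hξ i).1 j).integrable_norm_pow' h1.1.integrable_sq
        fun t => ?_).trans h1.2
      beta_reduce
      rw [Real.norm_of_nonneg (multiplier_nonneg (h.pos j) _ i t)]
      exact pow_le_pow_left₀ (multiplier_nonneg (h.pos j) _ i t) (multiplier_le_sum (h.pos j) _ i t) 2
    have h3 := integral_norm_le_sqrt ((hξ i).1 j) h2 le_rfl hT le_rfl
    rwa [sub_zero, intervalIntegral_timeMeasure hT] at h3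
  have hgradu : ∀ i, TendstoUniformlyOn (fun j t => gradient (ψ i) (X j t))
      (fun t => gradient (ψ i) (x t)) atTop (Icc 0 T) := by
    intro i
    have huc := D.compact.uniformContinuousOn_of_continuous
      ((D.continuousOn_gradient i).mono fun y hy => mem_cthickening hy)
    rw [Metric.tendstoUniformlyOn_iff]
    intro ε hε
    obtain ⟨d, hd, hdd⟩ := Metric.uniformContinuousOn_iff.1 huc ε hε
    filter_upwards [Metric.tendstoUniformlyOn_iff.1 hx d hd] with j hj t ht
    exact hdd _ (hb.mem t ht) _ ((h.curve j).mem t ht) (hj t ht)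
  have hxeq : ∀ t ∈ Icc 0 T,
      x t = x₀ + ∫ s in (0 : ℝ)..t, (G s - ∑ i, ξ i s • gradient (ψ i) (x s)) := by
    intro t ht
    rw [hsplit G ξ x hG (fun i => (hξ i).2.1) hb.inW12.1 hb.mem t ht]
    refine tendsto_nhds_unique (hx.tendsto_at ht) ?_
    simp only [fun j => hXeq j t ht]
    refine h.initial.add ((hlim t ht).sub (tendsto_finsetSum _ fun i _ => ?_))
    exact (hξ i).tendsto_integral_smul (hL1 i) (hgradu i)
      (fun j => hgradm i _ (h.curve j).absCont (h.curve j).mem) (hgradm i x hb.inW12.1 hb.mem)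
      (fun t ht => hL i _ (mem_cthickening (hb.mem t ht))) ht
  have hi : Integrable (fun s => G s - ∑ i, ξ i s • gradient (ψ i) (x s)) (timeMeasure T) :=
    hG.sub (hsumi ξ x (fun i => (hξ i).2.1) hb.inW12.1 hb.mem)
  filter_upwards [ae_hasDerivAt_integral hT hi x₀, ae_mem_Ioo_timeMeasure T] with t ht htT
  exact hasDerivAt_congr_Icc (fun s hs => (hxeq s hs).symm) htT ht

end PenalizedSequence

end

section

variable {n m r : ℕ} {ψ : Fin r → E n → ℝ} {ρ η Mψ T : ℝ}

/-! ### The sweeping process as the limit -/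

section Limit

variable {f : ℝ → E n → E m → E n} {U : ℝ → Set (E m)} {φ : E n → EReal} {Φ : E n → ℝ}
  {M K : ℝ} {C₀ : Set (E n)} {x₀ : E n} {x : ℝ → E n} {ξ : Fin r → ℝ → ℝ} {v : ℝ → E m}

/-- A viable curve driven by slack multipliers solves the sweeping process, and the size of the
multipliers is controlled by the field. -/
theorem isLimitTriplet_of_hasDerivAt (D : ConstraintData ψ ρ η Mψ) (hT : 0 < T)
    (hdom : {x | φ x < ⊤} = sweepingSet ψ) (hΦ : IsExtension (sweepingSet ψ) φ Φ K)
    (hf : RegularDynamics T (sweepingSet ψ) U f M) (hv : v ∈ controls T U) (hx₀ : x₀ ∈ C₀)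
    (hac : AbsolutelyContinuousOnInterval x 0 T) (h0 : x 0 = x₀)
    (hxC : ∀ t ∈ Icc 0 T, x t ∈ sweepingSet ψ)
    (hξ : ∀ i, ∀ᵐ t ∂timeMeasure T, 0 ≤ ξ i t ∧ (ψ i (x t) ≠ 0 → ξ i t = 0))
    (heq : ∀ᵐ t ∂timeMeasure T,
      HasDerivAt x (fExt f Φ t (x t) (v t) - ∑ i, ξ i t • gradient (ψ i) (x t)) t) :
    IsUniqueSweepingSolution T f φ C₀ x₀ v x ∧
      IsLimitTriplet T f Φ ψ (M + K) η Mψ x v ξ := by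
  have hη := D.eta_pos
  have hMψ := D.Mψ_pos
  have hsol : IsSweepingSolution T f φ C₀ x₀ v x := by
    refine ⟨hac, h0, hx₀, ?_⟩
    filter_upwards [heq, ae_all_iff.2 hξ, ae_mem_timeMeasure T] with t h1 h2 ht
    refine ⟨_, mem_clarkeSubdifferential_of_multipliers D hdom hΦ (hxC t ht)
      (fun i => (h2 i).1) (fun i => (h2 i).2), ?_⟩
    rw [← sub_sub]
    exact h1
  -- The normal part `N` of the velocity is orthogonal to it, because the curve stays in `C`; hence
  -- `‖N‖` is at most the norm of the field, and it controls the multipliers.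
  have key : ∀ᵐ t ∂timeMeasure T, x t ∈ sweepingSet ψ ∧ (∀ i, 0 ≤ ξ i t) ∧
      IsNormal ψ (x t) (fExt f Φ t (x t) (v t) - deriv x t) ∧
      ‖fExt f Φ t (x t) (v t) - deriv x t‖ ≤ ‖fExt f Φ t (x t) (v t)‖ ∧
      ‖fExt f Φ t (x t) (v t)‖ ≤ M + K ∧
      2 * η * ∑ i, ξ i t ≤ ‖fExt f Φ t (x t) (v t) - deriv x t‖ := by
    filter_upwards [heq, ae_all_iff.2 hξ, ae_mem_Ioo_timeMeasure T,
      (boundedField_of_control hf hΦ hv).bound] with t h1 h2 ht hb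
    have hxt := hxC t (Ioo_subset_Icc_self ht)
    have hN := isNormal_sum (x := x t) (fun i => (h2 i).1) (fun i => (h2 i).2)
    rw [h1.deriv, sub_sub_cancel]
    exact ⟨hxt, fun i => (h2 i).1, hN, hN.norm_le_of_viable D hxC ht h1, hb _ hxt,
      sum_multipliers_le D hxt (fun i => (h2 i).1) (fun i => (h2 i).2)⟩
  have hsum : ∀ᵐ t ∂timeMeasure T, |∑ i, ξ i t| ≤ (M + K) / (2 * η) := by
    filter_upwards [key] with t ⟨_, h0, _, h1, h2, h3⟩
    rw [abs_of_nonneg (Finset.sum_nonneg fun i _ => h0 i), le_div_iff₀ (by positivity)]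
    linarith
  refine ⟨⟨hsol, fun y hy => IsSweepingSolution.eqOn D hT hdom hΦ hf hv hy hsol⟩,
    heq, fun i => ?_, hsum, ?_, ?_⟩
  · filter_upwards [key, hsum] with t ⟨_, h0, _⟩ h1
    rw [abs_of_nonneg (Finset.sum_nonneg fun i _ => h0 i)] at h1
    rw [abs_of_nonneg (h0 i)]
    exact (Finset.single_le_sum (f := fun i => ξ i t) (fun i _ => h0 i) (Finset.mem_univ i)).trans h1
  · filter_upwards [key] with t ⟨_, _, _, h1, _⟩ using h1
  · filter_upwards [key] with t ⟨hxt, _, hN, h1, h2, _⟩ z hz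
    refine (hN.inner_sub_le D hxt hz).trans ?_
    rw [mul_div_assoc]
    have := h1.trans h2
    gcongr

variable {γ : ℕ → ℝ} {X : ℕ → ℝ → E n} {u : ℕ → ℝ → E m}

/-- The limit for pointwise convergent controls. -/
theorem isLimitTriplet_of_tendsto_control (D : ConstraintData ψ ρ η Mψ) (hT : 0 < T)
    (hdom : {x | φ x < ⊤} = sweepingSet ψ) (hΦ : IsExtension (sweepingSet ψ) φ Φ K)
    (hf : RegularDynamics T (sweepingSet ψ) U f M) (hx₀ : x₀ ∈ C₀)
    (h : PenalizedSequence T ψ (M + K) (fun j t y => fExt f Φ t y (u j t)) γ X x₀)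
    (hu : ∀ j, u j ∈ controls T U) (hx : TendstoUniformlyOn X x atTop (Icc 0 T))
    (hξ : ∀ i, WeakL2Tendsto T (fun j => multiplier ψ (γ j) (X j) i) (ξ i))
    (hv : v ∈ controls T U)
    (huv : ∀ᵐ t ∂timeMeasure T, Tendsto (fun j => u j t) atTop (𝓝 (v t))) :
    IsUniqueSweepingSolution T f φ C₀ x₀ v x ∧
      IsLimitTriplet T f Φ ψ (M + K) η Mψ x v ξ := by
  have hMK : 0 ≤ M + K := (add_pos hf.pos hΦ.pos).le
  have hb := h.hasStateBounds D hT.le hx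
  have hg := boundedField_of_control hf hΦ hv
  have hpt : ∀ᵐ t ∂timeMeasure T, Tendsto (fun j => fExt f Φ t (X j t) (u j t)) atTop
      (𝓝 (fExt f Φ t (x t) (v t))) := by
    filter_upwards [hf.regular, hv.2, ae_all_iff.2 fun j => (hu j).2, huv, ae_mem_timeMeasure T]
      with t h1 h2 h3 h4 ht
    have hxt := hx.tendsto_at ht
    refine Tendsto.sub ?_ ((hΦ.continuous_gradient.tendsto _).comp hxt)
    have h5 := h1.1 (x t, v t) ⟨hb.mem t ht, h2⟩
    exact h5.tendsto.comp (tendsto_nhdsWithin_iff.2 ⟨hxt.prodMk_nhds h4,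
      Eventually.of_forall fun j => ⟨(h.curve j).mem t ht, h3 j⟩⟩)
  have hmeas : ∀ {y : ℝ → E n} {w : ℝ → E m}, w ∈ controls T U →
      AbsolutelyContinuousOnInterval y 0 T → (∀ t ∈ Icc 0 T, y t ∈ sweepingSet ψ) →
      AEStronglyMeasurable (fun t => fExt f Φ t (y t) (w t)) (timeMeasure T) := by
    intro y w hw hy hyC
    exact ((boundedField_of_control hf hΦ hw).aemeasurable_comp hMK
      (aemeasurable_of_absCont hT.le hy) hyC).aestronglyMeasurable
  have hbd : ∀ {y : ℝ → E n} {w : ℝ → E m}, w ∈ controls T U →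
      (∀ t ∈ Icc 0 T, y t ∈ sweepingSet ψ) →
      ∀ᵐ t ∂timeMeasure T, ‖fExt f Φ t (y t) (w t)‖ ≤ M + K := by
    intro y w hw hyC
    filter_upwards [(boundedField_of_control hf hΦ hw).bound, ae_mem_timeMeasure T] with t ht htT
    exact ht _ (hyC t htT)
  have h0T : (0 : ℝ) ∈ Icc 0 T := left_mem_Icc.2 hT.le
  have heq := h.hasDerivAt_limit D hT.le hMK hx hξ
    (G := fun t => fExt f Φ t (x t) (v t))
    ((integrable_const (M + K)).mono' (hmeas hv hb.inW12.1 hb.mem) (hbd hv hb.mem)) fun t ht => by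
      simp only [intervalIntegral_eq_indicator _ ht]
      refine tendsto_integral_of_dominated_convergence (fun _ => M + K)
        (fun j => (hmeas (hu j) (h.curve j).absCont (h.curve j).mem).indicator measurableSet_Icc)
        (integrable_const _) (fun j => ?_) ?_
      · filter_upwards [hbd (hu j) (h.curve j).mem] with s hs
        exact (norm_indicator_le_norm_self _ _).trans hs
      · filter_upwards [hpt] with s hs
        by_cases hst : s ∈ Icc 0 t
        · simpa only [indicator_of_mem hst] using hs
        · simp only [indicator_of_notMem hst, tendsto_const_nhds]
  refine isLimitTriplet_of_hasDerivAt D hT hdom hΦ hf hv hx₀ hb.inW12.1 ?_ hb.mem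
    (fun i => h.ae_multiplier_limit D hT.le hx (hξ i)) heq
  exact tendsto_nhds_unique (hx.tendsto_at h0T) h.initial

end Limit

end

/-! ### Measurable selections -/

section Selection

open scoped ENNReal

/-- Continuous images of the Baire space are approximated in measure by the images of compact
boxes `{z | ∀ i, z i ≤ b i}`. -/
theorem exists_measure_range_le {μ : Measure ℝ} [IsFiniteMeasure μ] {p : (ℕ → ℕ) → ℝ}
    (hp : Continuous p) {ε : ℝ≥0∞} (hε : ε ≠ 0) :
    ∃ b : ℕ → ℕ, μ (range p) ≤ μ (p '' {z | ∀ i, z i ≤ b i}) + ε := by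
  obtain ⟨e, he0, he⟩ := ENNReal.exists_pos_sum_of_countable' hε ℕ
  -- bounding one more coordinate loses an arbitrarily small part of the outer measure
  have hstep : ∀ (k : ℕ) (B : Set (ℕ → ℕ)), ∃ N : ℕ, μ (p '' B) ≤ μ (p '' (B ∩ {z | z k ≤ N})) + e k := by
    intro k B
    have hmono : Monotone fun N : ℕ => p '' (B ∩ {z | z k ≤ N}) := fun N N' hN =>
      image_mono (inter_subset_inter_right _ fun z (hz : z k ≤ N) => hz.trans hN)
    have hU : ⋃ N : ℕ, p '' (B ∩ {z | z k ≤ N}) = p '' B := by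
      rw [← image_iUnion, ← inter_iUnion]
      congr 1
      exact inter_eq_left.2 fun z _ => mem_iUnion.2 ⟨z k, le_refl (z k)⟩
    have h1 := (tendsto_measure_iUnion_atTop (μ := μ) hmono).add_const (e k)
    rw [hU] at h1
    have h2 : μ (p '' B) < μ (p '' B) + e k :=
      ENNReal.lt_add_right (measure_ne_top _ _) (he0 k).ne'
    obtain ⟨N, hN⟩ := (h1.eventually (lt_mem_nhds h2)).exists
    exact ⟨N, hN.le⟩
  choose N hN using hstep
  set B : ℕ → Set (ℕ → ℕ) := fun k => Nat.rec univ (fun k B => B ∩ {z | z k ≤ N k B}) k with hB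
  have hB0 : B 0 = univ := rfl
  have hBs : ∀ k, B (k + 1) = B k ∩ {z | z k ≤ N k (B k)} := fun k => rfl
  set b : ℕ → ℕ := fun k => N k (B k) with hb
  have hBmem : ∀ k, ∀ z ∈ B k, ∀ i < k, z i ≤ b i := by
    intro k
    induction k with
    | zero => intro z _ i hi; omega
    | succ k ih =>
      intro z hz i hi
      rw [hBs] at hz
      rcases Nat.lt_succ_iff_lt_or_eq.1 hi with h | rfl
      · exact ih z hz.1 i h
      · exact hz.2
  have hBanti : Antitone B := antitone_nat_of_succ_le fun k => by
    rw [hBs]; exact inter_subset_left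
  have hBle : ∀ k, μ (range p) ≤ μ (p '' B k) + ∑ i ∈ Finset.range k, e i := by
    intro k
    induction k with
    | zero => simp [hB0, image_univ]
    | succ k ih =>
      rw [Finset.sum_range_succ, hBs, add_comm _ (e k), ← add_assoc]
      exact ih.trans (by gcongr; exact hN k (B k))
  have hBε : ∀ k, μ (range p) ≤ μ (closure (p '' B k)) + ε := fun k =>
    (hBle k).trans (add_le_add (measure_mono subset_closure)
      ((ENNReal.sum_le_tsum _).trans he.le))
  have hlim := tendsto_measure_iInter_atTop (μ := μ) (s := fun k => closure (p '' B k))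
    (fun k => isClosed_closure.measurableSet.nullMeasurableSet)
    (fun k l hkl => closure_mono (image_mono (hBanti hkl))) ⟨0, measure_ne_top _ _⟩
  refine ⟨b, (ge_of_tendsto' (hlim.add_const ε) hBε).trans ?_⟩
  gcongr
  -- compactness: a point of all the closures is the image of a point of the box
  intro y hy
  have hy' : ∀ k : ℕ, ∃ z ∈ B k, dist (p z) y < 1 / ((k : ℝ) + 1) := by
    intro k
    obtain ⟨_, ⟨z, hz, rfl⟩, hd⟩ := Metric.mem_closure_iff.1 (mem_iInter.1 hy k)
      (1 / ((k : ℝ) + 1)) (by positivity)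
    exact ⟨z, hz, by rwa [dist_comm]⟩
  choose z hz hzd using hy'
  set Q : Set (ℕ → ℕ) := univ.pi fun i => Iic (b i + ∑ k ∈ Finset.range (i + 1), z k i) with hQ
  have hQc : IsCompact Q := isCompact_univ_pi fun i => (finite_Iic _).isCompact
  have hzQ : ∀ k, z k ∈ Q := by
    intro k i _
    rw [mem_Iic]
    by_cases hik : i < k
    · exact (hBmem k _ (hz k) i hik).trans (Nat.le_add_right _ _)
    · exact (Finset.single_le_sum (f := fun k => z k i) (fun _ _ => Nat.zero_le _)
        (Finset.mem_range.2 (by omega))).trans (Nat.le_add_left _ _)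
  obtain ⟨z₀, -, s, hs, hs0⟩ := hQc.tendsto_subseq hzQ
  have hpz : Tendsto (fun k => p (z k)) atTop (𝓝 y) :=
    tendsto_iff_dist_tendsto_zero.2 (squeeze_zero (fun _ => dist_nonneg) (fun k => (hzd k).le)
      tendsto_one_div_add_atTop_nhds_zero_nat)
  refine ⟨z₀, fun i => ?_, tendsto_nhds_unique ((hp.tendsto z₀).comp hs0)
    (hpz.comp hs.tendsto_atTop)⟩
  refine le_of_tendsto ((continuous_apply i).tendsto z₀ |>.comp hs0) ?_
  filter_upwards [hs.tendsto_atTop.eventually_gt_atTop i] with k hk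
  exact hBmem _ _ (hz (s k)) i hk

/-- A continuous injection of the Baire space into `ℝ`. -/
theorem exists_continuous_injective : ∃ θ : (ℕ → ℕ) → ℝ, Continuous θ ∧ Function.Injective θ := by
  set ι : (ℕ → ℕ) → ℕ → Bool := fun z q => decide (z q.unpair.1 = q.unpair.2) with hι
  have hιc : Continuous ι := by
    refine continuous_pi fun q => ?_
    exact (continuous_of_discreteTopology (f := fun a : ℕ => decide (a = q.unpair.2))).comp
      (continuous_apply _)
  have hιi : Function.Injective ι := by
    intro z z' h
    funext i
    have := congrFun h (Nat.pair i (z i))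
    simp only [hι, Nat.unpair_pair, decide_true] at this
    exact (of_decide_eq_true this.symm).symm
  refine ⟨fun z => Cardinal.cantorFunction (1 / 3) (ι z), ?_,
    (Cardinal.cantorFunction_injective (by norm_num) (by norm_num)).comp hιi⟩
  unfold Cardinal.cantorFunction
  refine continuous_tsum (u := fun q : ℕ => (1 / 3 : ℝ) ^ q) (fun q => ?_)
    (summable_geometric_of_lt_one (by norm_num) (by norm_num)) fun q z => ?_
  · exact (continuous_of_discreteTopology (f := fun a : Bool => cond a ((1 / 3 : ℝ) ^ q) 0)).comp
      ((continuous_apply q).comp hιc)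
  · rw [Cardinal.cantorFunctionAux]
    cases ι z q
    · simp
    · simp

variable {m : ℕ}

/-- Over the projection of a compact piece of an analytic set there is a Borel selection, given by
the fibrewise minimum of an injective continuous function. -/
theorem exists_measurable_selection_compact {g : (ℕ → ℕ) → ℝ × E m} (hg : Continuous g)
    {K : Set (ℕ → ℕ)} (hK : IsCompact K) :
    ∃ σ : ℝ → E m, Measurable σ ∧ ∀ t ∈ (fun z => (g z).1) '' K, (t, σ t) ∈ range g := by
  obtain ⟨θ, hθ, hθi⟩ := exists_continuous_injective
  have hemb : MeasurableEmbedding θ := hθ.measurableEmbedding hθi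
  obtain ⟨G, hG, hGθ⟩ := hemb.exists_measurable_extend (g := fun z => (g z).2)
    (measurable_snd.comp hg.measurable) fun _ => ⟨0⟩
  have hp : Continuous fun z => (g z).1 := continuous_fst.comp hg
  set τ : ℝ → ℝ := fun t => sInf (θ '' (K ∩ {z | (g z).1 = t})) with hτ
  have hfib : ∀ t, IsCompact (K ∩ {z | (g z).1 = t}) := fun t =>
    hK.inter_right (isClosed_eq hp continuous_const)
  have hatt : ∀ t ∈ (fun z => (g z).1) '' K, ∃ z ∈ K, (g z).1 = t ∧ θ z = τ t ∧
      ∀ z' ∈ K, (g z').1 = t → τ t ≤ θ z' := by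
    rintro t ⟨z₀, hz₀, hz₀t⟩
    have hc := (hfib t).image hθ
    obtain ⟨z, ⟨hzK, hzt⟩, hz⟩ := hc.sInf_mem ⟨_, mem_image_of_mem θ ⟨hz₀, hz₀t⟩⟩
    exact ⟨z, hzK, hzt, hz, fun z' hz' ht' => csInf_le hc.bddBelow (mem_image_of_mem θ ⟨hz', ht'⟩)⟩
  have hτm : Measurable τ := by
    refine measurable_of_Iic fun c => ?_
    have hP : IsCompact ((fun z => (g z).1) '' K) := hK.image hp
    have h1 : IsCompact ((fun z => (g z).1) '' (K ∩ {z | θ z ≤ c})) :=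
      (hK.inter_right (isClosed_le hθ continuous_const)).image hp
    have h2 : τ ⁻¹' Iic c = (fun z => (g z).1) '' (K ∩ {z | θ z ≤ c}) ∪
        (((fun z => (g z).1) '' K)ᶜ ∩ {_t | 0 ≤ c}) := by
      ext t
      by_cases ht : t ∈ (fun z => (g z).1) '' K
      · obtain ⟨z, hzK, hzt, hz, hmin⟩ := hatt t ht
        constructor
        · intro h
          exact Or.inl ⟨z, ⟨hzK, hz.le.trans h⟩, hzt⟩
        · rintro (⟨z', ⟨hz'K, hz'c⟩, hz't⟩ | h)
          · exact (hmin z' hz'K hz't).trans hz'c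
          · exact absurd ht h.1
      · have hemp : K ∩ {z | (g z).1 = t} = ∅ :=
          eq_empty_of_forall_notMem fun z hz => ht ⟨z, hz.1, hz.2⟩
        have h0 : τ t = 0 := by simp only [hτ, hemp, image_empty, Real.sInf_empty]
        constructor
        · intro h
          exact Or.inr ⟨ht, h0 ▸ h⟩
        · rintro (⟨z', ⟨hz'K, _⟩, hz't⟩ | h)
          · exact absurd ⟨z', hz'K, hz't⟩ ht
          · change τ t ≤ c
            rw [h0]; exact h.2
    rw [h2]
    exact h1.isClosed.measurableSet.union (hP.isClosed.measurableSet.compl.inter (.const _))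
  refine ⟨fun t => G (τ t), hG.comp hτm, fun t ht => ?_⟩
  obtain ⟨z, -, hzt, hz, -⟩ := hatt t ht
  refine ⟨z, Prod.ext hzt ?_⟩
  change (g z).2 = G (τ t)
  rw [← hz]
  exact (congrFun hGθ z).symm

/-- Aumann's measurable selection theorem: a Borel set has a Borel selection over a Borel set that
is almost all of its projection. -/
theorem exists_measurable_selection (μ : Measure ℝ) [IsFiniteMeasure μ] {S : Set (ℝ × E m)}
    (hS : MeasurableSet S) :
    ∃ (P : Set ℝ) (σ : ℝ → E m), MeasurableSet P ∧ Measurable σ ∧ (∀ t ∈ P, (t, σ t) ∈ S) ∧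
      ∀ᵐ t ∂μ, (∃ a, (t, a) ∈ S) → t ∈ P := by
  have hA := hS.analyticSet
  rw [AnalyticSet] at hA
  rcases hA with rfl | ⟨g, hg, rfl⟩
  · exact ⟨∅, fun _ => 0, .empty, measurable_const, by simp, by simp⟩
  have hp : Continuous fun z => (g z).1 := continuous_fst.comp hg
  have hb : ∀ k : ℕ, ∃ b : ℕ → ℕ, μ (range fun z => (g z).1)
      ≤ μ ((fun z => (g z).1) '' {z | ∀ i, z i ≤ b i}) + ((k : ℝ≥0∞) + 1)⁻¹ := fun k =>
    exists_measure_range_le hp (by simp)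
  choose b hb using hb
  have hbox : ∀ k, IsCompact {z : ℕ → ℕ | ∀ i, z i ≤ b k i} := by
    intro k
    have : {z : ℕ → ℕ | ∀ i, z i ≤ b k i} = univ.pi fun i => Iic (b k i) := by
      ext z; simp [Pi.le_def]
    rw [this]
    exact isCompact_univ_pi fun i => (finite_Iic _).isCompact
  choose σ hσ hσS using fun k => exists_measurable_selection_compact hg (hbox k)
  set Q : ℕ → Set ℝ := fun k => (fun z => (g z).1) '' {z | ∀ i, z i ≤ b k i} with hQ
  have hQm : ∀ k, MeasurableSet (Q k) := fun k => ((hbox k).image hp).isClosed.measurableSet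
  obtain ⟨σ', hσ', heq⟩ := exists_measurable_piecewise (disjointed Q)
    (fun k => MeasurableSet.disjointed hQm k) σ hσ fun i j hij t ht =>
      absurd ht.2 (disjoint_left.1 (disjoint_disjointed Q hij) ht.1)
  refine ⟨⋃ k, Q k, σ', .iUnion hQm, hσ', fun t ht => ?_, ?_⟩
  · rw [← iUnion_disjointed] at ht
    obtain ⟨k, hk⟩ := mem_iUnion.1 ht
    rw [heq k hk]
    exact hσS k t (disjointed_subset Q k hk)
  · have hsub : ⋃ k, Q k ⊆ range fun z => (g z).1 := iUnion_subset fun k => image_subset_range _ _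
    have hle : μ (range fun z => (g z).1) ≤ μ (⋃ k, Q k) := by
      have hlim : Tendsto (fun k : ℕ => μ (⋃ k, Q k) + ((k : ℝ≥0∞) + 1)⁻¹) atTop
          (𝓝 (μ (⋃ k, Q k) + 0)) := by
        refine tendsto_const_nhds.add ?_
        have := (tendsto_add_atTop_iff_nat 1).2 ENNReal.tendsto_inv_nat_nhds_zero
        simpa only [Nat.cast_add, Nat.cast_one] using this
      rw [add_zero] at hlim
      exact ge_of_tendsto' hlim fun k => (hb k).trans
        (add_le_add_left (measure_mono (subset_iUnion Q k)) _)
    have hzero : μ ((range fun z => (g z).1) \ ⋃ k, Q k) = 0 := by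
      have h1 := measure_inter_add_sdiff (μ := μ) (range fun z => (g z).1)
        (MeasurableSet.iUnion hQm)
      rw [inter_eq_right.2 hsub] at h1
      have h2 : μ (⋃ k, Q k) + μ ((range fun z => (g z).1) \ ⋃ k, Q k) ≤ μ (⋃ k, Q k) + 0 := by
        rw [h1, add_zero]; exact hle
      exact le_antisymm ((ENNReal.add_le_add_iff_left (measure_ne_top _ _)).1 h2) zero_le
    rw [ae_iff]
    refine measure_mono_null (fun t ht => ?_) hzero
    simp only [mem_ofPred_eq, Classical.not_imp] at ht
    obtain ⟨⟨a, z, hz⟩, hn⟩ := ht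
    exact ⟨⟨z, congrArg Prod.fst hz⟩, hn⟩

/-- Sets in the product of the Lebesgue and the Borel σ-algebras are Borel up to a null set of
parameters. -/
theorem exists_measurableSet_ae_iff {S : Set (ℝ × E m)}
    (hS : MeasurableSet[lebesgueSigma.prod (borel (E m))] S) :
    ∃ S' : Set (ℝ × E m), MeasurableSet S' ∧ ∀ᵐ t : ℝ, ∀ a, (t, a) ∈ S ↔ (t, a) ∈ S' := by
  let 𝓜 : MeasurableSpace (ℝ × E m) :=
    { MeasurableSet' := fun S => ∃ S' : Set (ℝ × E m), MeasurableSet S' ∧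
        ∀ᵐ t : ℝ, ∀ a, (t, a) ∈ S ↔ (t, a) ∈ S'
      measurableSet_empty := ⟨∅, .empty, by simp⟩
      measurableSet_compl := by
        rintro S ⟨S', hS', h⟩
        refine ⟨S'ᶜ, hS'.compl, ?_⟩
        filter_upwards [h] with t ht a
        rw [mem_compl_iff, mem_compl_iff, ht a]
      measurableSet_iUnion := by
        intro S hS
        choose S' hS' h using hS
        refine ⟨⋃ i, S' i, .iUnion hS', ?_⟩
        filter_upwards [ae_all_iff.2 h] with t ht a
        simp only [mem_iUnion, ht] }
  have hle : lebesgueSigma.prod (borel (E m)) ≤ 𝓜 := by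
    refine sup_le ?_ ?_
    · rintro _ ⟨A, hA, rfl⟩
      obtain ⟨B, -, hB, hAB⟩ := NullMeasurableSet.exists_measurable_superset_ae_eq
        (show NullMeasurableSet A volume from hA)
      refine ⟨Prod.fst ⁻¹' B, measurable_fst hB, ?_⟩
      filter_upwards [hAB.mem_iff] with t ht a
      exact ht.symm
    · rintro _ ⟨A, hA, rfl⟩
      rw [← BorelSpace.measurable_eq (α := E m)] at hA
      exact ⟨Prod.snd ⁻¹' A, measurable_snd hA, by simp⟩
  exact hle S hS

end Selection

section

variable {n m r : ℕ} {ψ : Fin r → E n → ℝ} {ρ η Mψ T : ℝ}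

section Filippov

variable {U : ℝ → Set (E m)}

/-- Castaing representation: countably many controls are dense in the control sets. -/
theorem exists_dense_controls
    (hU : MeasurableSet[lebesgueSigma.prod (borel (E m))]
      {p : ℝ × E m | p.1 ∈ Icc 0 T ∧ p.2 ∈ U p.1}) {u₀ : ℝ → E m} (hu₀ : u₀ ∈ controls T U) :
    ∃ V : ℕ → ℝ → E m, (∀ j, V j ∈ controls T U) ∧
      ∀ᵐ t ∂timeMeasure T, ∀ a ∈ U t, ∀ ε > 0, ∃ j, dist (V j t) a < ε := by
  obtain ⟨S, hS, hSU⟩ := exists_measurableSet_ae_iff hU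
  have hSU' : ∀ᵐ t ∂timeMeasure T, ∀ a, a ∈ U t ↔ (t, a) ∈ S := by
    filter_upwards [ae_restrict_of_ae hSU, ae_mem_timeMeasure T] with t ht htT a
    rw [← ht a]
    exact ⟨fun h => ⟨htT, h⟩, fun h => h.2⟩
  set q : ℕ → E m := TopologicalSpace.denseSeq (E m) with hq
  set δ : ℕ → ℝ := fun k => 1 / ((k : ℝ) + 1) with hδ
  have hδ0 : ∀ k, 0 < δ k := fun k => by positivity
  -- selections of the intersections with the balls of a countable base
  have hsel : ∀ j : ℕ, ∃ (P : Set ℝ) (σ : ℝ → E m), MeasurableSet P ∧ Measurable σ ∧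
      (∀ t ∈ P, (t, σ t) ∈ S ∩ univ ×ˢ Metric.ball (q j.unpair.1) (δ j.unpair.2)) ∧
      ∀ᵐ t ∂timeMeasure T,
        (∃ a, (t, a) ∈ S ∩ univ ×ˢ Metric.ball (q j.unpair.1) (δ j.unpair.2)) → t ∈ P := fun j =>
    exists_measurable_selection (timeMeasure T) (hS.inter (MeasurableSet.univ.prod measurableSet_ball))
  choose P σ hP hσ hPσ hae using hsel
  classical
  refine ⟨fun j => (P j).piecewise (σ j) (hu₀.1.mk u₀), fun j => ⟨?_, ?_⟩, ?_⟩
  · exact (Measurable.piecewise (hP j) (hσ j) hu₀.1.measurable_mk).aemeasurable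
  · filter_upwards [hSU', hu₀.2, hu₀.1.ae_eq_mk] with t h1 h2 h3
    by_cases ht : t ∈ P j
    · rw [piecewise_eq_of_mem _ _ _ ht]
      exact (h1 _).2 (hPσ j t ht).1
    · rw [piecewise_eq_of_notMem _ _ _ ht, ← h3]
      exact h2
  · filter_upwards [hSU', ae_all_iff.2 hae] with t h1 h2 a ha ε hε
    obtain ⟨k, hk⟩ := exists_nat_one_div_lt (half_pos hε)
    obtain ⟨i, hi⟩ := (TopologicalSpace.denseRange_denseSeq (E m)).exists_dist_lt a (hδ0 k)
    have hball : ∀ b, (t, b) ∈ S ∩ univ ×ˢ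
        Metric.ball (q (Nat.pair i k).unpair.1) (δ (Nat.pair i k).unpair.2) ↔
        (t, b) ∈ S ∧ dist b (q i) < δ k := by
      intro b
      simp only [Nat.unpair_pair, mem_inter_iff, mem_prod, mem_univ, true_and, Metric.mem_ball]
    have htP : t ∈ P (Nat.pair i k) := h2 _ ⟨a, (hball a).2 ⟨(h1 a).1 ha, hi⟩⟩
    refine ⟨Nat.pair i k, ?_⟩
    rw [piecewise_eq_of_mem _ _ _ htP]
    have h3 := ((hball _).1 (hPσ _ t htP)).2
    have h4 := dist_triangle_right (σ (Nat.pair i k) t) a (q i)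
    have h5 : δ k < ε / 2 := hk
    have h6 : dist a (q i) < δ k := hi
    linarith

/-- Filippov's selection lemma: a measurable selection of the velocity sets is realized by a
control. -/
theorem exists_control_eq
    (hU : MeasurableSet[lebesgueSigma.prod (borel (E m))]
      {p : ℝ × E m | p.1 ∈ Icc 0 T ∧ p.2 ∈ U p.1}) {u₀ : ℝ → E m} (hu₀ : u₀ ∈ controls T U)
    {F : ℝ → E m → E n} (hF : ∀ᵐ t ∂timeMeasure T, ContinuousOn (F t) (U t))
    (hFm : ∀ u ∈ controls T U, AEMeasurable (fun t => F t (u t)) (timeMeasure T))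
    {w : ℝ → E n} (hw : AEMeasurable w (timeMeasure T))
    (hwF : ∀ᵐ t ∂timeMeasure T, w t ∈ F t '' U t) :
    ∃ v ∈ controls T U, ∀ᵐ t ∂timeMeasure T, F t (v t) = w t := by
  classical
  obtain ⟨V, hV, hVd⟩ := exists_dense_controls hU hu₀
  obtain ⟨S, hS, hSU⟩ := exists_measurableSet_ae_iff hU
  have hSU' : ∀ᵐ t ∂timeMeasure T, ∀ a, a ∈ U t ↔ (t, a) ∈ S := by
    filter_upwards [ae_restrict_of_ae hSU, ae_mem_timeMeasure T] with t ht htT a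
    rw [← ht a]
    exact ⟨fun h => ⟨htT, h⟩, fun h => h.2⟩
  set V' : ℕ → ℝ → E m := fun j => (hV j).1.mk (V j) with hV'
  set F' : ℕ → ℝ → E n := fun j => (hFm _ (hV j)).mk _ with hF'
  set w' : ℝ → E n := hw.mk w with hw'
  -- by continuity, `F t a = w t` is expressed through the dense controls
  set R : Set (ℝ × E m) := S ∩ ⋂ k : ℕ, ⋃ j : ℕ, {p | dist (V' j p.1) p.2 < 1 / ((k : ℝ) + 1)} ∩
    {p | dist (F' j p.1) (w' p.1) < 1 / ((k : ℝ) + 1)} with hR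
  have hRm : MeasurableSet R := by
    refine hS.inter (.iInter fun k => .iUnion fun j => ?_)
    refine (measurableSet_lt ?_ measurable_const).inter (measurableSet_lt ?_ measurable_const)
    · exact ((hV j).1.measurable_mk.comp measurable_fst).dist measurable_snd
    · exact ((hFm _ (hV j)).measurable_mk.comp measurable_fst).dist
        (hw.measurable_mk.comp measurable_fst)
  obtain ⟨P, σ, hP, hσ, hPσ, hae⟩ := exists_measurable_selection (timeMeasure T) hRm
  have hall : ∀ᵐ t ∂timeMeasure T, (P.piecewise σ (hu₀.1.mk u₀)) t ∈ U t ∧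
      F t ((P.piecewise σ (hu₀.1.mk u₀)) t) = w t := by
    filter_upwards [hSU', hVd, hF, hwF, hae, hw.ae_eq_mk,
      ae_all_iff.2 fun j => (hV j).1.ae_eq_mk, ae_all_iff.2 fun j => (hFm _ (hV j)).ae_eq_mk,
      ae_all_iff.2 fun j => (hV j).2]
      with t h1 h2 h3 h4 h5 h6 h7 h8 h9
    have htP : t ∈ P := by
      obtain ⟨a, ha, haw⟩ := h4
      refine h5 ⟨a, (h1 a).1 ha, mem_iInter.2 fun k => ?_⟩
      have hε : (0 : ℝ) < 1 / ((k : ℝ) + 1) := by positivity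
      obtain ⟨d, hd, hdd⟩ := Metric.continuousWithinAt_iff.1 (h3 a ha) _ hε
      obtain ⟨j, hj⟩ := h2 a ha (min d (1 / ((k : ℝ) + 1))) (lt_min hd hε)
      refine mem_iUnion.2 ⟨j, ?_, ?_⟩
      · change dist ((hV j).1.mk (V j) t) a < _
        rw [← h7 j]
        exact hj.trans_le (min_le_right _ _)
      · change dist ((hFm _ (hV j)).mk _ t) (hw.mk w t) < _
        rw [← h8 j, ← h6, ← haw]
        exact hdd (h9 j) (hj.trans_le (min_le_left _ _))
    rw [piecewise_eq_of_mem _ _ _ htP]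
    obtain ⟨hσS, hσR⟩ := hPσ t htP
    have hσU := (h1 _).2 hσS
    refine ⟨hσU, ?_⟩
    refine eq_of_forall_dist_le fun ε hε => ?_
    obtain ⟨d, hd, hdd⟩ := Metric.continuousWithinAt_iff.1 (h3 _ hσU) _ (half_pos hε)
    obtain ⟨k, hk⟩ := exists_nat_one_div_lt (lt_min hd (half_pos hε))
    obtain ⟨j, hj1, hj2⟩ := mem_iUnion.1 (mem_iInter.1 hσR k)
    change dist ((hV j).1.mk (V j) t) (σ t) < _ at hj1
    change dist ((hFm _ (hV j)).mk _ t) (hw.mk w t) < _ at hj2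
    rw [← h7 j] at hj1
    rw [← h8 j, ← h6] at hj2
    have h10 := hdd (h9 j) (hj1.trans (hk.trans_le (min_le_left _ _)))
    have h11 := hj2.trans (hk.trans_le (min_le_right _ _))
    have h12 := dist_triangle_left (F t (σ t)) (w t) (F t (V j t))
    linarith
  refine ⟨P.piecewise σ (hu₀.1.mk u₀), ⟨?_, hall.mono fun t ht => ht.1⟩,
    hall.mono fun t ht => ht.2⟩
  exact (Measurable.piecewise hP hσ hu₀.1.measurable_mk).aemeasurable

end Filippov

/-! ### Convex velocity sets -/

/-- Weak limits stay in closed convex sets, since the set of `L²` selections is closed and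
convex, hence weakly closed. -/
theorem WeakL2Tendsto.ae_mem {H : Type*} [NormedAddCommGroup H] [InnerProductSpace ℝ H]
    [CompleteSpace H] {v : ℕ → ℝ → H} {w : ℝ → H} (h : WeakL2Tendsto T v w) {F : ℝ → Set H}
    (hF : ∀ᵐ t ∂timeMeasure T, IsClosed (F t) ∧ Convex ℝ (F t))
    (hv : ∀ j, ∀ᵐ t ∂timeMeasure T, v j t ∈ F t) : ∀ᵐ t ∂timeMeasure T, w t ∈ F t := by
  set S : Set (Lp H 2 (timeMeasure T)) := {g | ∀ᵐ t ∂timeMeasure T, g t ∈ F t} with hS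
  have hconv : Convex ℝ S := by
    intro g hg g' hg' a b ha hb hab
    filter_upwards [hF, hg, hg', Lp.coeFn_add (a • g) (b • g'), Lp.coeFn_smul a g,
      Lp.coeFn_smul b g'] with t h1 h2 h3 h4 h5 h6
    rw [h4, Pi.add_apply, h5, h6]
    exact h1.2 h2 h3 ha hb hab
  have hclosed : IsClosed S := by
    refine IsSeqClosed.isClosed fun g g₀ hg hlim => ?_
    obtain ⟨s, -, hs⟩ := (tendstoInMeasure_of_tendsto_Lp hlim).exists_seq_tendsto_ae
    filter_upwards [hF, hs, ae_all_iff.2 hg] with t h1 h2 h3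
    exact h1.1.mem_of_tendsto h2 (Eventually.of_forall fun k => h3 (s k))
  have hvS : ∀ j, (h.1 j).toLp (v j) ∈ S := by
    intro j
    filter_upwards [(h.1 j).coeFn_toLp, hv j] with t h1 h2
    rw [h1]; exact h2
  suffices hw : h.2.1.toLp w ∈ S by
    filter_upwards [hw, h.2.1.coeFn_toLp] with t h1 h2
    rwa [h2] at h1
  by_contra hw
  obtain ⟨ℓ, c, h1, h2⟩ := geometric_hahn_banach_point_closed hconv hclosed hw
  set y := (InnerProductSpace.toDual ℝ (Lp H 2 (timeMeasure T))).symm ℓ with hy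
  have hℓ : ∀ (u : ℝ → H) (hu : MemLp u 2 (timeMeasure T)),
      ℓ (hu.toLp u) = ∫ t, inner ℝ (y t) (u t) ∂timeMeasure T := by
    intro u hu
    rw [← inner_toLp (Lp.memLp y) hu, Lp.toLp_coeFn, hy, InnerProductSpace.toDual_symm_apply]
  have hlim := h.2.2 y (Lp.memLp y)
  have h3 : c ≤ ∫ t, inner ℝ (y t) (w t) ∂timeMeasure T := by
    refine ge_of_tendsto' hlim fun j => ?_
    rw [← hℓ _ (h.1 j)]
    exact (h2 _ (hvS j)).le
  rw [← hℓ _ h.2.1] at h3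
  exact absurd h1 (not_lt.2 h3)

section Limit

variable {f : ℝ → E n → E m → E n} {U : ℝ → Set (E m)} {φ : E n → EReal} {Φ : E n → ℝ}
  {M K : ℝ} {C₀ : Set (E n)} {x₀ : E n} {x : ℝ → E n} {ξ : Fin r → ℝ → ℝ}
  {γ : ℕ → ℝ} {X : ℕ → ℝ → E n} {u : ℕ → ℝ → E m}

/-- The limit for convex velocity sets: the weak limit of the velocities `f_Φ(t, x, u_j)` is
realized by a control. -/
theorem exists_control_isLimitTriplet (D : ConstraintData ψ ρ η Mψ) (hT : 0 < T)
    (hdom : {x | φ x < ⊤} = sweepingSet ψ) (hΦ : IsExtension (sweepingSet ψ) φ Φ K)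
    (hf : RegularDynamics T (sweepingSet ψ) U f M) (hx₀ : x₀ ∈ C₀)
    (h : PenalizedSequence T ψ (M + K) (fun j t y => fExt f Φ t y (u j t)) γ X x₀)
    (hu : ∀ j, u j ∈ controls T U) (hx : TendstoUniformlyOn X x atTop (Icc 0 T))
    (hξ : ∀ i, WeakL2Tendsto T (fun j => multiplier ψ (γ j) (X j) i) (ξ i))
    (hU : RegularControlSets T U)
    (hconv : ∀ᵐ t ∂timeMeasure T, ∀ y ∈ sweepingSet ψ, Convex ℝ (f t y '' U t)) :
    ∃ v ∈ controls T U, IsUniqueSweepingSolution T f φ C₀ x₀ v x ∧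
      IsLimitTriplet T f Φ ψ (M + K) η Mψ x v ξ := by
  have hMK : 0 ≤ M + K := (add_pos hf.pos hΦ.pos).le
  have hb := h.hasStateBounds D hT.le hx
  have h0T : (0 : ℝ) ∈ Icc 0 T := left_mem_Icc.2 hT.le
  have hfield : ∀ w ∈ controls T U,
      BoundedField T (sweepingSet ψ) (fun t y => fExt f Φ t y (w t)) (M + K) := fun w hw =>
    boundedField_of_control hf hΦ hw
  have hmeas : ∀ {y : ℝ → E n} {w : ℝ → E m}, w ∈ controls T U →
      AbsolutelyContinuousOnInterval y 0 T → (∀ t ∈ Icc 0 T, y t ∈ sweepingSet ψ) →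
      AEMeasurable (fun t => fExt f Φ t (y t) (w t)) (timeMeasure T) := by
    intro y w hw hy hyC
    exact (hfield w hw).aemeasurable_comp hMK (aemeasurable_of_absCont hT.le hy) hyC
  have hbd : ∀ {y : ℝ → E n} {w : ℝ → E m}, w ∈ controls T U →
      (∀ t ∈ Icc 0 T, y t ∈ sweepingSet ψ) →
      ∀ᵐ t ∂timeMeasure T, ‖fExt f Φ t (y t) (w t)‖ ≤ M + K := by
    intro y w hw hyC
    filter_upwards [(hfield w hw).bound, ae_mem_timeMeasure T] with t ht htT
    exact ht _ (hyC t htT)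
  have hint : ∀ {y : ℝ → E n} {w : ℝ → E m}, w ∈ controls T U →
      AbsolutelyContinuousOnInterval y 0 T → (∀ t ∈ Icc 0 T, y t ∈ sweepingSet ψ) →
      Integrable (fun t => fExt f Φ t (y t) (w t)) (timeMeasure T) := by
    intro y w hw hy hyC
    exact (integrable_const (M + K)).mono' (hmeas hw hy hyC).aestronglyMeasurable (hbd hw hyC)
  set κ : ℕ → ℝ → E n := fun j t => fExt f Φ t (x t) (u j t) with hκ
  have hκL : ∀ j, MemLp (κ j) 2 (timeMeasure T) := fun j =>
    MemLp.of_bound (hmeas (hu j) hb.inW12.1 hb.mem).aestronglyMeasurable (M + K) (hbd (hu j) hb.mem)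
  obtain ⟨s, w, hs, hw⟩ := exists_weakL2Tendsto_subseq hκL (B := ∫ _, (M + K) ^ 2 ∂timeMeasure T)
    fun j => by
      refine integral_mono_ae (hκL j).integrable_norm_pow' (integrable_const _) ?_
      filter_upwards [hbd (hu j) hb.mem] with t ht
      exact pow_le_pow_left₀ (norm_nonneg _) ht 2
  have hcontU : ∀ᵐ t ∂timeMeasure T, ContinuousOn (fun a => fExt f Φ t (x t) a) (U t) := by
    filter_upwards [hf.regular, ae_mem_timeMeasure T] with t ht htT
    refine ContinuousOn.sub ?_ continuousOn_const
    exact ht.1.comp (continuousOn_const.prodMk continuousOn_id) fun a ha => ⟨hb.mem t htT, ha⟩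
  have hwU : ∀ᵐ t ∂timeMeasure T, w t ∈ (fun a => fExt f Φ t (x t) a) '' U t := by
    refine hw.ae_mem ?_ fun j => ?_
    · obtain ⟨-, hUc, R, hR⟩ := hU
      filter_upwards [hcontU, hconv, ae_mem_timeMeasure T] with t h1 h2 ht
      constructor
      · have hUt : IsCompact (U t) := Metric.isCompact_of_isClosed_isBounded (hUc t ht)
          (isBounded_iff_forall_norm_le.2 ⟨R, hR t ht⟩)
        exact (hUt.image_of_continuousOn h1).isClosed
      · have h3 := (h2 _ (hb.mem t ht)).sub (convex_singleton (gradient Φ (x t)))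
        rwa [sub_singleton, image_image] at h3
    · filter_upwards [(hu (s j)).2] with t ht
      exact mem_image_of_mem _ ht
  obtain ⟨v, hv, hvw⟩ := exists_control_eq hU.1 (hu 0) hcontU
    (fun u hu => hmeas hu hb.inW12.1 hb.mem) hw.2.1.aestronglyMeasurable.aemeasurable hwU
  have hx' : TendstoUniformlyOn (fun j => X (s j)) x atTop (Icc 0 T) :=
    fun u hu => hs.tendsto_atTop.eventually (hx u hu)
  have heq := (h.comp hs).hasDerivAt_limit D hT.le hMK hx'
    (fun i => (hξ i).comp hs.tendsto_atTop) (hw.2.1.integrable one_le_two) fun t ht => by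
      -- replacing `X_j` by its limit in the field changes the integrals by `o(1)`
      have h1 : Tendsto (fun j => ∫ τ in (0 : ℝ)..t, (fExt f Φ τ (X (s j) τ) (u (s j) τ)
          - κ (s j) τ)) atTop (𝓝 (∫ τ in (0 : ℝ)..t, (0 : E n))) := by
        simp only [intervalIntegral_eq_indicator _ ht]
        refine tendsto_integral_of_dominated_convergence (fun _ => M + K + (M + K))
          (fun j => ((hmeas (hu _) (h.curve _).absCont (h.curve _).mem).sub
            (hmeas (hu _) hb.inW12.1 hb.mem)).aestronglyMeasurable.indicator measurableSet_Icc)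
          (integrable_const _) (fun j => ?_) ?_
        · filter_upwards [hbd (hu (s j)) (h.curve (s j)).mem, hbd (hu (s j)) hb.mem] with τ h2 h3
          exact (norm_indicator_le_norm_self _ _).trans
            ((norm_sub_le _ _).trans (add_le_add h2 h3))
        · filter_upwards [ae_all_iff.2 fun j => (hfield _ (hu j)).lipschitz,
            ae_mem_timeMeasure T] with τ h2 hτ
          by_cases hτt : τ ∈ Icc 0 t
          · simp only [indicator_of_mem hτt]
            have h3 : Tendsto (fun j => (M + K) * ‖X (s j) τ - x τ‖) atTop (𝓝 0) := by
              have := (tendsto_iff_norm_sub_tendsto_zero.1 (hx'.tendsto_at hτ)).const_mul (M + K)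
              rwa [mul_zero] at this
            exact squeeze_zero_norm (fun j => h2 (s j) _ ((h.curve _).mem τ hτ) _ (hb.mem τ hτ)) h3
          · simp only [indicator_of_notMem hτt, tendsto_const_nhds]
      have h2 := h1.add (hw.tendsto_integral ht)
      rw [intervalIntegral.integral_zero, zero_add] at h2
      refine h2.congr fun j => ?_
      rw [← intervalIntegral.integral_add]
      · simp only [sub_add_cancel]
      · exact intervalIntegrable_of_timeMeasure ((hint (hu _) (h.curve _).absCont
          (h.curve _).mem).sub (hint (hu _) hb.inW12.1 hb.mem)) h0T ht
      · exact intervalIntegrable_of_timeMeasure (hint (hu _) hb.inW12.1 hb.mem) h0T ht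
  refine ⟨v, hv, isLimitTriplet_of_hasDerivAt D hT hdom hΦ hf hv hx₀ hb.inW12.1
    (tendsto_nhds_unique (hx.tendsto_at h0T) h.initial) hb.mem
    (fun i => h.ae_multiplier_limit D hT.le hx (hξ i)) ?_⟩
  filter_upwards [heq, hvw] with t h1 h2
  rwa [h2]

end Limit

end

section

variable {n m r : ℕ} {ψ : Fin r → E n → ℝ} {ρ η Mψ T : ℝ}

/-! ### Initial points and well-posedness -/

theorem innerApproxSet_subset {Mbar γ : ℝ} (hη : 0 < η) (hM : 0 < Mbar) (hγ : 2 * Mbar / η < γ) :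
    innerApproxSet ψ Mbar η γ ⊆ approxSet ψ γ := by
  intro x hx
  have hγ0 : 0 < γ := lt_trans (by positivity) hγ
  refine le_trans (show penaltySum ψ γ x ≤ 2 * Mbar / (η * γ) from hx) ?_
  rw [div_le_one (by positivity)]
  rw [div_lt_iff₀ hη] at hγ
  linarith

/-- Points of `C` are limits of interior points of the sets `C^γ(k)`: move from `x₀` by `γ^(-1/2)`
in a direction pointing strictly inside the active constraints. -/
theorem exists_tendsto_mem_interior_innerApproxSet (D : ConstraintData ψ ρ η Mψ) {Mbar : ℝ}
    (hM : 0 < Mbar) {x₀ : E n} (hx₀ : x₀ ∈ sweepingSet ψ) {γ : ℕ → ℝ} (hγ : Tendsto γ atTop atTop) :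
    ∃ c : ℕ → E n, Tendsto c atTop (𝓝 x₀) ∧
      ∀ᶠ k in atTop, c k ∈ interior (innerApproxSet ψ Mbar η (γ k)) := by
  have hη := D.eta_pos
  obtain ⟨v, -, hv⟩ := D.exists_inward hx₀
  -- along the inward direction all constraints decrease at rate `2η`
  have hdec : ∀ᶠ s : ℝ in 𝓝[>] 0, ∀ i, ψ i (x₀ + s • v) < -(2 * η) * s := by
    rw [eventually_all]
    intro i
    have hline : HasDerivAt (fun s : ℝ => x₀ + s • v) v 0 := by
      simpa using ((hasDerivAt_id (0 : ℝ)).smul_const v).const_add x₀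
    have hder : HasDerivAt (fun s : ℝ => ψ i (x₀ + s • v)) (inner ℝ (gradient (ψ i) x₀) v) 0 := by
      have hd : DifferentiableAt ℝ (ψ i) (x₀ + (0 : ℝ) • v) := by
        simpa using D.differentiableAt i (mem_cthickening hx₀)
      simpa using hasDerivAt_comp_gradient (x := fun s : ℝ => x₀ + s • v) hd hline
    by_cases hi : ψ i x₀ = 0
    · have hslope := (hasDerivAt_iff_tendsto_slope.1 hder).mono_left
        (nhdsWithin_mono 0 fun s (hs : 0 < s) => hs.ne')
      filter_upwards [hslope.eventually_lt_const (hv i hi), self_mem_nhdsWithin] with s h1 h2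
      have hs0 : (0 : ℝ) < s := h2
      rw [slope_def_field, zero_smul, add_zero, hi, sub_zero, sub_zero, div_lt_iff₀ hs0] at h1
      exact h1
    · have hneg : ψ i x₀ < 0 := lt_of_le_of_ne (mem_sweepingSet.1 hx₀ i) hi
      have h1 : Tendsto (fun s : ℝ => ψ i (x₀ + s • v)) (𝓝[>] 0) (𝓝 (ψ i x₀)) := by
        have := hder.continuousAt.tendsto
        rw [zero_smul, add_zero] at this
        exact this.mono_left nhdsWithin_le_nhds
      have h2 : Tendsto (fun s : ℝ => -(2 * η) * s) (𝓝[>] 0) (𝓝 0) := by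
        have := (continuous_const_mul (-(2 * η))).tendsto (0 : ℝ)
        rw [mul_zero] at this
        exact this.mono_left nhdsWithin_le_nhds
      exact h1.eventually_lt h2 hneg
  have hsq : Tendsto (fun k => Real.sqrt (γ k)) atTop atTop := Real.tendsto_sqrt_atTop.comp hγ
  have hs : Tendsto (fun k => (Real.sqrt (γ k))⁻¹) atTop (𝓝[>] 0) :=
    tendsto_inv_atTop_nhdsGT_zero.comp hsq
  refine ⟨fun k => x₀ + (Real.sqrt (γ k))⁻¹ • v, ?_, ?_⟩
  · have := ((hs.mono_right nhdsWithin_le_nhds).smul_const v).const_add x₀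
    simpa using this
  have hexp : Tendsto (fun k => (r : ℝ) * ((2 * η)⁻¹ ^ 2 *
      ((2 * η * Real.sqrt (γ k)) ^ 2 * Real.exp (-(2 * η * Real.sqrt (γ k)))))) atTop (𝓝 0) := by
    have := (((Real.tendsto_pow_mul_exp_neg_atTop_nhds_zero 2).comp
      (hsq.const_mul_atTop (by positivity : 0 < 2 * η))).const_mul ((2 * η)⁻¹ ^ 2)).const_mul (r : ℝ)
    simpa using this
  filter_upwards [hs.eventually hdec, hγ.eventually_gt_atTop 0,
    hexp.eventually_lt_const (show 0 < 2 * Mbar / η by positivity)] with k h1 hγ0 h2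
  set c := x₀ + (Real.sqrt (γ k))⁻¹ • v with hc
  have hsq0 : 0 < Real.sqrt (γ k) := Real.sqrt_pos.2 hγ0
  have hcC : c ∈ sweepingSet ψ := mem_sweepingSet.2 fun i => (h1 i).le.trans (by
    have : 0 ≤ 2 * η * (Real.sqrt (γ k))⁻¹ := by positivity
    linarith)
  have hlt : penaltySum ψ (γ k) c < 2 * Mbar / (η * γ k) := by
    have h3 : penaltySum ψ (γ k) c ≤ r * Real.exp (-(2 * η * Real.sqrt (γ k))) := by
      have h4 : ∀ i ∈ Finset.univ, Real.exp (γ k * ψ i c)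
          ≤ Real.exp (-(2 * η * Real.sqrt (γ k))) := by
        intro i _
        refine Real.exp_le_exp.2 ?_
        have h5 := mul_le_mul_of_nonneg_left (h1 i).le hγ0.le
        refine h5.trans (le_of_eq ?_)
        nth_rewrite 1 [← Real.mul_self_sqrt hγ0.le]
        field_simp
      refine (Finset.sum_le_sum h4).trans (le_of_eq ?_)
      simp
    refine h3.trans_lt ?_
    rw [mul_pow, Real.sq_sqrt hγ0.le] at h2
    rw [← div_div, lt_div_iff₀ hγ0]
    refine lt_of_eq_of_lt ?_ h2
    field_simp
  have hcont : ContinuousAt (penaltySum ψ (γ k)) c := by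
    unfold penaltySum
    exact tendsto_finsetSum _ fun i _ => (continuousAt_const.mul (D.continuousAt hcC)).rexp
  rw [mem_interior_iff_mem_nhds]
  filter_upwards [hcont.eventually_lt_const hlt] with y hy
  exact hy.le

section Assembly

variable {f : ℝ → E n → E m → E n} {U : ℝ → Set (E m)} {φ : E n → EReal} {Φ : E n → ℝ}
  {M K : ℝ} {C₀ : Set (E n)} {x₀ c : E n} {x : ℝ → E n} {v : ℝ → E m}

theorem IsPenalizedSolution.penalizedCurve {γ : ℝ} (h : IsPenalizedSolution T f Φ ψ γ c v x) :
    PenalizedCurve T (fun t y => fExt f Φ t y (v t)) ψ γ x :=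
  ⟨h.absCont, h.mem, h.equation⟩

/-- For large `γ` the penalized equation has a unique solution, of class `W^{1,2}` and with values
in `C^γ`. -/
theorem exists_unique_penalizedSolution (D : ConstraintData ψ ρ η Mψ) (hT : 0 ≤ T)
    (hΦ : IsExtension (sweepingSet ψ) φ Φ K) (hf : RegularDynamics T (sweepingSet ψ) U f M) :
    ∃ γ₀, 0 < γ₀ ∧ ∀ γ, γ₀ ≤ γ → ∀ c ∈ approxSet ψ γ, ∀ u ∈ controls T U,
      ∃ x, IsPenalizedSolution T f Φ ψ γ c u x ∧ InW12 T x ∧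
        (∀ t ∈ Icc 0 T, x t ∈ approxSet ψ γ) ∧
        ∀ y, IsPenalizedSolution T f Φ ψ γ c u y → EqOn y x (Icc 0 T) := by
  obtain ⟨γ₀, hγ₀, h⟩ := D.exists_penalizedCurve hT (add_pos hf.pos hΦ.pos).le
  refine ⟨γ₀, hγ₀, fun γ hγ c hc u hu => ?_⟩
  have hg := boundedField_of_control hf hΦ hu
  obtain ⟨x, hx, hx0, hxγ⟩ := h γ hγ _ hg c hc
  exact ⟨x, ⟨hx.absCont, hx0, hc, hx.mem, hx.equation⟩, ⟨hx.absCont, hx.memLp_deriv D hg⟩, hxγ,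
    fun y hy => hy.penalizedCurve.eqOn D hT hg hx (hy.initial.trans hx0.symm)⟩

variable {γ : ℕ → ℝ} {X : ℕ → ℝ → E n}

theorem penalizedSequence_of_solutions (hΦ : IsExtension (sweepingSet ψ) φ Φ K)
    (hf : RegularDynamics T (sweepingSet ψ) U f M) {c : ℕ → E n} {u : ℕ → ℝ → E m}
    (hu : ∀ j, u j ∈ controls T U) (hγ0 : ∀ j, 0 < γ j) (hγ : Tendsto γ atTop atTop)
    (hc : Tendsto c atTop (𝓝 x₀)) (hX : ∀ j, IsPenalizedSolution T f Φ ψ (γ j) (c j) (u j) (X j)) :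
    PenalizedSequence T ψ (M + K) (fun j t y => fExt f Φ t y (u j t)) γ X x₀ where
  pos := hγ0
  tendsto := hγ
  field j := boundedField_of_control hf hΦ (hu j)
  curve j := (hX j).penalizedCurve
  initial_mem j := by rw [(hX j).initial]; exact (hX j).initial_mem
  initial := hc.congr fun j => (hX j).initial.symm

/-- For a fixed control, a uniform limit of penalized curves is the solution of the sweeping
process, and the multipliers subconverge. -/
theorem exists_limit_of_control (D : ConstraintData ψ ρ η Mψ) (hT : 0 < T)
    (hdom : {x | φ x < ⊤} = sweepingSet ψ) (hΦ : IsExtension (sweepingSet ψ) φ Φ K)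
    (hf : RegularDynamics T (sweepingSet ψ) U f M) (hx₀ : x₀ ∈ C₀) (hv : v ∈ controls T U)
    (h : PenalizedSequence T ψ (M + K) (fun _ t y => fExt f Φ t y (v t)) γ X x₀)
    (hx : TendstoUniformlyOn X x atTop (Icc 0 T)) :
    ∃ (s : ℕ → ℕ) (ξ : Fin r → ℝ → ℝ), StrictMono s ∧ MultipliersTendsto T ψ γ X s ξ ∧
      IsSlack T ψ x ξ ∧ IsUniqueSweepingSolution T f φ C₀ x₀ v x ∧
      IsLimitTriplet T f Φ ψ (M + K) η Mψ x v ξ := by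
  obtain ⟨s, ξ, hs, hξ, hsl⟩ := h.exists_isSlack D hT.le hx
  have hx' : TendstoUniformlyOn (fun j => X (s j)) x atTop (Icc 0 T) :=
    fun u hu => hs.tendsto_atTop.eventually (hx u hu)
  exact ⟨s, ξ, hs, hξ, hsl, isLimitTriplet_of_tendsto_control D hT hdom hΦ hf hx₀ (h.comp hs)
    (fun _ => hv) hx' hξ hv (Eventually.of_forall fun t => tendsto_const_nhds)⟩

end Assembly

end

end Sweeping

end

theorem mainTheorem2 {n m r : ℕ} (hr : 1 ≤ r) (T : ℝ) (hT : 0 < T)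
    (f : ℝ → Sweeping.E n → Sweeping.E m → Sweeping.E n)
    (U : ℝ → Set (Sweeping.E m))
    (ψ : Fin r → Sweeping.E n → ℝ) (φ : Sweeping.E n → EReal)
    (C C₀ : Set (Sweeping.E n)) (M ρ η Mψ : ℝ)
    -- the function `φ` and its domain `C`
    (hφbot : ∀ x, φ x ≠ ⊥) (hφlsc : LowerSemicontinuous φ)
    (hdom : {x | φ x < ⊤} = C) (hC : C = Sweeping.sweepingSet ψ)
    (hCne : C.Nonempty) (hCcomp : IsCompact C)
    -- the assumptions
    (hf : Sweeping.RegularDynamics T C U f M)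
    (hψ : Sweeping.SmoothConstraints ψ ρ)
    (hη : Sweeping.QualifiedConstraints ψ η)
    (hint : IsConnected (interior C))
    (hφ : Sweeping.RegularPotential C φ)
    (hC₀ : C₀ ⊆ C ∧ C₀.Nonempty ∧ IsClosed C₀)
    -- `2 Mψ` is a common Lipschitz constant of the gradients on `C + (ρ/2) B̄`
    (hMψ : 4 * η / ρ ≤ Mψ)
    (hMψLip : ∀ i, ∀ x ∈ Metric.cthickening (ρ / 2) C, ∀ y ∈ Metric.cthickening (ρ / 2) C,
      ‖gradient (ψ i) x - gradient (ψ i) y‖ ≤ 2 * Mψ * ‖x - y‖) :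
    -- `φ` has an extension `Φ`
    (∃ Φ K, Sweeping.IsExtension C φ Φ K) ∧
    -- and, for any such extension and any penalty sequence `γ`:
    ∀ (Φ : Sweeping.E n → ℝ) (K : ℝ), Sweeping.IsExtension C φ Φ K →
    ∀ (Mbar : ℝ), Mbar = M + K →
    ∀ (γ : ℕ → ℝ), (∀ k, 2 * Mbar / η < γ k) → Tendsto γ atTop atTop →
    ∃ k₃ : ℕ,
      -- well-posedness of the penalized equations and invariance of `C^γ`
      (∀ k ≥ k₃, (Sweeping.approxSet ψ (γ k)).Nonempty ∧
        ∀ c ∈ Sweeping.approxSet ψ (γ k), ∀ u ∈ Sweeping.controls T U,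
          ∃ x, Sweeping.IsPenalizedSolution T f Φ ψ (γ k) c u x ∧ Sweeping.InW12 T x ∧
            (∀ t ∈ Icc 0 T, x t ∈ Sweeping.approxSet ψ (γ k)) ∧
            ∀ y, Sweeping.IsPenalizedSolution T f Φ ψ (γ k) c u y → EqOn y x (Icc 0 T)) ∧
      -- Part (I)
      (∀ x₀ ∈ C₀, ∀ (c : ℕ → Sweeping.E n) (u : ℕ → ℝ → Sweeping.E m)
          (X : ℕ → ℝ → Sweeping.E n),
        Tendsto c atTop (𝓝 x₀) → (∀ k, u k ∈ Sweeping.controls T U) →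
        (∀ k ≥ k₃, Sweeping.IsPenalizedSolution T f Φ ψ (γ k) (c k) (u k) (X k)) →
        -- (i)
        (∃ (s : ℕ → ℕ) (x : ℝ → Sweeping.E n), StrictMono s ∧ (∀ j, k₃ ≤ s j) ∧
          TendstoUniformlyOn (fun j => X (s j)) x atTop (Icc 0 T) ∧
          Sweeping.WeakL2Tendsto T (fun j => deriv (X (s j))) (deriv x) ∧
          Sweeping.HasStateBounds T Mbar C x₀ x) ∧
        -- (ii)
        (∃ Mξ : ℝ, 0 < Mξ ∧ ∀ k ≥ k₃,
          MemLp (fun t => ∑ i, Sweeping.multiplier ψ (γ k) (X k) i t) 2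
            (Sweeping.timeMeasure T) ∧
          ∫ t, (∑ i, Sweeping.multiplier ψ (γ k) (X k) i t) ^ 2 ∂Sweeping.timeMeasure T
            ≤ Mξ) ∧
        (∀ (s : ℕ → ℕ) (x : ℝ → Sweeping.E n), StrictMono s → (∀ j, k₃ ≤ s j) →
          TendstoUniformlyOn (fun j => X (s j)) x atTop (Icc 0 T) →
          Sweeping.HasStateBounds T Mbar C x₀ x ∧
          ∃ (s' : ℕ → ℕ) (ξ : Fin r → ℝ → ℝ), StrictMono s' ∧
            Sweeping.MultipliersTendsto T ψ γ X (s ∘ s') ξ ∧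
            Sweeping.WeakL2Tendsto T
              (fun j t => ∑ i, Sweeping.multiplier ψ (γ (s (s' j))) (X (s (s' j))) i t)
              (fun t => ∑ i, ξ i t) ∧
            Sweeping.IsSlack T ψ x ξ) ∧
        -- (iii) and (iv), for any limits `x` and `ξ` along a common subsequence
        (∀ (s : ℕ → ℕ) (x : ℝ → Sweeping.E n) (ξ : Fin r → ℝ → ℝ),
          StrictMono s → (∀ j, k₃ ≤ s j) →
          TendstoUniformlyOn (fun j => X (s j)) x atTop (Icc 0 T) →
          Sweeping.MultipliersTendsto T ψ γ X s ξ →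
          (∀ v ∈ Sweeping.controls T U,
            (∀ᵐ t ∂Sweeping.timeMeasure T, Tendsto (fun j => u (s j) t) atTop (𝓝 (v t))) →
            Sweeping.IsUniqueSweepingSolution T f φ C₀ x₀ v x ∧
            Sweeping.IsLimitTriplet T f Φ ψ Mbar η Mψ x v ξ) ∧
          (Sweeping.RegularControlSets T U →
            (∀ᵐ t ∂Sweeping.timeMeasure T, ∀ y ∈ C, Convex ℝ (f t y '' U t)) →
            ∃ v ∈ Sweeping.controls T U,
              Sweeping.IsUniqueSweepingSolution T f φ C₀ x₀ v x ∧
              Sweeping.IsLimitTriplet T f Φ ψ Mbar η Mψ x v ξ))) ∧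
      -- Part (II)
      (∀ x₀ ∈ C₀, ∀ v ∈ Sweeping.controls T U,
        (∃ c : ℕ → Sweeping.E n, Tendsto c atTop (𝓝 x₀) ∧
          ∀ᶠ k in atTop, c k ∈ interior (Sweeping.innerApproxSet ψ Mbar η (γ k))) ∧
        ∃ x : ℝ → Sweeping.E n, Sweeping.IsUniqueSweepingSolution T f φ C₀ x₀ v x ∧
          ∀ (c : ℕ → Sweeping.E n) (X : ℕ → ℝ → Sweeping.E n), Tendsto c atTop (𝓝 x₀) →
            (∀ᶠ k in atTop, c k ∈ interior (Sweeping.innerApproxSet ψ Mbar η (γ k))) →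
            (∀ᶠ k in atTop, Sweeping.IsPenalizedSolution T f Φ ψ (γ k) (c k) v (X k)) →
            (∀ᶠ k in atTop, ∀ t ∈ Icc 0 T, X k t ∈ Sweeping.approxSet ψ (γ k)) ∧
            ∃ (s : ℕ → ℕ) (ξ : Fin r → ℝ → ℝ), StrictMono s ∧
              TendstoUniformlyOn (fun j => X (s j)) x atTop (Icc 0 T) ∧
              Sweeping.MultipliersTendsto T ψ γ X s ξ ∧
              Sweeping.WeakL2Tendsto T
                (fun j t => ∑ i, Sweeping.multiplier ψ (γ (s j)) (X (s j)) i t)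
                (fun t => ∑ i, ξ i t) ∧
              Sweeping.HasStateBounds T Mbar C x₀ x ∧
              Sweeping.IsSlack T ψ x ξ ∧
              Sweeping.IsLimitTriplet T f Φ ψ Mbar η Mψ x v ξ) := by
  subst hC
  have D : Sweeping.ConstraintData ψ ρ η Mψ := ⟨hCcomp, hCne, hψ, hη, hMψ, hMψLip⟩
  have hη0 : 0 < η := D.eta_pos
  refine ⟨D.exists_isExtension hφbot hdom hint.nonempty hφ, ?_⟩
  rintro Φ K hΦ _ rfl γ hγ hγt
  have hMK : 0 < M + K := add_pos hf.pos hΦ.pos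
  have hγ0 : ∀ k, 0 < γ k := fun k => lt_trans (by positivity) (hγ k)
  have hinner : ∀ k, interior (Sweeping.innerApproxSet ψ (M + K) η (γ k))
      ⊆ Sweeping.approxSet ψ (γ k) := fun k =>
    interior_subset.trans (Sweeping.innerApproxSet_subset hη0 hMK (hγ k))
  obtain ⟨γ₀, -, hwell⟩ := Sweeping.exists_unique_penalizedSolution D hT.le hΦ hf
  have hpts := fun x₀ (hx₀ : x₀ ∈ C₀) =>
    Sweeping.exists_tendsto_mem_interior_innerApproxSet D hMK (hC₀.1 hx₀) hγt
  have hne : ∀ᶠ k in atTop, (Sweeping.approxSet ψ (γ k)).Nonempty := by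
    obtain ⟨x₀, hx₀⟩ := hC₀.2.1
    obtain ⟨c, -, hc⟩ := hpts x₀ hx₀
    filter_upwards [hc] with k hk
    exact ⟨_, hinner k hk⟩
  obtain ⟨k₃, hk₃⟩ := eventually_atTop.1 (hne.and (hγt.eventually_ge_atTop γ₀))
  have hshift : ∀ k₀ : ℕ, StrictMono fun j : ℕ => j + k₀ := fun k₀ i j hij =>
    Nat.add_lt_add_right hij k₀
  refine ⟨k₃, fun k hk => ⟨(hk₃ k hk).1, hwell (γ k) (hk₃ k hk).2⟩, ?_, ?_⟩
  · intro x₀ hx₀ c u X hc hu hX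
    have hseq : ∀ s : ℕ → ℕ, StrictMono s → (∀ j, k₃ ≤ s j) →
        Sweeping.PenalizedSequence T ψ (M + K) (fun j t y => Sweeping.fExt f Φ t y (u (s j) t))
          (fun j => γ (s j)) (fun j => X (s j)) x₀ := fun s hs hsk =>
      Sweeping.penalizedSequence_of_solutions hΦ hf (fun j => hu (s j)) (fun j => hγ0 (s j))
        (hγt.comp hs.tendsto_atTop) (hc.comp hs.tendsto_atTop) (fun j => hX (s j) (hsk j))
    refine ⟨?_, ?_, ?_, ?_⟩
    · obtain ⟨s, x, hs, h⟩ := (hseq (fun j => j + k₃) (hshift k₃)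
        fun j => Nat.le_add_left _ _).exists_subseq D hT.le
      exact ⟨fun j => s j + k₃, x, (hshift k₃).comp hs, fun j => Nat.le_add_left _ _, h⟩
    · obtain ⟨Mξ, hMξ, h⟩ := Sweeping.exists_multiplier_bound D hT.le (M + K)
      refine ⟨Mξ, hMξ, fun k hk => ?_⟩
      refine h (γ k) _ (X k) (hγ0 k) (Sweeping.boundedField_of_control hf hΦ (hu k))
        (hX k hk).penalizedCurve ?_
      rw [(hX k hk).initial]
      exact (hX k hk).initial_mem
    · intro s x hs hsk hx
      obtain ⟨s', ξ, hs', hξ, hsl⟩ := (hseq s hs hsk).exists_isSlack D hT.le hx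
      exact ⟨(hseq s hs hsk).hasStateBounds D hT.le hx, s', ξ, hs', hξ,
        Sweeping.WeakL2Tendsto.sum hξ, hsl⟩
    · intro s x ξ hs hsk hx hξ
      exact ⟨fun v hv huv => Sweeping.isLimitTriplet_of_tendsto_control D hT hdom hΦ hf hx₀
          (hseq s hs hsk) (fun j => hu (s j)) hx hξ hv huv,
        fun hU hconv => Sweeping.exists_control_isLimitTriplet D hT hdom hΦ hf hx₀
          (hseq s hs hsk) (fun j => hu (s j)) hx hξ hU hconv⟩
  · intro x₀ hx₀ v hv
    have hseq : ∀ (k₀ : ℕ) (c : ℕ → Sweeping.E n) (X : ℕ → ℝ → Sweeping.E n),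
        Tendsto c atTop (𝓝 x₀) →
        (∀ k ≥ k₀, Sweeping.IsPenalizedSolution T f Φ ψ (γ k) (c k) v (X k)) →
        Sweeping.PenalizedSequence T ψ (M + K) (fun _ t y => Sweeping.fExt f Φ t y (v t))
          (fun j => γ (j + k₀)) (fun j => X (j + k₀)) x₀ := fun k₀ c X hc hX =>
      Sweeping.penalizedSequence_of_solutions hΦ hf (fun _ => hv) (fun j => hγ0 (j + k₀))
        (hγt.comp (hshift k₀).tendsto_atTop) (hc.comp (hshift k₀).tendsto_atTop)
        (fun j => hX (j + k₀) (Nat.le_add_left _ _))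
    have hsol : ∀ c : ℕ → Sweeping.E n,
        (∀ᶠ k in atTop, c k ∈ interior (Sweeping.innerApproxSet ψ (M + K) η (γ k))) →
        ∀ᶠ k in atTop, ∃ x, Sweeping.IsPenalizedSolution T f Φ ψ (γ k) (c k) v x ∧
          (∀ t ∈ Icc 0 T, x t ∈ Sweeping.approxSet ψ (γ k)) ∧
          ∀ y, Sweeping.IsPenalizedSolution T f Φ ψ (γ k) (c k) v y → EqOn y x (Icc 0 T) := by
      intro c hc
      filter_upwards [hc, hγt.eventually_ge_atTop γ₀] with k h1 h2
      obtain ⟨x, hx1, -, hx2⟩ := hwell (γ k) h2 (c k) (hinner k h1) v hv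
      exact ⟨x, hx1, hx2⟩
    refine ⟨hpts x₀ hx₀, ?_⟩
    -- the solution of `(D)` is the limit of the penalized curves for one choice of initial points
    have hex : ∃ x, Sweeping.IsUniqueSweepingSolution T f φ C₀ x₀ v x := by
      obtain ⟨c, hc, hcin⟩ := hpts x₀ hx₀
      obtain ⟨k₀, hk₀⟩ := eventually_atTop.1 (hsol c hcin)
      choose! X hX using hk₀
      have h := hseq k₀ c X hc fun k hk => (hX k hk).1
      obtain ⟨s, x, hs, hx, -, -⟩ := h.exists_subseq D hT.le
      obtain ⟨-, -, -, -, -, hu, -⟩ :=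
        Sweeping.exists_limit_of_control D hT hdom hΦ hf hx₀ hv (h.comp hs) hx
      exact ⟨x, hu⟩
    obtain ⟨x, hx⟩ := hex
    refine ⟨x, hx, fun c X hc hcin hX => ⟨?_, ?_⟩⟩
    · filter_upwards [hsol c hcin, hX] with k ⟨y, _, hy, huniq⟩ hXk t ht
      rw [huniq _ hXk ht]
      exact hy t ht
    · obtain ⟨k₀, hk₀⟩ := eventually_atTop.1 hX
      have h := hseq k₀ c X hc hk₀
      obtain ⟨s, y, hs, hy, -, -⟩ := h.exists_subseq D hT.le
      obtain ⟨-, -, -, -, -, hu, -⟩ :=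
        Sweeping.exists_limit_of_control D hT hdom hΦ hf hx₀ hv (h.comp hs) hy
      have hy' := hy.congr_right (hx.2 y hu.1)
      obtain ⟨s', ξ, hs', hξ, hsl, -, htrip⟩ :=
        Sweeping.exists_limit_of_control D hT hdom hΦ hf hx₀ hv (h.comp hs) hy'
      exact ⟨fun j => s (s' j) + k₀, ξ, (hshift k₀).comp (hs.comp hs'),
        fun w hw => hs'.tendsto_atTop.eventually (hy' w hw), hξ, Sweeping.WeakL2Tendsto.sum hξ,
        (h.comp hs).hasStateBounds D hT.le hy', hsl, htrip⟩
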